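/- Setting. Let $F$ be a totally real field, $M/F$ a totally imaginary quadratic extension with nontrivial automorphism $c$, and $l$ a prime such that every place of $F$ above $l$ is unramified over $\mathbb{Q}$ and splits in $M$. Let $S(B)$ be a finite set of finite places of $F$, all split in $M$ and prime to $l$. Let $B$ be a division algebra with centre $M$ and $\dim_M B=n^2$, such that $B_w$ is a division algebra for the places $w$ of $M$ above $S(B)$ and is split for all other $w$; let $\ddagger$ be an involution of $B$ with $\ddagger|_M=c$, and $G(R)=\{g\in B\otimes_F R: g^{\ddagger}g=1\}$, with $G(F_v)\cong U(n)$ for all $v\mid\infty$. Let $\mathcal{O}_B$ be a $\ddagger$-stable order of $B$ that is maximal at the places $w$ of $M$ split over $F$; it defines $G(\mathcal{O}_{F,v})$. For a place $v\notin S(B)$ of $F$ split in $M$ and $w\mid v$, fix $i_w:G(F_v)\cong \mathrm{GL}_n(M_w)$ induced by an isomorphism $B\otimes_M M_w\cong M_n(M_w)$ taking $\mathcal{O}_{B,w}$ to $M_n(\mathcal{O}_{M,w})$. Let $\tilde S_l$ be a set of places of $M$ containing exactly one place $\tilde v$ above each $v\mid l$ of $F$. Let $K=\overline{\mathbb{Q}}_l$,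 with ring of integers $\mathcal{O}$ and residue field $k$, and let $\tilde I_l$ be the set of $\tau\in\mathrm{Hom}(M,K)$ inducing a place in $\tilde S_l$. A weight is $a\in(\mathbb{Z}^n)^{\mathrm{Hom}(M,K)}$ with $a_{\tau,1}\ge\dots\ge a_{\tau,n}\ge 0$ for $\tau\in\tilde I_l$ and $a_{\tau c,i}=-a_{\tau,n+1-i}$ for all $\tau$. For $t_1\ge\dots\ge t_n\ge 0$ let $X_t\subset K[X_{i,j}]_{1\le i,j\le n}$ be the $\mathcal{O}$-span of the monomials of left weight $t$ in the minors $Y_{i,j}$ (first $i$ rows, columns $j_1<\dots<j_i$), where left weight $t$ means $f(d^{-1}X)=\prod_i d_i^{-t_i}f(X)$ for diagonal $d$. The group $\mathrm{GL}_n(\mathcal{O})$ acts on $X_t$ by $(gf)(X)=f(Xg)$, and $\alpha=\mathrm{diag}(l^{b_1},\dots,l^{b_n})$ with $b_1\ge\dots\ge b_n\ge0$ acts by the twisted action $l^{-\sum_i b_it_{n+1-i}}f(X\alpha)$. The lowest weight vector of $X_t$ is the monomial of right weight $(t_n,\dots,t_1)$, that is, with $f(Xd)=\prod_i d_i^{t_{n+1-i}}f(X)$.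 Let $U=\prod_vU_v$ be an open compact subgroup of $G(\mathbb{A}_F^\infty)$ with $U_v\subset G(\mathcal{O}_{F,v})$ for all $v$ and $U_v=G(\mathcal{O}_{F,v})$ for $v\in S(B)$, such that for $v\mid l$, $U_v$ is the Iwahori subgroup of matrices in $\mathrm{GL}_n(\mathcal{O}_{M,\tilde v})$ upper triangular mod $l$, and such that the projection of $U$ to some $G(F_v)$ has no nontrivial element of finite order. For $v\mid l$ let $U_v'\subset U_v$ be the subgroup of matrices that are unipotent mod $l$, let $\chi_v:U_v/U_v'\to\mathcal{O}^\times$ be characters, and put $\chi=\otimes_{v\mid l}\chi_v$. Let $Y_a=\bigotimes_{\tau\in\tilde I_l}X_{a_\tau}$, on which $u\in U$ acts on the factor at $\tau$ (inducing $\tilde v$) through $\tau(i_{\tilde v}(u_v))$, and $Y_{a,\chi}=Y_a\otimes_{\mathcal{O}}\chi$. For an $\mathcal{O}$-algebra $A$, let $S_{a,\chi}(U,A)$ be the space of functions $f:G(F)\backslash G(\mathbb{A}_F^\infty)\to A\otimes_{\mathcal{O}}Y_{a,\chi}$ with $f(gu)=u^{-1}f(g)$ for all $u\in U$. If $g$ has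 each component at $l$ of the form $\mathrm{diag}(l^{b_1},\dots,l^{b_n})$ with $b_1\ge\dots\ge b_n\ge0$, and $UgU=\coprod_i g_iU$ with $g_i\in Ug$, put $([UgU]f)(h)=\sum_i g_if(hg_i)$, where $g_i=u_ig$ acts on $Y_{a,\chi}$ through $u_i$ and the twisted action of the component of $g$ at $l$. Let $\mathbb{T}(U)$ be the polynomial $\mathcal{O}$-algebra on the symbols $T_w^{(j)}$ $(1\le j\le n)$ and $(T_w^{(n)})^{-1}$, for places $w$ of $M$ above places $v\nmid l$, $v\notin S(B)$ of $F$ that split in $M$ and have $U_v=G(\mathcal{O}_{F,v})$; $T_w^{(j)}$ acts as $[U\,\mathrm{diag}(\varpi_w,\dots,\varpi_w,1,\dots,1)\,U]$ with $j$ entries $\varpi_w$ (a uniformiser of $M_w$), and $(T_w^{(n)})^{-1}$ as the double coset operator of the inverse of $\mathrm{diag}(\varpi_w,\dots,\varpi_w)$. Let $u\in G(\mathbb{A}_F^\infty)$ be trivial away from $l$ with $u_v=\mathrm{diag}(l^{n-1},\dots,l,1)$ for $v\mid l$, put $U_l=[UuU]$ and $e_l=\lim_{m\to\infty}U_l^{m!}$,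 and let $S^{\mathrm{ord}}_{a,\chi}(U,k)=e_lS_{a,\chi}(U,k)$. For a weight $a$ let $\chi_a=\otimes_{v\mid l}\chi_{a,v}$, where $\chi_{a,v}:U_v/U_v'\to\mathcal{O}^\times$ sends a matrix with diagonal $(x_1,\dots,x_n)$ mod $l$ to $\prod_{\tau}\prod_i\tau(\tilde x_i)^{a_{\tau,n+1-i}}$, with $\tilde x_i$ the Teichmüller lift of $x_i$ and $\tau$ running over the elements of $\tilde I_l$ inducing $\tilde v$. Lemma. Let $a$ be a weight. Let $p:k\otimes_{\mathcal{O}}Y_a\to k\otimes_{\mathcal{O}}Y_0=k$ be the $k$-linear projection onto the tensor product of the lowest weight vectors, i.e. the map sending a tensor product of monomials $y_\tau\in X_{a_\tau}$ to $1$ if every $y_\tau$ is the lowest weight vector and to $0$ otherwise. Then $p$ is well defined and $f\mapsto p\circ f$ defines a $\mathbb{T}(U)$-equivariant isomorphism of $k$-vector spaces $$S^{\mathrm{ord}}_{a,\chi}(U,k)\;\xrightarrow{\ \sim\ }\;S^{\mathrm{ord}}_{0,\chi\chi_a}(U,k),$$ and both sides are stable under $\mathbb{T}(U)$. -/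

import Mathlib

open scoped TensorProduct NumberField

namespace UnitaryHida

/-! ## Algebraic modular forms and double coset operators on an abstract group -/

section AbstractForms

variable {𝒢 : Type*} [Group 𝒢] {A : Type*} [CommRing A] {V : Type*} [AddCommGroup V] [Module A V]

/-- Functions `f : Γ \ 𝒢 → V` with `f (g u) = u⁻¹ f g` for all `u ∈ U`. -/
def forms (Γ U : Subgroup 𝒢) (ρ : Representation A U V) : Submodule A (𝒢 → V) where
  carrier := {f | (∀ γ ∈ Γ, ∀ g, f (γ * g) = f g) ∧ ∀ (u : U) (g : 𝒢), f (g * u) = ρ u⁻¹ (f g)}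
  add_mem' := by
    rintro f f' ⟨h1, h2⟩ ⟨h1', h2'⟩
    refine ⟨fun γ hγ g => ?_, fun u g => ?_⟩
    · simp [h1 γ hγ, h1' γ hγ]
    · simp [h2, h2']
  zero_mem' := by simp
  smul_mem' := by
    rintro c f ⟨h1, h2⟩
    refine ⟨fun γ hγ g => ?_, fun u g => ?_⟩
    · simp [h1 γ hγ]
    · simp [h2]

/-- The subgroup `U ∩ g U g⁻¹` of `U`; one has `U g U = ∐ u g U`, where `u` runs over
representatives of `U / (U ∩ g U g⁻¹)`. -/
def cosetStab (U : Subgroup 𝒢) (g : 𝒢) : Subgroup U :=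
  (U.map (MulAut.conj g).toMonoidHom).subgroupOf U

theorem mem_cosetStab {U : Subgroup 𝒢} {g : 𝒢} {s : U} (hs : s ∈ cosetStab U g) :
    ∃ k : U, (s : 𝒢) * g = g * k := by
  obtain ⟨k, hk, hk'⟩ := (Subgroup.mem_subgroupOf.mp hs)
  refine ⟨⟨k, hk⟩, ?_⟩
  rw [← hk']
  simp

variable {Γ U : Subgroup 𝒢} {ρ : Representation A U V}

theorem hecke_term_eq {g : 𝒢} {γ : V →ₗ[A] V}
    (hγ : ∀ k k' : U, (k : 𝒢) * g = g * k' → ρ k ∘ₗ γ = γ ∘ₗ ρ k')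
    {f : 𝒢 → V} (hf : f ∈ forms Γ U ρ) (x : 𝒢) {r r' : U}
    (h : (r : U ⧸ cosetStab U g) = r') :
    ρ r (γ (f (x * r * g))) = ρ r' (γ (f (x * r' * g))) := by
  obtain ⟨s, hs, rfl⟩ : ∃ s ∈ cosetStab U g, r' = r * s :=
    ⟨r⁻¹ * r', QuotientGroup.eq.mp h, by group⟩
  obtain ⟨k, hk⟩ := mem_cosetStab hs
  have e : x * (r * s : U) * g = (x * r * g) * k := by
    simp only [Subgroup.coe_mul, mul_assoc, hk]
  have e2 := LinearMap.congr_fun (hγ s k hk) (ρ k⁻¹ (f (x * r * g)))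
  have e3 : ρ k (ρ k⁻¹ (f (x * r * g))) = f (x * r * g) := by
    rw [← Module.End.mul_apply, ← map_mul]; simp
  simp only [LinearMap.comp_apply, e3] at e2
  rw [e, hf.2 k, map_mul, Module.End.mul_apply, e2]

open Classical in
/-- The double coset operator `[U g U]`: writing `U g U = ∐ gᵢ U` with `gᵢ = uᵢ g`, `uᵢ ∈ U`,
it is `([U g U] f) x = ∑ᵢ gᵢ • f (x gᵢ)`, where `gᵢ = uᵢ g` acts on `V` as `ρ uᵢ ∘ γ`, the map `γ`
being the given action of `g` on `V`. The sum is over a finite set whenever `U` is open and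
compact in a topological group (the operator is set to be `0` if there are infinitely many
cosets). -/
noncomputable def heckeOperator (g : 𝒢) (γ : V →ₗ[A] V)
    (hγ : ∀ k k' : U, (k : 𝒢) * g = g * k' → ρ k ∘ₗ γ = γ ∘ₗ ρ k') :
    Module.End A (forms Γ U ρ) :=
  if hfin : Finite (U ⧸ cosetStab U g) then
    { toFun := fun f => ⟨fun x => ∑ᶠ c : U ⧸ cosetStab U g,
          ρ c.out (γ (f.1 (x * (c.out : U) * g))), by
        refine ⟨fun δ hδ x => finsum_congr fun c => ?_, fun k x => ?_⟩
        · rw [mul_assoc, mul_assoc, f.2.1 δ hδ, mul_assoc]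
        · rw [map_finsum _ (Set.toFinite _)]
          symm
          rw [← finsum_comp_equiv (MulAction.toPerm (α := U) (β := U ⧸ cosetStab U g) k)]
          refine finsum_congr fun c => ?_
          have h := hecke_term_eq hγ f.2 x (r := (k • c).out) (r' := k * c.out)
            (by
              rw [QuotientGroup.out_eq']
              conv_lhs => rw [← QuotientGroup.out_eq' c]
              rfl)
          simp only [MulAction.toPerm_apply]
          rw [h, ← Module.End.mul_apply, ← map_mul]
          simp [mul_assoc]⟩
      map_add' := fun f f' => by
        ext x
        simp only [Submodule.coe_add, Pi.add_apply, map_add]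
        exact finsum_add_distrib (Set.toFinite _) (Set.toFinite _)
      map_smul' := fun c f => by
        ext x
        simp only [Submodule.coe_smul, Pi.smul_apply, map_smul, RingHom.id_apply]
        exact (smul_finsum' c (Set.toFinite _)).symm }
  else 0

/-- For an endomorphism `T` of a module regarded as discrete, the image `e S` of the Hida idempotent
`e = lim_{n → ∞} T ^ n!`, that is the set of all limits of the sequences `T ^ n! f`. -/
def ordinaryPart {S : Type*} [AddCommMonoid S] [Module A S] (T : Module.End A S) :
    Submodule A S where
  carrier := {g | ∃ f, ∀ᶠ m : ℕ in Filter.atTop, (T ^ m.factorial) f = g}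
  add_mem' := by
    rintro g g' ⟨f, h⟩ ⟨f', h'⟩
    exact ⟨f + f', by filter_upwards [h, h'] with m e e'; rw [map_add, e, e']⟩
  zero_mem' := ⟨0, by simp⟩
  smul_mem' := by
    rintro c g ⟨f, h⟩
    exact ⟨c • f, by filter_upwards [h] with m e; rw [map_smul, e]⟩

end AbstractForms

/-! ## The lattices `X_t` in the irreducible algebraic representations of `GL_n` -/

section Lattice

variable (l : ℕ) [Fact l.Prime] {n : ℕ}

/-- The ring of integers of `K = ℚ̄_l`. -/
noncomputable abbrev OK : ValuationSubring (PadicAlgCl l) :=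
  (Valued.v : Valuation (PadicAlgCl l) NNReal).valuationSubring

/-- The residue field `k = 𝔽̄_l` of `ℚ̄_l`. -/
noncomputable abbrev kbar : Type := IsLocalRing.ResidueField (OK l)

/-- The polynomial ring `K[X_{i,j}]` in the entries of the generic `n × n` matrix, inside the
coordinate ring of `GL_n` over `K = ℚ̄_l`. -/
abbrev MatPoly (n : ℕ) : Type := MvPolynomial (Fin n × Fin n) (PadicAlgCl l)

variable {l}

/-- The minor `Y_{i,j}` of order `i + 1` of the generic matrix: the first `i + 1` rows and the
columns `j_0 < ⋯ < j_i` (indices start at `0`). -/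
noncomputable def minor (i : Fin n) (j : Fin (i + 1) ↪o Fin n) : MatPoly l n :=
  Matrix.det (Matrix.of fun r s : Fin (i + 1) =>
    (MvPolynomial.X (Fin.castLE i.2 r, j s) : MatPoly l n))

variable (l n) in
/-- The monomials in the minors `Y_{i,j}`. -/
noncomputable def minorMonomials : Submonoid (MatPoly l n) :=
  Submonoid.closure {f | ∃ i j, f = minor (l := l) (n := n) i j}

/-- The right action `(g_r f)(X) = f(X g)`. -/
noncomputable def rightAct (g : Matrix (Fin n) (Fin n) (PadicAlgCl l)) :
    MatPoly l n →ₐ[PadicAlgCl l] MatPoly l n :=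
  MvPolynomial.aeval fun p => ∑ m, MvPolynomial.X (p.1, m) * MvPolynomial.C (g m p.2)

/-- The left action `(d_l f)(X) = f(d⁻¹ X)` of the diagonal torus. -/
noncomputable def leftTorus (d : Fin n → (PadicAlgCl l)ˣ) :
    MatPoly l n →ₐ[PadicAlgCl l] MatPoly l n :=
  MvPolynomial.aeval fun p =>
    MvPolynomial.C ((d p.1)⁻¹ : (PadicAlgCl l)ˣ).val * MvPolynomial.X p

/-- The character `diag(d_1, …, d_n) ↦ ∏ d_i ^ t_i`. -/
noncomputable def torusChar (t : Fin n → ℤ) (d : Fin n → (PadicAlgCl l)ˣ) : (PadicAlgCl l)ˣ :=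
  ∏ i, d i ^ t i

/-- `f` has left weight `t`: `d_l f = t(d)⁻¹ f` for all diagonal `d`. -/
def IsLeftWeight (t : Fin n → ℤ) (f : MatPoly l n) : Prop :=
  ∀ d : Fin n → (PadicAlgCl l)ˣ,
    leftTorus d f = ((torusChar t d)⁻¹ : (PadicAlgCl l)ˣ).val • f

/-- `f` has right weight `t`: `d_r f = t(d) f` for all diagonal `d`. -/
def IsRightWeight (t : Fin n → ℤ) (f : MatPoly l n) : Prop :=
  ∀ d : Fin n → (PadicAlgCl l)ˣ,
    rightAct (Matrix.diagonal fun i => (d i).val) f = (torusChar t d).val • f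

variable (l) in
/-- The monomials in the `Y_{i,j}` of left weight `t`. -/
def weightMonomials (t : Fin n → ℤ) : Set (MatPoly l n) :=
  {f | f ∈ minorMonomials l n ∧ IsLeftWeight t f}

variable (l) in
/-- The lattice `X_t`: the `O_K`-span of the monomials in the `Y_{i,j}` of left weight `t`. -/
noncomputable def XLattice (t : Fin n → ℤ) : Submodule (OK l) (MatPoly l n) :=
  Submodule.span (OK l) (weightMonomials l t)

/-- The exponent `∑ b_i t_{n+1-i}`. -/
def twistExp (b : Fin n → ℕ) (t : Fin n → ℤ) : ℤ := ∑ i, (b i : ℤ) * t i.rev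

variable (l) in
/-- The diagonal matrix `diag(l ^ b_1, …, l ^ b_n)`. -/
noncomputable def lDiag {R : Type*} [CommRing R] (b : Fin n → ℕ) : Matrix (Fin n) (Fin n) R :=
  Matrix.diagonal fun i => (l : R) ^ b i

theorem rightAct_X (g : Matrix (Fin n) (Fin n) (PadicAlgCl l)) (p : Fin n × Fin n) :
    rightAct g (MvPolynomial.X p) =
      ∑ m, MvPolynomial.X (p.1, m) * MvPolynomial.C (g m p.2) := by
  simp [rightAct]

theorem rightAct_mul (g h : Matrix (Fin n) (Fin n) (PadicAlgCl l)) (f : MatPoly l n) :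
    rightAct (g * h) f = rightAct g (rightAct h f) := by
  suffices H : rightAct (g * h) = (rightAct (l := l) g).comp (rightAct h) by
    rw [H, AlgHom.comp_apply]
  refine MvPolynomial.algHom_ext fun p => ?_
  simp only [AlgHom.comp_apply, rightAct_X, map_sum, map_mul, MvPolynomial.algHom_C,
    MvPolynomial.algebraMap_eq, Matrix.mul_apply, Finset.sum_mul, Finset.mul_sum]
  rw [Finset.sum_comm]
  refine Finset.sum_congr rfl fun m _ => Finset.sum_congr rfl fun k _ => ?_
  ring

theorem rightAct_diagonal_X (d : Fin n → PadicAlgCl l) (p : Fin n × Fin n) :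
    rightAct (Matrix.diagonal d) (MvPolynomial.X p) =
      MvPolynomial.C (d p.2) * MvPolynomial.X p := by
  rw [rightAct_X, Finset.sum_eq_single p.2]
  · simp [mul_comm]
  · intro m _ hm; simp [Matrix.diagonal_apply_ne _ hm]
  · simp

theorem rightAct_one (f : MatPoly l n) : rightAct 1 f = f := by
  have h : (rightAct (l := l) (1 : Matrix (Fin n) (Fin n) (PadicAlgCl l))) =
      AlgHom.id (PadicAlgCl l) (MatPoly l n) := by
    refine MvPolynomial.algHom_ext fun p => ?_
    rw [← Matrix.diagonal_one, rightAct_diagonal_X, map_one, one_mul, AlgHom.id_apply]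
  exact DFunLike.congr_fun h f

theorem rightAct_diagonal_minor (d : Fin n → PadicAlgCl l) (i : Fin n)
    (j : Fin (i + 1) ↪o Fin n) :
    rightAct (Matrix.diagonal d) (minor i j) = (∏ s, d (j s)) • minor i j := by
  rw [minor, AlgHom.map_det]
  have : (rightAct (Matrix.diagonal d)).mapMatrix (Matrix.of fun r s : Fin (i + 1) =>
      (MvPolynomial.X (Fin.castLE i.2 r, j s) : MatPoly l n)) =
      Matrix.of fun r s => (MvPolynomial.C (d (j s)) : MatPoly l n) *
        (Matrix.of fun r s : Fin (i + 1) =>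
          (MvPolynomial.X (Fin.castLE i.2 r, j s) : MatPoly l n)) r s := by
    ext1 r s
    simp [rightAct_diagonal_X]
  rw [this, Matrix.det_mul_row, MvPolynomial.smul_eq_C_mul, map_prod]

theorem leftTorus_minor (d : Fin n → (PadicAlgCl l)ˣ) (i : Fin n) (j : Fin (i + 1) ↪o Fin n) :
    leftTorus d (minor i j) =
      (∏ r : Fin (i + 1), ((d (Fin.castLE i.2 r))⁻¹ : (PadicAlgCl l)ˣ).val) • minor i j := by
  rw [minor, AlgHom.map_det]
  have : (leftTorus d).mapMatrix (Matrix.of fun r s : Fin (i + 1) =>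
      (MvPolynomial.X (Fin.castLE i.2 r, j s) : MatPoly l n)) =
      Matrix.of fun r s =>
        (MvPolynomial.C ((d (Fin.castLE i.2 r))⁻¹ : (PadicAlgCl l)ˣ).val : MatPoly l n) *
        (Matrix.of fun r s : Fin (i + 1) =>
          (MvPolynomial.X (Fin.castLE i.2 r, j s) : MatPoly l n)) r s := by
    ext1 r s
    simp [leftTorus]
  rw [this, Matrix.det_mul_column, MvPolynomial.smul_eq_C_mul, map_prod]

/-- The left weight `(1, …, 1, 0, …, 0)` of a minor of order `i + 1`. -/
def minorWeight (i : Fin n) : Fin n → ℤ := fun r => if r ≤ i then 1 else 0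

theorem prod_castLE {C : Type*} [CommMonoid C] (i : Fin n) (F : Fin n → C) :
    ∏ r : Fin (i + 1), F (Fin.castLE i.2 r) = ∏ r, if r ≤ i then F r else 1 := by
  rw [← Finset.prod_filter]
  refine Finset.prod_bij (fun r _ => Fin.castLE i.2 r) ?_ ?_ ?_ ?_
  · intro r _
    simp only [Finset.mem_filter, Finset.mem_univ, true_and, Fin.le_def, Fin.val_castLE]
    omega
  · intro r _ r' _ h
    exact Fin.castLE_injective _ h
  · intro r hr
    simp only [Finset.mem_filter, Finset.mem_univ, true_and, Fin.le_def] at hr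
    exact ⟨⟨r, by omega⟩, Finset.mem_univ _, by ext; simp⟩
  · intros; rfl

theorem isLeftWeight_minor (i : Fin n) (j : Fin (i + 1) ↪o Fin n) :
    IsLeftWeight (minorWeight i) (minor (l := l) i j) := by
  intro d
  rw [leftTorus_minor]
  congr 1
  rw [prod_castLE i (fun r => ((d r)⁻¹ : (PadicAlgCl l)ˣ).val), torusChar,
    ← Finset.prod_inv_distrib, Units.coe_prod]
  refine Finset.prod_congr rfl fun r _ => ?_
  simp only [minorWeight]
  split_ifs <;> simp

theorem IsLeftWeight.mul {t t' : Fin n → ℤ} {f f' : MatPoly l n} (h : IsLeftWeight t f)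
    (h' : IsLeftWeight t' f') : IsLeftWeight (t + t') (f * f') := by
  intro d
  have : torusChar (t + t') d = torusChar t d * torusChar t' d := by
    simp [torusChar, zpow_add, Finset.prod_mul_distrib]
  rw [map_mul, h d, h' d, this, mul_inv, Units.val_mul, smul_mul_smul_comm]

theorem isLeftWeight_one : IsLeftWeight 0 (1 : MatPoly l n) := by
  intro d; simp [torusChar]

theorem minor_ne_zero (i : Fin n) (j : Fin (i + 1) ↪o Fin n) : minor (l := l) i j ≠ 0 := by
  intro h
  have := congrArg (MvPolynomial.aeval (R := PadicAlgCl l) fun p : Fin n × Fin n =>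
    if h : (p.1 : ℕ) < i + 1 then (if p.2 = j ⟨p.1, h⟩ then (1 : PadicAlgCl l) else 0) else 0) h
  rw [minor, AlgHom.map_det, map_zero] at this
  have e : (MvPolynomial.aeval (R := PadicAlgCl l) fun p : Fin n × Fin n =>
    if h : (p.1 : ℕ) < i + 1 then
      (if p.2 = j ⟨p.1, h⟩ then (1 : PadicAlgCl l) else 0) else 0).mapMatrix
      (Matrix.of fun r s : Fin (i + 1) =>
      (MvPolynomial.X (Fin.castLE i.2 r, j s) : MatPoly l n)) = 1 := by
    ext r s
    simp only [AlgHom.mapMatrix_apply, Matrix.map_apply, Matrix.of_apply, MvPolynomial.aeval_X,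
      Fin.val_castLE, r.2, dif_pos, Fin.eta, EmbeddingLike.apply_eq_iff_eq, Matrix.one_apply]
    simp [eq_comm]
  rw [e, Matrix.det_one] at this
  exact one_ne_zero this

theorem IsLeftWeight.unique {t t' : Fin n → ℤ} {f : MatPoly l n} (hf : f ≠ 0)
    (h : IsLeftWeight t f) (h' : IsLeftWeight t' f) : t = t' := by
  have hl : (l : PadicAlgCl l) ≠ 0 := Nat.cast_ne_zero.mpr (Fact.out : l.Prime).ne_zero
  have hn : ‖(l : PadicAlgCl l)‖ = (l : ℝ)⁻¹ := by
    have := PadicAlgCl.norm_extends l (l : ℚ_[l])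
    simpa using this
  funext i
  have h1 := (h (Function.update 1 i (Units.mk0 _ hl))).symm.trans
    (h' (Function.update 1 i (Units.mk0 _ hl)))
  have h2 := smul_left_injective (PadicAlgCl l) hf h1
  have key : ∀ t : Fin n → ℤ, torusChar t (Function.update 1 i (Units.mk0 (l : PadicAlgCl l) hl)) =
      Units.mk0 (l : PadicAlgCl l) hl ^ t i := by
    intro t
    rw [torusChar, Finset.prod_eq_single i]
    · simp
    · intro b _ hb; simp [Function.update_of_ne hb]
    · simp
  rw [key, key] at h2
  have h3 := congrArg norm h2
  simp only [Units.val_inv_eq_inv_val, Units.val_zpow_eq_zpow_val, Units.val_mk0, norm_inv,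
    norm_zpow, hn, inv_zpow, inv_inv] at h3
  exact zpow_right_injective₀ (by exact_mod_cast (Fact.out : l.Prime).pos)
    (by exact_mod_cast (Fact.out : l.Prime).one_lt.ne') h3

theorem XLattice_mul {p q : Fin n → ℤ} {f f' : MatPoly l n} (hf : f ∈ XLattice l p)
    (hf' : f' ∈ XLattice l q) : f * f' ∈ XLattice l (p + q) := by
  have h := Submodule.mul_mem_mul hf hf'
  rw [XLattice, XLattice, Submodule.span_mul_span] at h
  refine Submodule.span_mono ?_ h
  rintro _ ⟨x, hx, y, hy, rfl⟩
  exact ⟨mul_mem hx.1 hy.1, hx.2.mul hy.2⟩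

theorem rightAct_minor_mem {g : Matrix (Fin n) (Fin n) (PadicAlgCl l)}
    (hg : ∀ i j, g i j ∈ OK l) (i : Fin n) (j : Fin (i + 1) ↪o Fin n) :
    rightAct g (minor i j) ∈ XLattice l (minorWeight i) := by
  set v : Fin n → Fin (i + 1) → MatPoly l n :=
    fun m r => MvPolynomial.X (Fin.castLE i.2 r, m) with hv
  have e : rightAct g (minor i j) =
      ∑ κ : Fin (i + 1) → Fin n, (∏ s, (MvPolynomial.C (g (κ s) (j s)) : MatPoly l n)) •
        Matrix.detRowAlternating (fun s => v (κ s)) := by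
    rw [minor, AlgHom.map_det, ← Matrix.det_transpose]
    change Matrix.detRowAlternating _ = _
    have : ((rightAct g).mapMatrix (Matrix.of fun r s : Fin (i + 1) =>
        (MvPolynomial.X (Fin.castLE i.2 r, j s) : MatPoly l n))).transpose =
        fun s => ∑ m, (MvPolynomial.C (g m (j s)) : MatPoly l n) • v m := by
      funext s r
      simp [rightAct_X, hv, Finset.sum_apply, mul_comm]
    rw [this]
    have h2 := (Matrix.detRowAlternating (n := Fin (i + 1)) (R := MatPoly l n)).toMultilinearMap.map_sum
      (fun (s : Fin (i + 1)) (m : Fin n) => (MvPolynomial.C (g m (j s)) : MatPoly l n) • v m)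
    refine h2.trans (Finset.sum_congr rfl fun κ _ => ?_)
    exact MultilinearMap.map_smul_univ _ _ _
  rw [e]
  refine Submodule.sum_mem _ fun κ _ => ?_
  have hs : (∏ s, (MvPolynomial.C (g (κ s) (j s)) : MatPoly l n)) =
      MvPolynomial.C (∏ s, g (κ s) (j s)) := (map_prod _ _ _).symm
  have hO : (∏ s, g (κ s) (j s)) ∈ OK l := prod_mem fun s _ => hg _ _
  rw [hs, smul_eq_mul, ← MvPolynomial.smul_eq_C_mul]
  refine Submodule.smul_mem (XLattice l (minorWeight i)) (⟨_, hO⟩ : OK l) ?_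
  by_cases hκ : Function.Injective κ
  · have hmono : StrictMono (κ ∘ Tuple.sort κ) :=
      (Tuple.monotone_sort κ).strictMono_of_injective (hκ.comp (Tuple.sort κ).injective)
    have h3 := (Matrix.detRowAlternating (n := Fin (i + 1)) (R := MatPoly l n)).map_perm
      (fun s => v (κ s)) (Tuple.sort κ)
    have h4 : Matrix.detRowAlternating ((fun s => v (κ s)) ∘ Tuple.sort κ) =
        minor i (OrderEmbedding.ofStrictMono _ hmono) := by
      rw [minor, ← Matrix.det_transpose]
      rfl
    have hmem : minor i (OrderEmbedding.ofStrictMono _ hmono) ∈ XLattice l (minorWeight i) :=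
      Submodule.subset_span ⟨Submonoid.subset_closure ⟨_, _, rfl⟩, isLeftWeight_minor _ _⟩
    have h5 := h3.symm.trans h4
    rcases Int.units_eq_one_or (Equiv.Perm.sign (Tuple.sort κ)) with h | h
    · rw [h, one_smul] at h5
      rw [h5]; exact hmem
    · rw [h, Units.neg_smul, one_smul, neg_eq_iff_eq_neg] at h5
      rw [h5]; exact neg_mem hmem
  · have hv' : ¬ Function.Injective (fun s => v (κ s)) := fun h => hκ fun a b hab =>
      h (congrArg v hab)
    rw [AlternatingMap.map_eq_zero_of_not_injective _ (fun s => v (κ s)) hv']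
    exact zero_mem _

theorem orderEmb_le {i : Fin n} (j : Fin (i + 1) ↪o Fin n) (s : Fin (i + 1)) :
    j s ≤ (Fin.castLE i.2 s.rev).rev := by
  have key : ∀ m : ℕ, ∀ s : Fin (i + 1), (hm : (s : ℕ) + m < i + 1) →
      (j s : ℕ) + m ≤ j ⟨s + m, hm⟩ := by
    intro m
    induction m with
    | zero => intro s hm; simp
    | succ m ih =>
      intro s hm
      have h1 := ih s (by omega)
      have h2 : j ⟨s + m, by omega⟩ < j ⟨s + (m + 1), hm⟩ := by
        rw [OrderEmbedding.lt_iff_lt, Fin.lt_def]; simp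
      rw [Fin.lt_def] at h2
      omega
  have h := key (i - s) s (by omega)
  have h' := (j ⟨s + (i - s), by omega⟩).2
  rw [Fin.le_def]
  simp only [Fin.val_rev, Fin.val_castLE]
  omega

theorem twistExp_minorWeight_le {b : Fin n → ℕ} (hb : Antitone b) (i : Fin n)
    (j : Fin (i + 1) ↪o Fin n) : twistExp b (minorWeight i) ≤ ∑ s, (b (j s) : ℤ) := by
  have e : twistExp b (minorWeight i) = ∑ s : Fin (i + 1), (b (Fin.castLE i.2 s.rev).rev : ℤ) := by
    have h1 : twistExp b (minorWeight i) = ∑ r : Fin n, (b r.rev : ℤ) * minorWeight i r := by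
      rw [twistExp, ← Equiv.sum_comp Fin.revPerm]
      simp
    have h2 := prod_castLE (C := Multiplicative ℤ) i (fun r => Multiplicative.ofAdd (b r.rev : ℤ))
    have h3 : ∑ r : Fin (i + 1), (b (Fin.castLE i.2 r).rev : ℤ) =
        ∑ r : Fin n, if r ≤ i then (b r.rev : ℤ) else 0 := h2
    rw [h1, ← Equiv.sum_comp Fin.revPerm (fun s : Fin (i + 1) =>
      (b (Fin.castLE i.2 s.rev).rev : ℤ))]
    simp only [Fin.revPerm_apply, Fin.rev_rev]
    rw [h3]
    refine Finset.sum_congr rfl fun r _ => ?_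
    simp [minorWeight]
  rw [e]
  exact Finset.sum_le_sum fun s _ => by exact_mod_cast hb (orderEmb_le j s)

theorem twistExp_add (b : Fin n → ℕ) (p q : Fin n → ℤ) :
    twistExp b (p + q) = twistExp b p + twistExp b q := by
  simp [twistExp, mul_add, Finset.sum_add_distrib]

theorem natCast_l_ne_zero : (l : PadicAlgCl l) ≠ 0 :=
  Nat.cast_ne_zero.mpr (Fact.out : l.Prime).ne_zero

theorem minorMonomials_spec {f : MatPoly l n} (hf : f ∈ minorMonomials l n) :
    f ≠ 0 ∧ ∃ p : Fin n → ℤ, IsLeftWeight p f ∧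
      (∀ g : Matrix (Fin n) (Fin n) (PadicAlgCl l), (∀ i j, g i j ∈ OK l) →
        rightAct g f ∈ XLattice l p) ∧
      ∀ b : Fin n → ℕ, Antitone b → ∃ s : ℕ, rightAct (lDiag l b) f =
        ((l : PadicAlgCl l) ^ twistExp b p * (l : PadicAlgCl l) ^ s) • f := by
  induction hf using Submonoid.closure_induction with
  | mem f h =>
    obtain ⟨i, j, rfl⟩ := h
    refine ⟨minor_ne_zero i j, minorWeight i, isLeftWeight_minor i j,
      fun g hg => rightAct_minor_mem hg i j, fun b hb => ?_⟩
    obtain ⟨s, hs⟩ := Int.le.dest (twistExp_minorWeight_le hb i j)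
    refine ⟨s, ?_⟩
    rw [lDiag, rightAct_diagonal_minor, ← zpow_natCast _ s, ← zpow_add₀ natCast_l_ne_zero, hs,
      Finset.prod_pow_eq_pow_sum, ← zpow_natCast]
    push_cast
    rfl
  | one =>
    refine ⟨one_ne_zero, 0, isLeftWeight_one, fun g _ => ?_, fun b _ => ⟨0, ?_⟩⟩
    · rw [map_one]
      exact Submodule.subset_span ⟨one_mem _, isLeftWeight_one⟩
    · simp [twistExp]
  | mul f f' _ _ h h' =>
    obtain ⟨h0, p, h1, h2, h3⟩ := h
    obtain ⟨h0', p', h1', h2', h3'⟩ := h'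
    refine ⟨mul_ne_zero h0 h0', p + p', h1.mul h1', fun g hg => ?_, fun b hb => ?_⟩
    · rw [map_mul]; exact XLattice_mul (h2 g hg) (h2' g hg)
    · obtain ⟨s, hs⟩ := h3 b hb
      obtain ⟨s', hs'⟩ := h3' b hb
      refine ⟨s + s', ?_⟩
      rw [map_mul, hs, hs', smul_mul_smul_comm, twistExp_add, zpow_add₀ natCast_l_ne_zero, pow_add]
      congr 1
      ring

theorem rightAct_mem {g : Matrix (Fin n) (Fin n) (PadicAlgCl l)} (hg : ∀ i j, g i j ∈ OK l)
    {t : Fin n → ℤ} {f : MatPoly l n} (hf : f ∈ XLattice l t) : rightAct g f ∈ XLattice l t := by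
  induction hf using Submodule.span_induction with
  | mem f h =>
    obtain ⟨h0, p, h1, h2, -⟩ := minorMonomials_spec h.1
    rw [h.2.unique h0 h1]
    exact h2 g hg
  | zero => simp
  | add x y _ _ hx hy => rw [map_add]; exact add_mem hx hy
  | smul c x _ hx =>
    have : rightAct g (c • x) = c • rightAct g x :=
      map_smul (rightAct g) (c : PadicAlgCl l) x
    rw [this]; exact Submodule.smul_mem _ c hx

theorem natCast_mem_OK (m : ℕ) : (m : PadicAlgCl l) ∈ OK l := natCast_mem _ m

theorem twist_mem {b : Fin n → ℕ} (hb : Antitone b) {t : Fin n → ℤ} {f : MatPoly l n}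
    (hf : f ∈ XLattice l t) :
    (l : PadicAlgCl l) ^ (-twistExp b t) • rightAct (lDiag l b) f ∈ XLattice l t := by
  induction hf using Submodule.span_induction with
  | mem f h =>
    obtain ⟨h0, p, h1, -, h3⟩ := minorMonomials_spec h.1
    obtain ⟨s, hs⟩ := h3 b hb
    rw [h.2.unique h0 h1, hs, smul_smul, ← mul_assoc, ← zpow_add₀ natCast_l_ne_zero,
      neg_add_cancel, zpow_zero, one_mul]
    rw [← h.2.unique h0 h1]
    exact Submodule.smul_mem (XLattice l t) (⟨_, pow_mem (natCast_mem_OK l) s⟩ : OK l)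
      (Submodule.subset_span h)
  | zero => simp
  | add x y _ _ hx hy => rw [map_add, smul_add]; exact add_mem hx hy
  | smul c x _ hx =>
    have : rightAct (lDiag l b) (c • x) = c • rightAct (lDiag l b) x :=
      map_smul (rightAct (lDiag l b)) (c : PadicAlgCl l) x
    rw [this, smul_comm]; exact Submodule.smul_mem _ c hx

/-- The natural action on `X_t` of a matrix with entries in `O_K`. -/
noncomputable def latticeAct (t : Fin n → ℤ) (g : Matrix (Fin n) (Fin n) (PadicAlgCl l))
    (hg : ∀ i j, g i j ∈ OK l) : XLattice l t →ₗ[OK l] XLattice l t :=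
  ((rightAct g).toLinearMap.restrictScalars (OK l)).restrict fun _ hf => rightAct_mem hg hf

theorem latticeAct_one (t : Fin n → ℤ) {g : Matrix (Fin n) (Fin n) (PadicAlgCl l)}
    (hg : ∀ i j, g i j ∈ OK l) (h : g = 1) : latticeAct t g hg = 1 := by
  subst h
  refine LinearMap.ext fun f => Subtype.ext ?_
  exact rightAct_one _

theorem latticeAct_mul (t : Fin n → ℤ) {g g₁ g₂ : Matrix (Fin n) (Fin n) (PadicAlgCl l)}
    (hg : ∀ i j, g i j ∈ OK l) (hg₁ : ∀ i j, g₁ i j ∈ OK l) (hg₂ : ∀ i j, g₂ i j ∈ OK l)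
    (h : g = g₁ * g₂) : latticeAct t g hg = latticeAct t g₁ hg₁ * latticeAct t g₂ hg₂ := by
  subst h
  refine LinearMap.ext fun f => Subtype.ext ?_
  exact rightAct_mul _ _ _

/-- The twisted action on `X_t` of `diag(l ^ b_1, …, l ^ b_n)` for `b_1 ≥ ⋯ ≥ b_n ≥ 0`: the natural
action multiplied by `l ^ (-∑ b_i t_{n+1-i})`. -/
noncomputable def twistAct (t : Fin n → ℤ) (b : Fin n → ℕ) (hb : Antitone b) :
    XLattice l t →ₗ[OK l] XLattice l t :=
  (((l : PadicAlgCl l) ^ (-twistExp b t)) •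
    (rightAct (lDiag l b)).toLinearMap |>.restrictScalars (OK l)).restrict
      fun _ hf => twist_mem hb hf

theorem latticeAct_comp_twistAct (t : Fin n → ℤ) {g g' : Matrix (Fin n) (Fin n) (PadicAlgCl l)}
    (hg : ∀ i j, g i j ∈ OK l) (hg' : ∀ i j, g' i j ∈ OK l) {b : Fin n → ℕ} (hb : Antitone b)
    (h : g * lDiag l b = lDiag l b * g') :
    latticeAct t g hg ∘ₗ twistAct t b hb = twistAct t b hb ∘ₗ latticeAct t g' hg' := by
  refine LinearMap.ext fun f => Subtype.ext ?_
  change rightAct g ((l : PadicAlgCl l) ^ (-twistExp b t) • rightAct (lDiag l b) f.1) =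
    (l : PadicAlgCl l) ^ (-twistExp b t) • rightAct (lDiag l b) (rightAct g' f.1)
  rw [map_smul, ← rightAct_mul, ← rightAct_mul, h]

end Lattice

/-! ## The definite unitary group -/

section Unitary

set_option linter.unusedSectionVars false

open IsDedekindDomain

variable (F : Type*) {M : Type*} [Field F] [NumberField F] [Field M] [NumberField M] [Algebra F M]

/-- The place of `F` below a finite place `w` of `M`. -/
noncomputable def below (w : HeightOneSpectrum (𝓞 M)) : HeightOneSpectrum (𝓞 F) where
  asIdeal := w.asIdeal.under (𝓞 F)
  isPrime := inferInstance
  ne_bot := by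
    have := w.isPrime
    exact Ideal.IsIntegral.comap_ne_bot (𝓞 F) w.ne_bot

instance (w : HeightOneSpectrum (𝓞 M)) : w.asIdeal.LiesOver (below F w).asIdeal := ⟨rfl⟩

variable (M) in
/-- The finite place `v` of `F` splits in the quadratic extension `M`. -/
def IsSplit (v : HeightOneSpectrum (𝓞 F)) : Prop := (v.asIdeal.primesOver (𝓞 M)).ncard = 2

/-- The embedding `F_v → M_w` for `w ∣ v`: the continuous extension of `F → M`. -/
noncomputable def placeMap (w : HeightOneSpectrum (𝓞 M)) :
    (below F w).adicCompletion F →ₐ[F] w.adicCompletion M where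
  toRingHom := ((HeightOneSpectrum.adicCompletion.equiv M w).symm.toRingHom.comp
    (UniformSpace.Completion.mapRingHom (algebraMap (WithVal ((below F w).valuation F))
      (WithVal (w.valuation M)))
      (HeightOneSpectrum.uniformContinuous_algebraMap_liesOver F M (below F w) w).continuous)).comp
    (HeightOneSpectrum.adicCompletion.equiv F (below F w)).toRingHom
  commutes' x := by
    apply HeightOneSpectrum.adicCompletion.ext
    exact UniformSpace.Completion.mapRingHom_coe
      (HeightOneSpectrum.uniformContinuous_algebraMap_liesOver F M (below F w) w).continuous
      ((WithVal.equiv ((below F w).valuation F)).symm x)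

/-- Evaluation of a finite adele of `F` at a finite place. -/
noncomputable def evalAt (v : HeightOneSpectrum (𝓞 F)) :
    FiniteAdeleRing (𝓞 F) F →ₐ[F] v.adicCompletion F where
  toFun x := x v
  map_one' := rfl
  map_mul' _ _ := rfl
  map_zero' := rfl
  map_add' _ _ := rfl
  commutes' _ := rfl

variable (M)
variable (B : Type*) [DivisionRing B] [Algebra M B] [Algebra F B] [IsScalarTower F M B]

variable {F M B} in
/-- The integral elements of the base change `R ⊗_k B` (where `k` is `F` or `M`): sums of elements `r ⊗ b`
with `r` in a given subring of `R` and `b` in a given order of `B`. -/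
def orderSpan (k : Type*) {R : Type*} [Field k] [CommRing R] [Algebra k R] [Algebra k B] (R₀ : Set R)
    (Λ : Set B) : AddSubgroup (R ⊗[k] B) :=
  AddSubgroup.closure {x | ∃ r ∈ R₀, ∃ b ∈ Λ, x = r ⊗ₜ[k] b}

/-- The data defining the unitary group: a division algebra `B` with centre `M`, of dimension `n²`,
an involution `‡` of the second kind which is positive definite at infinity, a `‡`-stable order
`𝓞_B`, and identifications of `𝓞_{B,w}` with `M_n(𝓞_{M,w})` at places `w` which are split over `F`
and do not divide a place in the finite set `S = S(B)` of ramified places. -/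
structure UnitaryDatum (n : ℕ) where
  /-- the nontrivial automorphism `c` of `M / F` -/
  conj : M ≃ₐ[F] M
  conj_ne : conj ≠ AlgEquiv.refl
  finrank_eq : Module.finrank M B = n ^ 2
  /-- the set `S(B)` -/
  S : Finset (HeightOneSpectrum (𝓞 F))
  split_S : ∀ v ∈ S, IsSplit F M v
  division_S : ∀ w : HeightOneSpectrum (𝓞 M), below F w ∈ S →
    ∀ x : w.adicCompletion M ⊗[M] B, x ≠ 0 → IsUnit x
  matrix_not_S : ∀ w : HeightOneSpectrum (𝓞 M), below F w ∉ S →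
    Nonempty (w.adicCompletion M ⊗[M] B ≃ₐ[w.adicCompletion M]
      Matrix (Fin n) (Fin n) (w.adicCompletion M))
  /-- the involution `‡` -/
  inv : B →ₗ[F] B
  inv_mul : ∀ x y, inv (x * y) = inv y * inv x
  inv_inv : ∀ x, inv (inv x) = x
  inv_algebraMap : ∀ m : M, inv (algebraMap M B m) = algebraMap M B (conj m)
  /-- at every real place `σ` of `F` there is an isomorphism of `B ⊗_{F,σ} ℝ` with `M_n(ℂ)` under
  which `‡` corresponds to the conjugate transpose, so that `G(F_σ) ≅ U(n)` -/
  definite : ∀ σ : F →+* ℝ, ∃ Θ : B →+* Matrix (Fin n) (Fin n) ℂ,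
    (∀ x : F, Θ (algebraMap F B x) = Matrix.scalar (Fin n) (σ x : ℂ)) ∧
      ∀ b, Θ (inv b) = (Θ b).conjTranspose
  /-- the order `𝓞_B` -/
  OB : Subalgebra (𝓞 M) B
  OB_finite : Module.Finite (𝓞 M) OB
  OB_span : Submodule.span M (OB : Set B) = ⊤
  OB_inv : ∀ b ∈ OB, inv b ∈ OB
  /-- `𝓞_{B,w}` is a maximal order for every `w` which is split over `F` -/
  OB_maximal : ∀ w : HeightOneSpectrum (𝓞 M), IsSplit F M (below F w) →
    ∀ Λ : Subring (w.adicCompletion M ⊗[M] B),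
      (∀ x ∈ orderSpan M (w.adicCompletionIntegers M : Set (w.adicCompletion M)) (OB : Set B),
        x ∈ Λ) →
      (∃ r : w.adicCompletion M, r ≠ 0 ∧ ∀ x ∈ Λ, r • x ∈ orderSpan M
        (w.adicCompletionIntegers M : Set (w.adicCompletion M)) (OB : Set B)) →
      ∀ x ∈ Λ, x ∈ orderSpan M
        (w.adicCompletionIntegers M : Set (w.adicCompletion M)) (OB : Set B)
  /-- the identification `i_w : B ⊗_M M_w ≅ M_n(M_w)`, restricted to `B` -/
  iso : ∀ w : HeightOneSpectrum (𝓞 M), IsSplit F M (below F w) → below F w ∉ S →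
    B →ₐ[M] Matrix (Fin n) (Fin n) (w.adicCompletion M)
  /-- `i_w` maps `𝓞_{B,w}` onto `M_n(𝓞_{M,w})` -/
  iso_OB : ∀ w hw hw', (Submodule.span (w.adicCompletionIntegers M) (iso w hw hw' '' OB) :
      Set (Matrix (Fin n) (Fin n) (w.adicCompletion M))) =
    {X | ∀ i j, X i j ∈ w.adicCompletionIntegers M}

variable {F M B} {n : ℕ}

namespace UnitaryDatum

variable (D : UnitaryDatum F M B n)

section Points

variable (R : Type*) [CommRing R] [Algebra F R]

/-- The map `‡ ⊗ 1` on `R ⊗_F B`. -/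
noncomputable def adj : R ⊗[F] B →ₗ[F] R ⊗[F] B := D.inv.lTensor R

theorem adj_mul (x y : R ⊗[F] B) : D.adj R (x * y) = D.adj R y * D.adj R x := by
  induction x using TensorProduct.induction_on with
  | zero => simp
  | add x x' h h' => rw [add_mul, map_add, h, h', map_add, mul_add]
  | tmul r b =>
    induction y using TensorProduct.induction_on with
    | zero => simp
    | add y y' h h' => rw [mul_add, map_add, h, h', map_add, add_mul]
    | tmul r' b' =>
      simp [adj, Algebra.TensorProduct.tmul_mul_tmul, D.inv_mul, mul_comm r r']

theorem inv_one : D.inv 1 = 1 := by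
  have := D.inv_algebraMap 1
  simpa using this

theorem adj_one : D.adj R 1 = 1 := by
  simp [adj, Algebra.TensorProduct.one_def, D.inv_one]

/-- The group `G(R) = {g ∈ (R ⊗_F B)ˣ : g^‡ g = 1}` for an `F`-algebra `R`. -/
def G : Subgroup (R ⊗[F] B)ˣ where
  carrier := {g | D.adj R g.val * g.val = 1}
  one_mem' := by simp [adj_one]
  mul_mem' := by
    intro g h hg hh
    simp only [Set.mem_ofPred_eq, Units.val_mul, adj_mul] at *
    rw [mul_assoc, ← mul_assoc _ g.val, hg, one_mul, hh]
  inv_mem' := by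
    intro g hg
    simp only [Set.mem_ofPred_eq] at *
    have h : D.adj R g.val = (g⁻¹).val := by
      rw [← mul_one (D.adj R g.val), ← Units.mul_inv g, ← mul_assoc, hg, one_mul]
    change D.adj R (g⁻¹).val * (g⁻¹).val = 1
    rw [← h, ← adj_mul, h, Units.mul_inv, adj_one]

variable {R} {R' : Type*} [CommRing R'] [Algebra F R']

theorem adj_map (f : R →ₐ[F] R') (x : R ⊗[F] B) :
    D.adj R' (Algebra.TensorProduct.map f (AlgHom.id F B) x) =
      Algebra.TensorProduct.map f (AlgHom.id F B) (D.adj R x) := by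
  induction x using TensorProduct.induction_on with
  | zero => simp
  | add x x' h h' => simp only [map_add, h, h']
  | tmul r b => simp [adj]

/-- The map `G(R) → G(R')` induced by a homomorphism of `F`-algebras `R → R'`. -/
noncomputable def mapG (f : R →ₐ[F] R') : D.G R →* D.G R' :=
  ((Units.map (Algebra.TensorProduct.map f (AlgHom.id F B) : _ →* _)).comp
    (D.G R).subtype).codRestrict (D.G R') fun g => by
      have h : D.adj R g.1.val * g.1.val = 1 := g.2
      change D.adj R' (Algebra.TensorProduct.map f (AlgHom.id F B) g.1.val) *
        Algebra.TensorProduct.map f (AlgHom.id F B) g.1.val = 1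
      rw [adj_map, ← map_mul, h, map_one]

end Points

/-- The group `G(𝔸_F^∞)`. -/
abbrev GA : Type _ := D.G (FiniteAdeleRing (𝓞 F) F)

/-- `G(𝔸_F^∞)` has the subspace topology from the finite free `𝔸_F^∞`-module `𝔸_F^∞ ⊗_F B`. -/
noncomputable instance : TopologicalSpace D.GA :=
  TopologicalSpace.induced (fun g => g.1.val)
    (moduleTopology (FiniteAdeleRing (𝓞 F) F) (FiniteAdeleRing (𝓞 F) F ⊗[F] B))

/-- The subgroup `G(F)` of `G(𝔸_F^∞)`. -/
noncomputable def GF : Subgroup D.GA := (D.mapG (Algebra.ofId F (FiniteAdeleRing (𝓞 F) F))).range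

/-- The component `G(𝔸_F^∞) → G(F_v)` at a finite place `v`. -/
noncomputable def proj (v : HeightOneSpectrum (𝓞 F)) : D.GA →* D.G (v.adicCompletion F) :=
  D.mapG (evalAt F v)

/-- `g ∈ G(F_v)` lies in `G(𝓞_{F,v})`, that is in `𝓞_{F,v} ⊗ 𝓞_B`. -/
def IsIntegral (v : HeightOneSpectrum (𝓞 F)) (g : D.G (v.adicCompletion F)) : Prop :=
  g.1.val ∈ orderSpan F (v.adicCompletionIntegers F : Set (v.adicCompletion F))
    (D.OB : Set B)

/-- The extension `F_v ⊗_F B → M_n(M_w)` of `i_w`, where `w ∣ v`. -/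
noncomputable def localHom (w : HeightOneSpectrum (𝓞 M)) (hw : IsSplit F M (below F w))
    (hw' : below F w ∉ D.S) :
    (below F w).adicCompletion F ⊗[F] B →ₐ[F] Matrix (Fin n) (Fin n) (w.adicCompletion M) :=
  Algebra.TensorProduct.lift ((Matrix.scalarAlgHom (Fin n) F).comp (placeMap F w))
    ((D.iso w hw hw').restrictScalars F) fun x b => by
      simp only [AlgHom.comp_apply, Matrix.scalarAlgHom_apply]
      exact (Matrix.scalar_commute _ (fun r => Commute.all _ _) _)

/-- The identification `i_w : G(F_v) → GL_n(M_w)` for `w ∣ v`, `v ∉ S(B)` split in `M`. -/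
noncomputable def toGL (w : HeightOneSpectrum (𝓞 M)) (hw : IsSplit F M (below F w))
    (hw' : below F w ∉ D.S) :
    D.G ((below F w).adicCompletion F) →* GL (Fin n) (w.adicCompletion M) :=
  (Units.map (D.localHom w hw hw' : _ →* _)).comp (D.G _).subtype

end UnitaryDatum

/-! ## Level structure, characters, coefficients -/

theorem mul_lt_one_left {a b : WithZero (Multiplicative ℤ)} (ha : a < 1) (hb : b ≤ 1) :
    a * b < 1 := (mul_le_of_le_one_right' hb).trans_lt ha

theorem mul_lt_one_right {a b : WithZero (Multiplicative ℤ)} (ha : a ≤ 1) (hb : b < 1) :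
    a * b < 1 := (mul_le_of_le_one_left' ha).trans_lt hb

/-- The Iwahori subgroup of `GL_n(M_w)`: matrices in `GL_n(𝓞_{M,w})` which are upper triangular
modulo the maximal ideal (a condition stable under inversion). -/
def iwahori (n : ℕ) (w : HeightOneSpectrum (𝓞 M)) : Subgroup (GL (Fin n) (w.adicCompletion M)) where
  carrier := {g | ((∀ i j, Valued.v (g.val i j) ≤ 1) ∧ ∀ i j, j < i → Valued.v (g.val i j) < 1) ∧
    ((∀ i j, Valued.v ((g⁻¹).val i j) ≤ 1) ∧ ∀ i j, j < i → Valued.v ((g⁻¹).val i j) < 1)}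
  one_mem' := by
    have h : ∀ i j : Fin n, Valued.v ((1 : Matrix (Fin n) (Fin n) (w.adicCompletion M)) i j) ≤ 1 := by
      intro i j
      by_cases hij : i = j
      · subst hij; rw [Matrix.one_apply_eq, map_one]
      · simp [Matrix.one_apply_ne hij]
    have h' : ∀ i j : Fin n, j < i →
        Valued.v ((1 : Matrix (Fin n) (Fin n) (w.adicCompletion M)) i j) < 1 := by
      intro i j hij
      simp [Matrix.one_apply_ne hij.ne']
    refine ⟨⟨h, h'⟩, ?_⟩
    rw [inv_one]
    exact ⟨h, h'⟩
  mul_mem' := by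
    have key : ∀ A B : Matrix (Fin n) (Fin n) (w.adicCompletion M),
        ((∀ i j, Valued.v (A i j) ≤ 1) ∧ ∀ i j, j < i → Valued.v (A i j) < 1) →
        ((∀ i j, Valued.v (B i j) ≤ 1) ∧ ∀ i j, j < i → Valued.v (B i j) < 1) →
        ((∀ i j, Valued.v ((A * B) i j) ≤ 1) ∧ ∀ i j, j < i → Valued.v ((A * B) i j) < 1) := by
      rintro A B ⟨hA, hA'⟩ ⟨hB, hB'⟩
      refine ⟨fun i j => ?_, fun i j hij => ?_⟩
      · rw [Matrix.mul_apply]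
        refine Valuation.map_sum_le _ fun m _ => ?_
        rw [map_mul]
        exact mul_le_one' (hA _ _) (hB _ _)
      · rw [Matrix.mul_apply]
        refine Valuation.map_sum_lt _ one_ne_zero fun m _ => ?_
        rw [map_mul]
        rcases lt_or_ge m i with hm | hm
        · exact mul_lt_one_left (hA' _ _ hm) (hB _ _)
        · exact mul_lt_one_right (hA _ _) (hB' _ _ (hij.trans_le hm))
    rintro g h ⟨hg, hg'⟩ ⟨hh, hh'⟩
    refine ⟨key _ _ hg hh, ?_⟩
    rw [mul_inv_rev]
    exact key _ _ hh' hg'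
  inv_mem' := by
    rintro g ⟨hg, hg'⟩
    refine ⟨hg', ?_⟩
    rw [inv_inv]
    exact hg

/-- An element of the Iwahori subgroup which is unipotent modulo the maximal ideal. -/
def IsUnipotentMod {w : HeightOneSpectrum (𝓞 M)} (g : iwahori n w) : Prop :=
  ∀ i, Valued.v (g.1.val i i - 1) < 1

theorem isUnipotentMod_of_diag_eq {w : HeightOneSpectrum (𝓞 M)} {g h : iwahori n w}
    (e : ∀ i, g.1.val i i = h.1.val i i) : IsUnipotentMod (g⁻¹ * h) := by
  intro i
  have h1 : ((g⁻¹ * h : iwahori n w).1.val i i - 1 : w.adicCompletion M) =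
      ∑ m, (g.1⁻¹).val i m * (h.1.val m i - g.1.val m i) := by
    have h2 : (1 : w.adicCompletion M) = ∑ m, (g.1⁻¹).val i m * g.1.val m i := by
      rw [← Matrix.mul_apply, ← Units.val_mul, inv_mul_cancel]; simp
    simp only [mul_sub, Finset.sum_sub_distrib]
    rw [← h2, ← Matrix.mul_apply]
    rfl
  rw [h1]
  refine Valuation.map_sum_lt _ one_ne_zero fun m _ => ?_
  rw [map_mul]
  rcases lt_trichotomy m i with hm | rfl | hm
  · refine mul_lt_one_left (g.2.2.2 _ _ hm) ?_
    exact (Valuation.map_sub_le _ (h.2.1.1 _ _) (g.2.1.1 _ _))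
  · rw [e, sub_self, map_zero, mul_zero]
    exact zero_lt_one
  · refine mul_lt_one_right (g.2.2.1 _ _) ?_
    exact (Valuation.map_sub_lt _ (h.2.1.2 _ _ hm) (g.2.1.2 _ _ hm))

variable {l : ℕ} [Fact l.Prime]

/-- A character of the Iwahori subgroup with values in `𝓞_K^×` which is trivial on the subgroup of
elements unipotent modulo the maximal ideal. -/
structure TameChar (n : ℕ) (l : ℕ) [Fact l.Prime] (w : HeightOneSpectrum (𝓞 M)) where
  toHom : iwahori n w →* (OK l)ˣ
  trivial : ∀ g, IsUnipotentMod g → toHom g = 1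

noncomputable instance (w : HeightOneSpectrum (𝓞 M)) : Mul (TameChar n l w) where
  mul χ χ' := ⟨χ.toHom * χ'.toHom, fun g hg => by simp [χ.trivial g hg, χ'.trivial g hg]⟩

variable (l) in
/-- The continuous embeddings of `M_w` in `K = ℚ̄_l`. -/
abbrev Emb (w : HeightOneSpectrum (𝓞 M)) : Type _ :=
  {τ : w.adicCompletion M →+* PadicAlgCl l // Continuous τ}

/-- The restriction to `M` of an embedding of `M_w`. -/
noncomputable def Emb.res {w : HeightOneSpectrum (𝓞 M)} (τ : Emb l w) : M →+* PadicAlgCl l :=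
  τ.1.comp (algebraMap M (w.adicCompletion M))

instance (w : HeightOneSpectrum (𝓞 M)) : Finite (Emb l w) := by
  refine Finite.of_injective (fun τ : Emb l w => τ.res) fun τ τ' h => ?_
  refine Subtype.ext (RingHom.ext fun x => ?_)
  refine congrFun (DenseRange.equalizer
    (HeightOneSpectrum.denseRange_algebraMap (K := M) w) τ.2 τ'.2 ?_) x
  funext m
  exact RingHom.congr_fun h m

theorem Emb.mem_OK {w : HeightOneSpectrum (𝓞 M)} (hl : (l : 𝓞 M) ∈ w.asIdeal) (τ : Emb l w)
    {x : w.adicCompletion M} (hx : Valued.v x ≤ 1) : τ.1 x ∈ OK l := by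
  have hv : Valued.v (l : w.adicCompletion M) < 1 := by
    have h := HeightOneSpectrum.valuedAdicCompletion_eq_valuation (K := M) w (l : 𝓞 M)
    have h1 : algebraMap (𝓞 M) (w.adicCompletion M) (l : 𝓞 M) = l := map_natCast _ l
    rw [← h1]
    exact h.trans_lt ((HeightOneSpectrum.valuation_lt_one_iff_mem w (l : 𝓞 M)).mpr hl)
  have hn : ‖(l : PadicAlgCl l)‖ = (l : ℝ)⁻¹ := by
    have := PadicAlgCl.norm_extends l (l : ℚ_[l])
    simpa using this
  have key : ∀ m : ℕ, ‖τ.1 x‖ ^ m < l := by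
    intro m
    have h1 : Valued.v ((l : w.adicCompletion M) * x ^ m) < 1 := by
      rw [map_mul, map_pow]
      exact mul_lt_one_left hv (pow_le_one' hx m)
    have h2 := (τ.2.tendsto 0).comp (Valued.tendsto_zero_pow_of_v_lt_one h1)
    have h3 : Filter.Tendsto (fun k : ℕ => ‖τ.1 ((l : w.adicCompletion M) * x ^ m)‖ ^ k)
        Filter.atTop (nhds 0) := by
      simpa [Function.comp_def] using h2.norm
    have h4 := (tendsto_pow_atTop_nhds_zero_iff.mp h3)
    rw [abs_of_nonneg (norm_nonneg _), map_mul, map_natCast, map_pow, norm_mul, norm_pow, hn] at h4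
    have hlpos : (0 : ℝ) < l := by exact_mod_cast (Fact.out : l.Prime).pos
    rwa [inv_mul_lt_iff₀ hlpos, mul_one] at h4
  have hle : ‖τ.1 x‖ ≤ 1 := by
    by_contra hlt
    obtain ⟨m, hm⟩ := pow_unbounded_of_one_lt (l : ℝ) (not_le.mp hlt)
    exact absurd (key m) (not_lt.mpr hm.le)
  exact hle

/-- The local embedding on integers `𝓞_{M,w} → 𝓞_K`. -/
noncomputable def Emb.int {w : HeightOneSpectrum (𝓞 M)} (hl : (l : 𝓞 M) ∈ w.asIdeal)
    (τ : Emb l w) : w.adicCompletionIntegers M →+* OK l :=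
  (τ.1.comp (w.adicCompletionIntegers M).subtype).codRestrict (OK l) fun x => τ.mem_OK hl x.2

/-- The diagonal entry, as a unit of the residue field, of an element of the Iwahori subgroup. -/
noncomputable def diagResidue (w : HeightOneSpectrum (𝓞 M)) (i : Fin n) :
    iwahori n w →* (IsLocalRing.ResidueField (w.adicCompletionIntegers M))ˣ :=
  MonoidHom.toHomUnits
    { toFun := fun g => IsLocalRing.residue _ ⟨g.1.val i i, g.2.1.1 i i⟩
      map_one' := by
        rw [← map_one (IsLocalRing.residue (w.adicCompletionIntegers M))]
        congr 1
        ext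
        simp
      map_mul' := by
        intro g h
        rw [← map_mul, ← sub_eq_zero, ← map_sub, IsLocalRing.residue_eq_zero_iff,
          IsLocalRing.mem_maximalIdeal, mem_nonunits_iff,
          HeightOneSpectrum.adicCompletionIntegers.isUnit_iff_valued_eq_one]
        refine ne_of_lt ?_
        have e : (g * h).1.val i i - g.1.val i i * h.1.val i i =
            ∑ m ∈ Finset.univ.erase i, g.1.val i m * h.1.val m i := by
          rw [sub_eq_iff_eq_add, Finset.sum_erase_add _ _ (Finset.mem_univ i), ← Matrix.mul_apply]
          rfl
        change Valued.v ((g * h).1.val i i - g.1.val i i * h.1.val i i) < 1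
        rw [e]
        refine Valuation.map_sum_lt _ one_ne_zero fun m hm => ?_
        rw [map_mul]
        rcases lt_or_gt_of_ne (Finset.ne_of_mem_erase hm) with hm | hm
        · exact mul_lt_one_left (g.2.1.2 _ _ hm) (h.2.1.1 _ _)
        · exact mul_lt_one_right (g.2.1.1 _ _) (h.2.1.2 _ _ hm) }

/-- A Teichmüller lift: a multiplicative section of the reduction map `𝓞_{M,w}ˣ → κ_wˣ`. (Such a
section is unique, because `κ_wˣ` is finite of order prime to the residue characteristic.) -/
structure TeichmullerLift (w : HeightOneSpectrum (𝓞 M)) where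
  toHom : (IsLocalRing.ResidueField (w.adicCompletionIntegers M))ˣ →*
    (w.adicCompletionIntegers M)ˣ
  residue_toHom : ∀ x, IsLocalRing.residue _ (toHom x).val = x.val

/-- The `l`-adic and level data: every place of `F` above `l` is unramified over `ℚ`, splits in `M`
and is not in `S(B)`; `Sl` is a set of places of `M`, one above each place of `F` above `l`; and
`U = ∏ U_v` is a sufficiently small open compact subgroup of `G(𝔸_F^∞)`, Iwahori at `l`. -/
structure Level (D : UnitaryDatum F M B n) (l : ℕ) [Fact l.Prime] where
  notMem_S : ∀ v : HeightOneSpectrum (𝓞 F), (l : 𝓞 F) ∈ v.asIdeal → v ∉ D.S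
  split : ∀ v : HeightOneSpectrum (𝓞 F), (l : 𝓞 F) ∈ v.asIdeal → IsSplit F M v
  unramified : ∀ v : HeightOneSpectrum (𝓞 F), (l : 𝓞 F) ∈ v.asIdeal → (l : 𝓞 F) ∉ v.asIdeal ^ 2
  /-- the set `S̃_l` -/
  Sl : Finset (HeightOneSpectrum (𝓞 M))
  bijOn : Set.BijOn (below F) (Sl : Set (HeightOneSpectrum (𝓞 M))) {v | (l : 𝓞 F) ∈ v.asIdeal}
  /-- the local components `U_v` -/
  Uv : ∀ v : HeightOneSpectrum (𝓞 F), Subgroup (D.G (v.adicCompletion F))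
  Uv_integral : ∀ v, ∀ g ∈ Uv v, D.IsIntegral v g
  Uv_S : ∀ v ∈ D.S, ∀ g, g ∈ Uv v ↔ D.IsIntegral v g
  Uv_l : ∀ w (hw : w ∈ Sl) (g : D.G ((below F w).adicCompletion F)), g ∈ Uv (below F w) ↔
    D.toGL w (split _ (bijOn.mapsTo hw)) (notMem_S _ (bijOn.mapsTo hw)) g ∈ iwahori n w
  isOpen : IsOpen ((⨅ v, (Uv v).comap (D.proj v) : Subgroup D.GA) : Set D.GA)
  isCompact : IsCompact ((⨅ v, (Uv v).comap (D.proj v) : Subgroup D.GA) : Set D.GA)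
  /-- `U` is sufficiently small: its projection to some `G(F_v)` is torsion free -/
  small : ∃ v, ∀ g ∈ (⨅ v, (Uv v).comap (D.proj v) : Subgroup D.GA),
    IsOfFinOrder (D.proj v g) → D.proj v g = 1

namespace Level

variable {D : UnitaryDatum F M B n} (P : Level D l)

/-- The open compact subgroup `U = ∏ U_v` of `G(𝔸_F^∞)`. -/
noncomputable def U : Subgroup D.GA := ⨅ v, (P.Uv v).comap (D.proj v)

theorem mem_U {g : D.GA} (hg : g ∈ P.U) (v : HeightOneSpectrum (𝓞 F)) : D.proj v g ∈ P.Uv v :=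
  Subgroup.mem_iInf.mp hg v

theorem l_mem (w : P.Sl) : (l : 𝓞 M) ∈ w.1.asIdeal := by
  have h : (l : 𝓞 F) ∈ (below F w.1).asIdeal := P.bijOn.mapsTo w.2
  have h' : algebraMap (𝓞 F) (𝓞 M) (l : 𝓞 F) ∈ w.1.asIdeal := h
  rwa [map_natCast] at h'

/-- The component of `g ∈ G(𝔸_F^∞)` in `GL_n(M_w)`, for `w ∈ S̃_l`. -/
noncomputable def comp (w : P.Sl) : D.GA →* GL (Fin n) (w.1.adicCompletion M) :=
  (D.toGL w.1 (P.split _ (P.bijOn.mapsTo w.2)) (P.notMem_S _ (P.bijOn.mapsTo w.2))).comp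
    (D.proj (below F w.1))

/-- The component of `u ∈ U` in the Iwahori subgroup of `GL_n(M_w)`, for `w ∈ S̃_l`. -/
noncomputable def compU (w : P.Sl) : P.U →* iwahori n w.1 :=
  ((P.comp w).comp P.U.subtype).codRestrict (iwahori n w.1) fun u =>
    (P.Uv_l w.1 w.2 _).mp (P.mem_U u.2 _)

/-- The set `Ĩ_l` of embeddings `τ : M → K` inducing a place in `S̃_l`, each given as a place
`w ∈ S̃_l` together with a continuous embedding `M_w → K`. -/
abbrev Idx : Type _ := Σ w : P.Sl, Emb l w.1

/-- The component `a_τ` of a weight `a ∈ (ℤ^n)^{Hom(M, K)}`. -/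
noncomputable def wt (a : (M →+* PadicAlgCl l) → Fin n → ℤ) (τ : P.Idx) : Fin n → ℤ := a τ.2.res

/-- `a` is a weight: `a_{τ,1} ≥ ⋯ ≥ a_{τ,n} ≥ 0` for `τ ∈ Ĩ_l`, and `a_{τc,i} = -a_{τ,n+1-i}`. -/
def IsWeight (a : (M →+* PadicAlgCl l) → Fin n → ℤ) : Prop :=
  (∀ τ : P.Idx, Antitone (P.wt a τ) ∧ ∀ i, 0 ≤ P.wt a τ i) ∧
    ∀ (τ : M →+* PadicAlgCl l) i, a (τ.comp (D.conj : M →+* M)) i = -a τ i.rev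

/-- The `𝓞_K`-module `Y_a = ⨂_{τ ∈ Ĩ_l} X_{a_τ}`. -/
abbrev Y (a : (M →+* PadicAlgCl l) → Fin n → ℤ) : Type _ :=
  PiTensorProduct (OK l) fun τ : P.Idx => XLattice l (P.wt a τ)

/-- The image `τ(g_w) ∈ GL_n(𝓞_K)` of the component of `u ∈ U` at `w`. -/
noncomputable def matAt (τ : P.Idx) (u : P.U) : Matrix (Fin n) (Fin n) (PadicAlgCl l) :=
  (P.compU τ.1 u).1.val.map τ.2.1

theorem matAt_mem (τ : P.Idx) (u : P.U) (i j : Fin n) : P.matAt τ u i j ∈ OK l :=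
  τ.2.mem_OK (P.l_mem τ.1) ((P.compU τ.1 u).2.1.1 i j)

theorem matAt_one (τ : P.Idx) : P.matAt τ 1 = 1 := by
  simp [matAt]

theorem matAt_mul (τ : P.Idx) (u u' : P.U) : P.matAt τ (u * u') = P.matAt τ u * P.matAt τ u' := by
  simp [matAt, Matrix.map_mul]

/-- The value at `u ∈ U` of the character `χ = ⊗_{v ∣ l} χ_v`. -/
noncomputable def chi (χ : ∀ w : P.Sl, TameChar n l w.1) : P.U →* (OK l)ˣ :=
  ∏ w : P.Sl, (χ w).toHom.comp (P.compU w)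

/-- The action of `u ∈ U` on `X_{a_τ}`. -/
noncomputable def actX (a : (M →+* PadicAlgCl l) → Fin n → ℤ) (u : P.U) (τ : P.Idx) :
    Module.End (OK l) (XLattice l (P.wt a τ)) :=
  latticeAct (P.wt a τ) (P.matAt τ u) (P.matAt_mem τ u)

theorem actX_one (a : (M →+* PadicAlgCl l) → Fin n → ℤ) : P.actX a 1 = fun _ => 1 :=
  funext fun τ => latticeAct_one _ _ (P.matAt_one τ)

theorem actX_mul (a : (M →+* PadicAlgCl l) → Fin n → ℤ) (u u' : P.U) :
    P.actX a (u * u') = fun τ => P.actX a u τ * P.actX a u' τ :=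
  funext fun τ => latticeAct_mul _ _ _ _ (P.matAt_mul τ u u')

/-- The action of `U` on `Y_{a,χ} = Y_a ⊗ χ`. -/
noncomputable def repY (χ : ∀ w : P.Sl, TameChar n l w.1) (a : (M →+* PadicAlgCl l) → Fin n → ℤ) :
    Representation (OK l) P.U (P.Y a) where
  toFun u := (P.chi χ u).val • PiTensorProduct.map (P.actX a u)
  map_one' := by
    rw [map_one, Units.val_one, one_smul, actX_one]
    exact PiTensorProduct.map_one
  map_mul' u u' := by
    rw [map_mul, Units.val_mul, smul_mul_smul_comm, actX_mul]
    congr 1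
    exact PiTensorProduct.map_mul _ _

theorem repY_apply (χ : ∀ w : P.Sl, TameChar n l w.1) (a : (M →+* PadicAlgCl l) → Fin n → ℤ)
    (u : P.U) : P.repY χ a u = (P.chi χ u).val • PiTensorProduct.map (P.actX a u) := rfl

/-- The action of `U` on `A ⊗ Y_{a,χ}`, for an `𝓞_K`-algebra `A`. -/
noncomputable def rep (χ : ∀ w : P.Sl, TameChar n l w.1) (a : (M →+* PadicAlgCl l) → Fin n → ℤ)
    (A : Type*) [CommRing A] [Algebra (OK l) A] :
    Representation A P.U (A ⊗[OK l] P.Y a) :=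
  (Module.End.baseChangeHom (OK l) A (P.Y a)).toRingHom.toMonoidHom.comp (P.repY χ a)

/-- The space `S_{a,χ}(U, A)` of algebraic modular forms. -/
noncomputable abbrev S (χ : ∀ w : P.Sl, TameChar n l w.1)
    (a : (M →+* PadicAlgCl l) → Fin n → ℤ) (A : Type*) [CommRing A] [Algebra (OK l) A] :
    Submodule A (D.GA → A ⊗[OK l] P.Y a) :=
  forms D.GF P.U (P.rep χ a A)

/-- The component of `g ∈ G(𝔸_F^∞)` at each `w ∈ S̃_l` is `diag(l ^ b_{w,1}, …, l ^ b_{w,n})`. -/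
def IsDiagAt (g : D.GA) (b : P.Sl → Fin n → ℕ) : Prop :=
  ∀ w : P.Sl, (P.comp w g).val = lDiag l (b w)

/-- The twisted action on `Y_a` of an element with components `diag(l ^ b_{w,1}, …, l ^ b_{w,n})`
at `w ∈ S̃_l`. -/
noncomputable def twistY (a : (M →+* PadicAlgCl l) → Fin n → ℤ) (b : P.Sl → Fin n → ℕ)
    (hb : ∀ w, Antitone (b w)) : Module.End (OK l) (P.Y a) :=
  PiTensorProduct.map fun τ => twistAct (P.wt a τ) (b τ.1) (hb τ.1)

theorem twist_compat (χ : ∀ w : P.Sl, TameChar n l w.1)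
    (a : (M →+* PadicAlgCl l) → Fin n → ℤ) (b : P.Sl → Fin n → ℕ)
    (hb : ∀ w, Antitone (b w)) {g : D.GA} (hg : P.IsDiagAt g b) (k k' : P.U)
    (h : (k : D.GA) * g = g * k') :
    P.repY χ a k ∘ₗ P.twistY a b hb = P.twistY a b hb ∘ₗ P.repY χ a k' := by
  have hloc : ∀ w : P.Sl, (P.compU w k).1.val * lDiag l (b w) =
      lDiag l (b w) * (P.compU w k').1.val := by
    intro w
    rw [← hg w]
    have h1 := congrArg (P.comp w) h
    rw [map_mul, map_mul] at h1
    exact congrArg Units.val h1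
  have hl0 : ∀ w : P.Sl, (l : w.1.adicCompletion M) ≠ 0 := by
    intro w
    have h1 : (algebraMap M (w.1.adicCompletion M)) (l : M) ≠ 0 := by
      rw [ne_eq, FaithfulSMul.algebraMap_eq_zero_iff]
      exact Nat.cast_ne_zero.mpr (Fact.out : l.Prime).ne_zero
    rwa [map_natCast] at h1
  have hchi : P.chi χ k = P.chi χ k' := by
    simp only [chi, MonoidHom.finsetProd_apply, MonoidHom.comp_apply]
    refine Finset.prod_congr rfl fun w _ => ?_
    have hd : ∀ i, (P.compU w k).1.val i i = (P.compU w k').1.val i i := by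
      intro i
      have := congrFun (congrFun (hloc w) i) i
      rw [lDiag, Matrix.mul_diagonal, Matrix.diagonal_mul, mul_comm] at this
      exact mul_left_cancel₀ (pow_ne_zero _ (hl0 w)) this
    have h1 := (χ w).trivial _ (isUnipotentMod_of_diag_eq hd)
    rwa [map_mul, map_inv, inv_mul_eq_one] at h1
  have hmat : ∀ τ : P.Idx, P.matAt τ k * lDiag l (b τ.1) = lDiag l (b τ.1) * P.matAt τ k' := by
    intro τ
    have hmap : (lDiag l (b τ.1) : Matrix (Fin n) (Fin n) (PadicAlgCl l)) =
        (lDiag l (b τ.1) : Matrix (Fin n) (Fin n) (τ.1.1.adicCompletion M)).map τ.2.1 := by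
      simp [lDiag, Matrix.diagonal_map]
    have := congrArg (fun X => X.map τ.2.1) (hloc τ.1)
    simp only [Matrix.map_mul] at this
    rw [hmap]
    exact this
  rw [repY_apply, repY_apply, hchi, LinearMap.smul_comp, LinearMap.comp_smul, twistY, ← PiTensorProduct.map_comp,
    ← PiTensorProduct.map_comp]
  congr 2
  funext τ
  exact latticeAct_comp_twistAct _ _ _ (hb τ.1) (hmat τ)

/-- The operator `[U g U]` on `S_{a,χ}(U, A)`, for `g ∈ G(𝔸_F^∞)` whose components at `S̃_l` are
`diag(l ^ b_{w,1}, …, l ^ b_{w,n})` with `b_{w,1} ≥ ⋯ ≥ b_{w,n} ≥ 0`; it is formed with the twisted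
action of `g` on `Y_{a,χ}`. -/
noncomputable def hecke (χ : ∀ w : P.Sl, TameChar n l w.1)
    (a : (M →+* PadicAlgCl l) → Fin n → ℤ) (A : Type*) [CommRing A] [Algebra (OK l) A]
    (g : D.GA) (b : P.Sl → Fin n → ℕ) (hb : ∀ w, Antitone (b w)) (hg : P.IsDiagAt g b) :
    Module.End A (P.S χ a A) :=
  heckeOperator g ((P.twistY a b hb).baseChange A) fun k k' h => by
    change (P.repY χ a k).baseChange A ∘ₗ _ = _ ∘ₗ (P.repY χ a k').baseChange A
    rw [← LinearMap.baseChange_comp, ← LinearMap.baseChange_comp, P.twist_compat χ a b hb hg k k' h]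

/-- The exponents `(n - 1, …, 1, 0)`. -/
def stdExp (P : Level D l) : P.Sl → Fin n → ℕ := fun _ i => n - 1 - i

theorem stdExp_antitone (w : P.Sl) : Antitone (P.stdExp w) := by
  intro i j h
  have : (i : ℕ) ≤ j := h
  simp only [stdExp]
  omega

/-- `u` is the element of `G(𝔸_F^∞)` which is trivial away from `l` and whose components at the
places above `l` are `diag(l ^ (n - 1), …, l, 1)`. -/
def IsUlElement (u : D.GA) : Prop :=
  (∀ v : HeightOneSpectrum (𝓞 F), (l : 𝓞 F) ∉ v.asIdeal → D.proj v u = 1) ∧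
    P.IsDiagAt u P.stdExp

/-- The ordinary part `S^ord_{a,χ}(U, A) = e_l S_{a,χ}(U, A)` for a discrete coefficient ring `A`
(such as `k`), where `e_l = lim U_l ^ n!` and `U_l = [U u U]`. -/
noncomputable def Sord (χ : ∀ w : P.Sl, TameChar n l w.1)
    (a : (M →+* PadicAlgCl l) → Fin n → ℤ) (A : Type*) [CommRing A] [Algebra (OK l) A]
    (u : D.GA) (hu : P.IsUlElement u) : Submodule A (P.S χ a A) :=
  ordinaryPart (P.hecke χ a A u P.stdExp P.stdExp_antitone hu.2)

/-- `g` has component `diag(ϖ, …, ϖ, 1, …, 1)` (with `j` entries `ϖ`) at the place `w`, and trivial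
components at the places of `F` other than the one below `w`. -/
def IsDiagElement (w : HeightOneSpectrum (𝓞 M)) (hw : IsSplit F M (below F w))
    (hw' : below F w ∉ D.S) (ϖ : w.adicCompletion M) (j : ℕ) (g : D.GA) : Prop :=
  (∀ v, v ≠ below F w → D.proj v g = 1) ∧
    (D.toGL w hw hw' (D.proj (below F w) g)).val =
      Matrix.diagonal fun i : Fin n => if (i : ℕ) < j then ϖ else 1

/-- The elements `g` of `G(𝔸_F^∞)` for which `[U g U]` is one of the generators `T_w^{(j)}`,
`1 ≤ j ≤ n`, and `(T_w^{(n)})⁻¹` of the Hecke algebra `𝕋(U)`; here `w` runs over the places of `M`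
above places `v ∤ l` of `F` which split in `M`, are not in `S(B)`, and satisfy
`U_v = G(𝓞_{F,v})`. -/
def IsHeckeElement (g : D.GA) : Prop :=
  ∃ (w : HeightOneSpectrum (𝓞 M)) (hw : IsSplit F M (below F w)) (hw' : below F w ∉ D.S)
    (ϖ : w.adicCompletion M) (j : ℕ),
    (l : 𝓞 F) ∉ (below F w).asIdeal ∧
    (∀ x, x ∈ P.Uv (below F w) ↔ D.IsIntegral (below F w) x) ∧
    Valued.v ϖ = WithZero.exp (-1 : ℤ) ∧ 1 ≤ j ∧ j ≤ n ∧
    (IsDiagElement w hw hw' ϖ j g ∨ (j = n ∧ IsDiagElement w hw hw' ϖ n g⁻¹))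

theorem IsHeckeElement.isDiagAt {P : Level D l} {g : D.GA} (hg : P.IsHeckeElement g) :
    P.IsDiagAt g fun _ _ => 0 := by
  obtain ⟨w, hw, hw', ϖ, j, hl, -, -, -, -, h⟩ := hg
  intro w'
  have hne : below F w'.1 ≠ below F w := fun e => hl (e ▸ P.bijOn.mapsTo w'.2)
  have h1 : D.proj (below F w'.1) g = 1 := by
    rcases h with h | ⟨-, h⟩
    · exact h.1 _ hne
    · simpa using h.1 _ hne
  simp [comp, h1, lDiag]

/-- The generator `[U g U]` of the Hecke algebra acting on `S_{a,χ}(U, A)`. -/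
noncomputable def heckeGen (χ : ∀ w : P.Sl, TameChar n l w.1)
    (a : (M →+* PadicAlgCl l) → Fin n → ℤ) (A : Type*) [CommRing A] [Algebra (OK l) A]
    (g : D.GA) (hg : P.IsHeckeElement g) : Module.End A (P.S χ a A) :=
  P.hecke χ a A g (fun _ _ => 0) (fun _ => antitone_const) hg.isDiagAt

/-- The local component at `w` of the character `χ_a`:
`g ↦ ∏_τ ∏_i τ(x̃_i) ^ a_{τ,n+1-i}`, where `x̃_i` is the Teichmüller lift of the residue class
of the diagonal entry `g_{i,i}` and `τ` runs over the elements of `Ĩ_l` inducing `w`. -/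
noncomputable def chiWt (T : ∀ w : P.Sl, TeichmullerLift w.1)
    (a : (M →+* PadicAlgCl l) → Fin n → ℤ) (w : P.Sl) : TameChar n l w.1 where
  toHom :=
    { toFun := fun g => ∏ᶠ τ : Emb l w.1, ∏ i : Fin n,
        (Units.map (τ.int (P.l_mem w) : _ →* _) ((T w).toHom (diagResidue w.1 i g))) ^
          P.wt a ⟨w, τ⟩ i.rev
      map_one' := by simp
      map_mul' := by
        intro g h
        rw [← finprod_mul_distrib (Set.toFinite _) (Set.toFinite _)]
        refine finprod_congr fun τ => ?_
        rw [← Finset.prod_mul_distrib]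
        refine Finset.prod_congr rfl fun i _ => ?_
        rw [map_mul, map_mul, map_mul, mul_zpow] }
  trivial g hg := by
    have h : ∀ i, diagResidue w.1 i g = 1 := by
      intro i
      ext
      change IsLocalRing.residue _ _ = 1
      rw [← map_one (IsLocalRing.residue (w.1.adicCompletionIntegers M)), ← sub_eq_zero, ← map_sub,
        IsLocalRing.residue_eq_zero_iff, IsLocalRing.mem_maximalIdeal, mem_nonunits_iff,
        HeightOneSpectrum.adicCompletionIntegers.isUnit_iff_valued_eq_one]
      exact ne_of_lt (hg i)
    simp [h]

/-- `p : k ⊗ Y_a → k ⊗ Y_0` is the projection to the tensor product of the lowest weight vectors: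
on a tensor product of monomials `y_τ ∈ X_{a_τ}` it takes the value `1` if every `y_τ` is the lowest
weight vector (the monomial of right weight `(a_{τ,n}, …, a_{τ,1})`), and `0` otherwise. -/
def IsLowestWeightProjection (a : (M →+* PadicAlgCl l) → Fin n → ℤ)
    (p : kbar l ⊗[OK l] P.Y a →ₗ[kbar l] kbar l ⊗[OK l] P.Y 0) : Prop :=
  ∀ y : ∀ τ : P.Idx, XLattice l (P.wt a τ), (∀ τ, (y τ).1 ∈ weightMonomials l (P.wt a τ)) →
    ((∀ τ, IsRightWeight (fun i => P.wt a τ i.rev) (y τ).1) →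
      p (1 ⊗ₜ PiTensorProduct.tprod _ y) = 1 ⊗ₜ PiTensorProduct.tprod _ fun _ =>
        ⟨1, Submodule.subset_span ⟨one_mem _, isLeftWeight_one⟩⟩) ∧
    ((¬ ∀ τ, IsRightWeight (fun i => P.wt a τ i.rev) (y τ).1) →
      p (1 ⊗ₜ PiTensorProduct.tprod _ y) = 0)

end Level

end Unitary

end UnitaryHida

/-! Everything comes from the twisted action of $\mathrm{diag}(l^{b_1},\dots,l^{b_n})$ with
$b_1>\dots>b_n$ on $X_t$. A monomial in the minors of right weight $q$ is multiplied by $l$ to the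
power $\sum_i b_i(q_i-t_{n+1-i})$. This exponent is $0$ for the lowest weight vector and positive
for every other monomial (`minorMonomials_lowest`), so modulo $l$ the action is the projection to
the lowest weight line (`twistAct_sub_mem`). Over $k$ the coefficient map in $U_l$ on $Y_a$ is
therefore $\iota\circ p$, with $p$ the projection of the lemma and $\iota$ a section of it
(`baseChange_twistY`), while $p\circ\iota=1$ is the coefficient map in $U_l$ on $Y_0$.

The monomials satisfy linear relations, so $p$ cannot be defined by prescribing its values on them.
Instead it is the tensor product of the evaluations $f\mapsto f(w)$ at a signed antidiagonal matrix
$w$, which are $1$ on the lowest weight vector and $0$ on the other monomials. This form also gives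
the equivariance. An element $g$ of the Iwahori subgroup is upper triangular modulo $l$, so $wg$ is
congruent to $Lw$ with $L$ lower triangular, and the minors of the first rows of $wg$ are those of
$w$ times products of diagonal entries of $g$ (`det_antiDiag_mul`). Hence $U$ acts on the lowest
weight quotient through $\chi_a$ (`baseChange_projY_comp_rep`).

On forms this yields maps $p$ and $q$, the second built from $\iota$ and the cosets of $UuU$, such
that $qp$ and $pq$ are the operators $U_l$ on the two sides. The ordinary part consists of the
vectors periodic under $U_l$ (`mem_ordinaryPart_iff`), so $U_l$ is invertible there, and $p$ is an
isomorphism of ordinary parts (`ordinaryPartEquiv`). No finiteness of the space of forms is used.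

The generators of $\mathbb{T}(U)$ are supported at one place $v\nmid l$, and $u$ is trivial at $v$.
Coset representatives for the two double cosets can be taken at $v$ and away from $v$ respectively,
so the operators commute (`commute_heckeGen`) and $\mathbb{T}(U)$ preserves ordinary parts. The
generators act trivially on coefficients, so they also commute with $p$. -/

namespace UnitaryHida

/-! ## Ordinary parts and functoriality of double coset operators -/

section OrdinaryPart

section Monoid

variable {A : Type*} [CommRing A] {S : Type*} [AddCommMonoid S] [Module A S]

/-- The ordinary part consists of the periodic vectors. -/
theorem mem_ordinaryPart_iff {T : Module.End A S} {g : S} :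
    g ∈ ordinaryPart T ↔ ∃ N, 0 < N ∧ (T ^ N) g = g := by
  constructor
  · rintro ⟨f, hf⟩
    obtain ⟨m, hm⟩ := Filter.eventually_atTop.mp hf
    have h1 := hm (m + 1) (by omega)
    have h2 := hm (m + 2) (by omega)
    -- The period is $(m+2)!-(m+1)!$, the difference of two consecutive exponents at which the
    -- sequence has become stationary.
    refine ⟨(m + 1) * (m + 1).factorial, by positivity, ?_⟩
    have e : (m + 2).factorial = (m + 1) * (m + 1).factorial + (m + 1).factorial := by
      rw [Nat.factorial_succ (m + 1)]; ring
    rw [e, pow_add, Module.End.mul_apply, h1] at h2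
    exact h2
  · rintro ⟨N, hN, h⟩
    refine ⟨g, Filter.eventually_atTop.mpr ⟨N, fun m hm => ?_⟩⟩
    obtain ⟨r, hr⟩ := Nat.dvd_factorial hN hm
    have hfix : ∀ r : ℕ, (T ^ (N * r)) g = g := by
      intro r
      induction r with
      | zero => simp
      | succ r ih => rw [Nat.mul_succ, pow_add, Module.End.mul_apply, h, ih]
    rw [hr, hfix]

theorem apply_mem_ordinaryPart {T R : Module.End A S} (h : Commute R T) {g : S}
    (hg : g ∈ ordinaryPart T) : R g ∈ ordinaryPart T := by
  obtain ⟨N, hN, e⟩ := mem_ordinaryPart_iff.mp hg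
  refine mem_ordinaryPart_iff.mpr ⟨N, hN, ?_⟩
  rw [← Module.End.mul_apply, ← (h.pow_right N).eq, Module.End.mul_apply, e]

end Monoid

variable {A : Type*} [CommRing A] {S S' : Type*} [AddCommGroup S] [Module A S] [AddCommGroup S']
  [Module A S']

theorem pow_comp_apply {p : S →ₗ[A] S'} {T : Module.End A S} {T' : Module.End A S'}
    (h : ∀ x, p (T x) = T' (p x)) (N : ℕ) (x : S) : p ((T ^ N) x) = (T' ^ N) (p x) := by
  induction N with
  | zero => simp
  | succ N ih => rw [pow_succ', pow_succ', Module.End.mul_apply, Module.End.mul_apply, h, ih]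

/-- If `T = q ∘ p` and `T' = p ∘ q`, then `p` restricts to an isomorphism of ordinary parts. -/
noncomputable def ordinaryPartEquiv {T : Module.End A S} {T' : Module.End A S'}
    (p : S →ₗ[A] S') (q : S' →ₗ[A] S) (h : ∀ x, q (p x) = T x) (h' : ∀ x, p (q x) = T' x) :
    ordinaryPart T ≃ₗ[A] ordinaryPart T' :=
  have hp : ∀ x, p (T x) = T' (p x) := fun x => by rw [← h, h']
  have hq : ∀ x, q (T' x) = T (q x) := fun x => by rw [← h, h']
  LinearEquiv.ofBijective
    (p.restrict (p := ordinaryPart T) (q := ordinaryPart T') fun g hg => by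
      obtain ⟨N, hN, e⟩ := mem_ordinaryPart_iff.mp hg
      exact mem_ordinaryPart_iff.mpr ⟨N, hN, by rw [← pow_comp_apply hp, e]⟩) (by
    constructor
    -- Injectivity: if $pg=0$ then $Tg=q(pg)=0$, hence $g=T^Ng=0$.
    · rw [← LinearMap.ker_eq_bot, LinearMap.ker_eq_bot']
      rintro ⟨g, hg⟩ h0
      have h0' : p g = 0 := congrArg Subtype.val h0
      obtain ⟨N, hN, e⟩ := mem_ordinaryPart_iff.mp hg
      obtain ⟨M, rfl⟩ := Nat.exists_eq_succ_of_ne_zero hN.ne'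
      rw [Nat.succ_eq_add_one, pow_succ, Module.End.mul_apply, ← h, h0', map_zero, map_zero] at e
      exact Subtype.ext e.symm
    · rintro ⟨g, hg⟩
      obtain ⟨N, hN, e⟩ := mem_ordinaryPart_iff.mp hg
      obtain ⟨M, rfl⟩ := Nat.exists_eq_succ_of_ne_zero hN.ne'
      -- Surjectivity: $p(q(T'^Mg))=T'^{M+1}g=g$ for a period $M+1$ of $g$.
      refine ⟨⟨q ((T' ^ M) g), mem_ordinaryPart_iff.mpr ⟨M + 1, hN, ?_⟩⟩, Subtype.ext ?_⟩
      · rw [← pow_comp_apply hq, ← Module.End.mul_apply, ← pow_add, add_comm, pow_add,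
          Module.End.mul_apply]
        exact congrArg (fun z => q ((T' ^ M) z)) e
      · change p (q ((T' ^ M) g)) = g
        rw [h', ← Module.End.mul_apply, ← pow_succ']
        exact e)

end OrdinaryPart

/-! ### Double coset operators under a change of coefficients -/

section HeckeMaps

variable {𝒢 : Type*} [Group 𝒢] {A : Type*} [CommRing A] {V V' : Type*} [AddCommGroup V]
  [Module A V] [AddCommGroup V'] [Module A V'] {Γ U : Subgroup 𝒢} {ρ : Representation A U V}
  {ρ' : Representation A U V'}

/-- Composition of forms with an equivariant map of coefficients. -/
def formsMap (Γ : Subgroup 𝒢) (p : V →ₗ[A] V') (hp : ∀ u, p ∘ₗ ρ u = ρ' u ∘ₗ p) :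
    forms Γ U ρ →ₗ[A] forms Γ U ρ' where
  toFun f := ⟨fun x => p (f.1 x), fun γ hγ g => congrArg p (f.2.1 γ hγ g), fun u g => by
    exact (congrArg p (f.2.2 u g)).trans (LinearMap.congr_fun (hp u⁻¹) _)⟩
  map_add' f f' := by ext x; simp
  map_smul' c f := by ext x; simp

/-- Replacing $r$ by $rs$ with $sg=gk$ moves $k$ out of $f$ as $\rho(k^{-1})$, and `hγ` carries it
across $\gamma$ to cancel $\rho'(s)$. Two coefficient modules are allowed because the inverse
direction of the isomorphism uses a map from $V'$ to $V$. -/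
theorem coset_term_eq {g : 𝒢} {γ : V →ₗ[A] V'}
    (hγ : ∀ k k' : U, (k : 𝒢) * g = g * k' → ρ' k ∘ₗ γ = γ ∘ₗ ρ k')
    {f : 𝒢 → V} (hf : f ∈ forms Γ U ρ) (x : 𝒢) {r r' : U}
    (h : (r : U ⧸ cosetStab U g) = r') :
    ρ' r (γ (f (x * r * g))) = ρ' r' (γ (f (x * r' * g))) := by
  obtain ⟨s, hs, rfl⟩ : ∃ s ∈ cosetStab U g, r' = r * s :=
    ⟨r⁻¹ * r', QuotientGroup.eq.mp h, by group⟩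
  obtain ⟨k, hk⟩ := mem_cosetStab hs
  have e : x * (r * s : U) * g = (x * r * g) * k := by
    simp only [Subgroup.coe_mul, mul_assoc, hk]
  have e2 := LinearMap.congr_fun (hγ s k hk) (ρ k⁻¹ (f (x * r * g)))
  have e3 : ρ k (ρ k⁻¹ (f (x * r * g))) = f (x * r * g) := by
    rw [← Module.End.mul_apply, ← map_mul]; simp
  simp only [LinearMap.comp_apply, e3] at e2
  rw [e, hf.2 k, map_mul, Module.End.mul_apply, e2]

/-- The map `f ↦ (x ↦ ∑ᵢ uᵢ γ f (x uᵢ g))` between spaces of forms with different coefficients,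
for `U g U = ∐ uᵢ g U` a finite union. -/
noncomputable def heckeMap (Γ : Subgroup 𝒢) (g : 𝒢) [Finite (U ⧸ cosetStab U g)] (γ : V →ₗ[A] V')
    (hγ : ∀ k k' : U, (k : 𝒢) * g = g * k' → ρ' k ∘ₗ γ = γ ∘ₗ ρ k') :
    forms Γ U ρ →ₗ[A] forms Γ U ρ' where
  toFun f := ⟨fun x => ∑ᶠ c : U ⧸ cosetStab U g, ρ' c.out (γ (f.1 (x * (c.out : U) * g))), by
    refine ⟨fun δ hδ x => finsum_congr fun c => ?_, fun k x => ?_⟩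
    · rw [mul_assoc, mul_assoc, f.2.1 δ hδ, mul_assoc]
    · rw [map_finsum _ (Set.toFinite _)]
      symm
      rw [← finsum_comp_equiv (MulAction.toPerm (α := U) (β := U ⧸ cosetStab U g) k)]
      refine finsum_congr fun c => ?_
      have h := coset_term_eq hγ f.2 x (r := (k • c).out) (r' := k * c.out)
        (by
          rw [QuotientGroup.out_eq']
          conv_lhs => rw [← QuotientGroup.out_eq' c]
          rfl)
      simp only [MulAction.toPerm_apply]
      rw [h, ← Module.End.mul_apply, ← map_mul]
      simp [mul_assoc]⟩
  map_add' f f' := by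
    ext x
    simp only [Submodule.coe_add, Pi.add_apply, map_add]
    exact finsum_add_distrib (Set.toFinite _) (Set.toFinite _)
  map_smul' c f := by
    ext x
    simp only [Submodule.coe_smul, Pi.smul_apply, map_smul, RingHom.id_apply]
    exact (smul_finsum' c (Set.toFinite _)).symm

theorem heckeOperator_eq_heckeMap {g : 𝒢} [hfin : Finite (U ⧸ cosetStab U g)] {γ : V →ₗ[A] V}
    (hγ : ∀ k k' : U, (k : 𝒢) * g = g * k' → ρ k ∘ₗ γ = γ ∘ₗ ρ k') :
    heckeOperator (Γ := Γ) g γ hγ = heckeMap Γ g γ hγ := by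
  rw [heckeOperator, dif_pos hfin]
  rfl

theorem heckeOperator_eq_zero {g : 𝒢} (hfin : ¬ Finite (U ⧸ cosetStab U g)) {γ : V →ₗ[A] V}
    (hγ : ∀ k k' : U, (k : 𝒢) * g = g * k' → ρ k ∘ₗ γ = γ ∘ₗ ρ k') :
    heckeOperator (Γ := Γ) g γ hγ = 0 := by
  rw [heckeOperator, dif_neg hfin]

/-- The terms of a double coset operator may be computed with arbitrary representatives. -/
theorem heckeMap_apply {g : 𝒢} [Finite (U ⧸ cosetStab U g)] {γ : V →ₗ[A] V'}
    (hγ : ∀ k k' : U, (k : 𝒢) * g = g * k' → ρ' k ∘ₗ γ = γ ∘ₗ ρ k')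
    (r : U ⧸ cosetStab U g → U) (hr : ∀ c, (r c : U ⧸ cosetStab U g) = c)
    (f : forms Γ U ρ) (x : 𝒢) :
    (heckeMap Γ g γ hγ f).1 x = ∑ᶠ c, ρ' (r c) (γ (f.1 (x * r c * g))) :=
  finsum_congr fun c => coset_term_eq hγ f.2 x ((QuotientGroup.out_eq' c).trans (hr c).symm)

theorem formsMap_heckeOperator {p : V →ₗ[A] V'} (hp : ∀ u, p ∘ₗ ρ u = ρ' u ∘ₗ p) {g : 𝒢}
    {γ : V →ₗ[A] V} {γ' : V' →ₗ[A] V'} (hpγ : p ∘ₗ γ = γ' ∘ₗ p)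
    (hγ : ∀ k k' : U, (k : 𝒢) * g = g * k' → ρ k ∘ₗ γ = γ ∘ₗ ρ k')
    (hγ' : ∀ k k' : U, (k : 𝒢) * g = g * k' → ρ' k ∘ₗ γ' = γ' ∘ₗ ρ' k') (f : forms Γ U ρ) :
    formsMap Γ p hp (heckeOperator g γ hγ f) = heckeOperator g γ' hγ' (formsMap Γ p hp f) := by
  by_cases hfin : Finite (U ⧸ cosetStab U g)
  · rw [heckeOperator_eq_heckeMap, heckeOperator_eq_heckeMap]
    refine Subtype.ext (funext fun x => ?_)
    refine (map_finsum p (Set.toFinite _)).trans (finsum_congr fun c => ?_)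
    exact (LinearMap.congr_fun (hp _) _).trans
      (congrArg _ (LinearMap.congr_fun hpγ _))
  · rw [heckeOperator_eq_zero hfin, heckeOperator_eq_zero hfin]
    simp

/-- If `γ = ι ∘ p` and `p ∘ ι = γ'`, with `p` equivariant and surjective, then the double coset
operators of `γ` and `γ'` have isomorphic ordinary parts. -/
theorem exists_ordinaryPart_equiv {p : V →ₗ[A] V'} (hp : ∀ u, p ∘ₗ ρ u = ρ' u ∘ₗ p)
    (hsurj : Function.Surjective p) {ι : V' →ₗ[A] V} {g : 𝒢}
    {γ : V →ₗ[A] V} {γ' : V' →ₗ[A] V'} (hι : γ = ι ∘ₗ p) (hι' : p ∘ₗ ι = γ')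
    (hγ : ∀ k k' : U, (k : 𝒢) * g = g * k' → ρ k ∘ₗ γ = γ ∘ₗ ρ k')
    (hγ' : ∀ k k' : U, (k : 𝒢) * g = g * k' → ρ' k ∘ₗ γ' = γ' ∘ₗ ρ' k') :
    ∃ φ : ordinaryPart (heckeOperator (Γ := Γ) g γ hγ) ≃ₗ[A]
        ordinaryPart (heckeOperator (Γ := Γ) g γ' hγ'),
      ∀ f, (φ f).1 = formsMap Γ p hp f.1 := by
  by_cases hfin : Finite (U ⧸ cosetStab U g)
  -- The map $\iota$ need not be $U$-equivariant. The compatibility required for a double coset map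
  -- is inherited from $\gamma=\iota\circ p$ by cancelling the surjection $p$.
  · have hιρ : ∀ k k' : U, (k : 𝒢) * g = g * k' → ρ k ∘ₗ ι = ι ∘ₗ ρ' k' := by
      intro k k' h
      have h1 := hγ k k' h
      rw [hι, LinearMap.comp_assoc, hp, ← LinearMap.comp_assoc, ← LinearMap.comp_assoc] at h1
      exact LinearMap.ext fun v => by
        obtain ⟨v, rfl⟩ := hsurj v
        exact LinearMap.congr_fun h1 v
    refine ⟨ordinaryPartEquiv (formsMap Γ p hp) (heckeMap Γ g ι hιρ) (fun f => ?_) fun f => ?_,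
      fun f => rfl⟩
    · subst hι
      rw [heckeOperator_eq_heckeMap]
      rfl
    · rw [heckeOperator_eq_heckeMap]
      refine Subtype.ext (funext fun x => ?_)
      refine (map_finsum p (Set.toFinite _)).trans (finsum_congr fun c => ?_)
      exact (LinearMap.congr_fun (hp _) _).trans (congrArg _ (LinearMap.congr_fun hι' _))
  -- With infinitely many cosets both operators are $0$ by convention, and $q=0$ satisfies the two
  -- factorizations.
  · refine ⟨ordinaryPartEquiv (formsMap Γ p hp) 0 (fun f => ?_) fun f => ?_, fun f => rfl⟩
    · rw [heckeOperator_eq_zero hfin]; rfl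
    · rw [heckeOperator_eq_zero hfin, LinearMap.zero_apply, map_zero]; rfl

/-- Two double coset operators commute if their cosets have representatives such that all
group elements and coefficient maps involved in one commute with those involved in the other. -/
theorem heckeOperator_commute {g g' : 𝒢} {γ γ' : V →ₗ[A] V}
    (hγ : ∀ k k' : U, (k : 𝒢) * g = g * k' → ρ k ∘ₗ γ = γ ∘ₗ ρ k')
    (hγ' : ∀ k k' : U, (k : 𝒢) * g' = g' * k' → ρ k ∘ₗ γ' = γ' ∘ₗ ρ k')
    (Q Q' : Set U) (hQ : ∀ c : U, ∃ r ∈ Q, (r : U ⧸ cosetStab U g) = c)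
    (hQ' : ∀ c : U, ∃ r ∈ Q', (r : U ⧸ cosetStab U g') = c)
    (hcomm : ∀ c ∈ Q, ∀ d ∈ Q', Commute c d) (hg : ∀ d ∈ Q', Commute g d)
    (hg' : ∀ c ∈ Q, Commute (c : 𝒢) g') (hgg' : Commute g g') (hγγ' : Commute γ γ') :
    Commute (heckeOperator (Γ := Γ) g γ hγ) (heckeOperator (Γ := Γ) g' γ' hγ') := by
  by_cases hfin : Finite (U ⧸ cosetStab U g)
  swap
  · rw [heckeOperator_eq_zero hfin]; exact Commute.zero_left _
  by_cases hfin' : Finite (U ⧸ cosetStab U g')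
  swap
  · rw [heckeOperator_eq_zero hfin' hγ']; exact Commute.zero_right _
  rw [heckeOperator_eq_heckeMap, heckeOperator_eq_heckeMap]
  have hr : ∀ c : U ⧸ cosetStab U g, ∃ r ∈ Q, (r : U ⧸ cosetStab U g) = c := fun c => by
    obtain ⟨c, rfl⟩ := QuotientGroup.mk_surjective c
    exact hQ c
  have hr' : ∀ c : U ⧸ cosetStab U g', ∃ r ∈ Q', (r : U ⧸ cosetStab U g') = c := fun c => by
    obtain ⟨c, rfl⟩ := QuotientGroup.mk_surjective c
    exact hQ' c
  choose r hrQ hr using hr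
  choose r' hrQ' hr' using hr'
  refine LinearMap.ext fun f => Subtype.ext (funext fun x => ?_)
  rw [Module.End.mul_apply, Module.End.mul_apply, heckeMap_apply hγ r hr,
    heckeMap_apply hγ' r' hr']
  have e1 : ∀ c, ρ (r c) (γ ((heckeMap Γ g' γ' hγ' f).1 (x * r c * g))) =
      ∑ᶠ d, ρ (r c) (γ (ρ (r' d) (γ' (f.1 (x * r c * g * r' d * g'))))) := fun c => by
    rw [heckeMap_apply hγ' r' hr', map_finsum γ (Set.toFinite _), map_finsum _ (Set.toFinite _)]
  have e2 : ∀ d, ρ (r' d) (γ' ((heckeMap Γ g γ hγ f).1 (x * r' d * g'))) =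
      ∑ᶠ c, ρ (r' d) (γ' (ρ (r c) (γ (f.1 (x * r' d * g' * r c * g))))) := fun d => by
    rw [heckeMap_apply hγ r hr, map_finsum γ' (Set.toFinite _), map_finsum _ (Set.toFinite _)]
  rw [finsum_congr e1, finsum_congr e2]
  have := Fintype.ofFinite (U ⧸ cosetStab U g)
  have := Fintype.ofFinite (U ⧸ cosetStab U g')
  simp only [finsum_eq_sum_of_fintype]
  rw [Finset.sum_comm]
  refine Finset.sum_congr rfl fun d _ => Finset.sum_congr rfl fun c _ => ?_
  -- The two double sums agree term by term: first the points at which $f$ is evaluated, then the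
  -- operators applied to its value.
  have hx : x * r c * g * r' d * g' = x * r' d * g' * r c * g := by
    have a1 : (r c : 𝒢) * r' d = r' d * r c := congrArg Subtype.val (hcomm _ (hrQ c) _ (hrQ' d)).eq
    have a2 := (hg _ (hrQ' d)).eq
    have a3 := (hg' _ (hrQ c)).eq
    calc x * r c * g * r' d * g' = x * (r c * (g * r' d) * g') := by simp only [mul_assoc]
      _ = x * (r c * r' d * (g * g')) := by rw [a2]; simp only [mul_assoc]
      _ = x * (r' d * (r c * g') * g) := by rw [a1, hgg'.eq]; simp only [mul_assoc]
      _ = _ := by rw [a3]; simp only [mul_assoc]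
  rw [hx]
  generalize f.1 (x * r' d * g' * r c * g) = v
  -- Since $d$ commutes with $g$, the case $k=k'=d$ of `hγ` says that $\rho(d)$ commutes with
  -- $\gamma$; `b2` is the symmetric statement.
  have b1 : ∀ v, ρ (r' d) (γ v) = γ (ρ (r' d) v) :=
    fun v => LinearMap.congr_fun (hγ _ _ (hg _ (hrQ' d)).eq.symm) v
  have b2 : ∀ v, ρ (r c) (γ' v) = γ' (ρ (r c) v) :=
    fun v => LinearMap.congr_fun (hγ' _ _ (hg' _ (hrQ c)).eq) v
  have b3 : ∀ v, ρ (r c) (ρ (r' d) v) = ρ (r' d) (ρ (r c) v) := fun v => by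
    rw [← Module.End.mul_apply, ← map_mul, (hcomm _ (hrQ c) _ (hrQ' d)).eq, map_mul,
      Module.End.mul_apply]
  have b4 : ∀ v, γ (γ' v) = γ' (γ v) := fun v => LinearMap.congr_fun hγγ'.eq v
  rw [← b1, b3, b4, b2]

end HeckeMaps

/-! ## Lowest weight vectors modulo `l` -/

section AntiDiagonal

variable {R : Type*} [CommRing R] {n : ℕ}

/-- The last `i + 1` columns. -/
def lastCols (i : Fin n) : Fin (i + 1) ↪o Fin n :=
  OrderEmbedding.ofStrictMono (fun s => (Fin.castLE i.2 s.rev).rev) fun s s' h => by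
    rw [Fin.lt_def] at h ⊢
    simp only [Fin.val_rev, Fin.val_castLE]
    omega

theorem lastCols_apply (i : Fin n) (s : Fin (i + 1)) :
    lastCols i s = (Fin.castLE i.2 s.rev).rev := rfl

/-- An increasing sequence of $i+1$ columns that starts at the first of the last $i+1$ columns must
be all of them. Otherwise its first column lies to the left of every antidiagonal position in the
first $i+1$ rows. This dichotomy yields both the vanishing of minors of $w$ and the strict
inequality of exponents. -/
theorem eq_lastCols_or_lt {i : Fin n} (j : Fin (i + 1) ↪o Fin n) :
    j = lastCols i ∨ ∀ r : Fin (i + 1), j 0 < (Fin.castLE i.2 r).rev := by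
  by_cases h0 : (j 0 : ℕ) + i + 1 < n
  · right
    intro r
    rw [Fin.lt_def, Fin.val_rev, Fin.val_castLE]
    have := r.2
    omega
  · left
    have key : ∀ m : ℕ, (hm : m < i + 1) → (j 0 : ℕ) + m ≤ j ⟨m, hm⟩ := by
      intro m
      induction m with
      | zero => intro hm; exact le_rfl
      | succ m ih =>
        intro hm
        have h1 := ih (by omega)
        have h2 : j ⟨m, by omega⟩ < j ⟨m + 1, hm⟩ := by
          rw [OrderEmbedding.lt_iff_lt, Fin.lt_def]; simp
        rw [Fin.lt_def] at h2
        omega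
    refine DFunLike.ext _ _ fun s => le_antisymm (orderEmb_le j s) ?_
    have h1 := key s s.2
    rw [Fin.eta] at h1
    rw [lastCols_apply, Fin.le_def, Fin.val_rev, Fin.val_castLE, Fin.val_rev]
    omega

variable (R n) in
/-- The antidiagonal matrix with entries `1, -1, 1, …`. -/
def antiDiag : Matrix (Fin n) (Fin n) R :=
  Matrix.of fun i j => if j = i.rev then (-1) ^ (i : ℕ) else 0

theorem antiDiag_map {R' : Type*} [CommRing R'] (f : R →+* R') :
    (antiDiag R n).map f = antiDiag R' n := by
  ext i j
  simp only [antiDiag, Matrix.map_apply, Matrix.of_apply]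
  split_ifs <;> simp

/-- The signs of the entries cancel the cofactor signs: the last row has a single nonzero entry, in
column $0$, and deleting both leaves the matrix of the same shape one size smaller. -/
theorem det_antiDiag : (antiDiag R n).det = 1 := by
  induction n with
  | zero => simp
  | succ n ih =>
    rw [Matrix.det_succ_row _ (Fin.last n), Finset.sum_eq_single 0]
    · have : (antiDiag R (n + 1)).submatrix (Fin.last n).succAbove (Fin.succAbove 0) =
          antiDiag R n := by
        ext i j
        simp only [antiDiag, Matrix.submatrix_apply, Matrix.of_apply, Fin.succAbove_last,
          Fin.succAbove_zero, Fin.rev_castSucc, Fin.succ_inj, Fin.val_castSucc]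
      rw [this, ih]
      simp [antiDiag, ← mul_pow]
    · intro j _ hj
      simp [antiDiag, hj]
    · simp

/-- The first rows and last columns of $w$ form the signed antidiagonal matrix of size $i+1$; the
signs match because they depend only on the row. -/
theorem det_antiDiag_lastCols (i : Fin n) :
    ((antiDiag R n).submatrix (Fin.castLE i.2) (lastCols i)).det = 1 := by
  rw [← det_antiDiag (R := R) (n := i + 1)]
  congr 1
  ext r s
  simp only [antiDiag, Matrix.submatrix_apply, Matrix.of_apply, lastCols_apply, Fin.rev_inj,
    Fin.val_castLE, Fin.castLE_inj]
  congr 1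
  rw [Fin.rev_eq_iff]

theorem det_antiDiag_eq_zero {i : Fin n} {j : Fin (i + 1) ↪o Fin n} (h : j ≠ lastCols i) :
    ((antiDiag R n).submatrix (Fin.castLE i.2) j).det = 0 := by
  refine Matrix.det_eq_zero_of_column_eq_zero 0 fun r => ?_
  have := ((eq_lastCols_or_lt j).resolve_left h r).ne
  simp [antiDiag, this]

/-- Right multiplication by an upper triangular matrix multiplies the minors of the first rows of
the antidiagonal matrix by diagonal entries. -/
theorem det_antiDiag_mul {h : Matrix (Fin n) (Fin n) R} (hh : ∀ i j, j < i → h i j = 0)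
    (i : Fin n) (j : Fin (i + 1) ↪o Fin n) :
    ((antiDiag R n * h).submatrix (Fin.castLE i.2) j).det =
      (∏ r : Fin (i + 1), h (Fin.castLE i.2 r).rev (Fin.castLE i.2 r).rev) *
        ((antiDiag R n).submatrix (Fin.castLE i.2) j).det := by
  -- $L$ is chosen with $wh=Lw$. Reversing rows and columns makes it lower triangular, so its first
  -- $i+1$ rows vanish outside the first $i+1$ columns, and the minor of $Lw$ is a product of two
  -- determinants, with no further terms from Cauchy–Binet.
  set L : Matrix (Fin n) (Fin n) R :=
    Matrix.of fun r m => (-1) ^ (r : ℕ) * (-1) ^ (m : ℕ) * h r.rev m.rev with hL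
  have hL0 : ∀ r m, r < m → L r m = 0 := fun r m hrm => by
    simp [hL, hh r.rev m.rev (Fin.rev_lt_rev.mpr hrm)]
  have e : antiDiag R n * h = L * antiDiag R n := by
    ext r c
    rw [Matrix.mul_apply, Matrix.mul_apply, Finset.sum_eq_single r.rev,
      Finset.sum_eq_single c.rev]
    · simp only [antiDiag, Matrix.of_apply, Fin.rev_rev, if_true, hL]
      have : ((-1 : R) ^ ((c.rev : Fin n) : ℕ)) * (-1) ^ ((c.rev : Fin n) : ℕ) = 1 := by
        rw [← mul_pow]; simp
      linear_combination (-(-1) ^ (r : ℕ) * h r.rev c) * this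
    · intro m _ hm
      have : c ≠ m.rev := fun h => hm (by rw [h, Fin.rev_rev])
      simp [antiDiag, this]
    · simp
    · intro m _ hm
      simp [antiDiag, hm]
    · simp
  have e2 : (L * antiDiag R n).submatrix (Fin.castLE i.2) j =
      L.submatrix (Fin.castLE i.2) (Fin.castLE i.2) *
        (antiDiag R n).submatrix (Fin.castLE i.2) j := by
    ext r s
    rw [Matrix.submatrix_apply, Matrix.mul_apply, Matrix.mul_apply]
    simp only [Matrix.submatrix_apply]
    symm
    refine Finset.sum_of_injOn (Fin.castLE i.2) (Fin.castLE_injective _).injOn (by simp) ?_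
      (fun _ _ => rfl)
    intro m _ hm
    rw [hL0, zero_mul]
    rw [Fin.lt_def, Fin.val_castLE]
    by_contra hlt
    exact hm ⟨⟨m, by omega⟩, by simp, by ext; simp⟩
  rw [e, e2, Matrix.det_mul]
  congr 1
  rw [Matrix.det_of_isLowerTriangular]
  · refine Finset.prod_congr rfl fun r _ => ?_
    simp only [Matrix.submatrix_apply, hL, Matrix.of_apply]
    rw [← mul_pow]; simp
  · intro r m hrm
    exact hL0 _ _ hrm

end AntiDiagonal

/-! ### Right weights of monomials and evaluation at the antidiagonal matrix -/

section Lowest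

variable {l : ℕ} [Fact l.Prime] {n : ℕ}

/-- Evaluation of polynomials at a matrix. -/
noncomputable def evalMat (Z : Matrix (Fin n) (Fin n) (PadicAlgCl l)) :
    MatPoly l n →ₐ[PadicAlgCl l] PadicAlgCl l :=
  MvPolynomial.aeval fun p => Z p.1 p.2

theorem evalMat_rightAct (Z g : Matrix (Fin n) (Fin n) (PadicAlgCl l)) (f : MatPoly l n) :
    evalMat Z (rightAct g f) = evalMat (Z * g) f := by
  suffices H : (evalMat Z).comp (rightAct (l := l) g) = evalMat (Z * g) from
    DFunLike.congr_fun H f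
  refine MvPolynomial.algHom_ext fun p => ?_
  simp [rightAct_X, evalMat, Matrix.mul_apply]

theorem evalMat_minor (Z : Matrix (Fin n) (Fin n) (PadicAlgCl l)) (i : Fin n)
    (j : Fin (i + 1) ↪o Fin n) :
    evalMat Z (minor i j) = (Z.submatrix (Fin.castLE i.2) j).det := by
  rw [minor, AlgHom.map_det]
  congr 1
  ext r s
  simp [evalMat]

theorem torusChar_add (t t' : Fin n → ℤ) (d : Fin n → (PadicAlgCl l)ˣ) :
    torusChar (t + t') d = torusChar t d * torusChar t' d := by
  simp [torusChar, zpow_add, Finset.prod_mul_distrib]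

theorem IsRightWeight.mul {t t' : Fin n → ℤ} {f f' : MatPoly l n} (h : IsRightWeight t f)
    (h' : IsRightWeight t' f') : IsRightWeight (t + t') (f * f') := by
  intro d
  rw [map_mul, h d, h' d, torusChar_add, Units.val_mul, smul_mul_smul_comm]

theorem isRightWeight_one : IsRightWeight 0 (1 : MatPoly l n) := by
  intro d; simp [torusChar]

/-- The unit `l` of `ℚ̄_l`. -/
noncomputable def lUnit (l : ℕ) [Fact l.Prime] : (PadicAlgCl l)ˣ :=
  Units.mk0 (l : PadicAlgCl l) natCast_l_ne_zero

theorem lUnit_zpow_injective : Function.Injective fun m : ℤ => lUnit l ^ m := by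
  intro m m' h
  have hn : ‖(l : PadicAlgCl l)‖ = (l : ℝ)⁻¹ := by
    have := PadicAlgCl.norm_extends l (l : ℚ_[l])
    simpa using this
  have h3 := congrArg (fun x : (PadicAlgCl l)ˣ => ‖(x : PadicAlgCl l)‖) h
  simp only [lUnit, Units.val_zpow_eq_zpow_val, Units.val_mk0, norm_zpow, hn] at h3
  rw [inv_zpow, inv_zpow, inv_inj] at h3
  exact zpow_right_injective₀ (by exact_mod_cast (Fact.out : l.Prime).pos)
    (by exact_mod_cast (Fact.out : l.Prime).one_lt.ne') h3

/-- Diagonal matrices with one entry $l$ and the others $1$ suffice to separate weights, since the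
powers of $l$ have distinct norms. -/
theorem IsRightWeight.unique {t t' : Fin n → ℤ} {f : MatPoly l n} (hf : f ≠ 0)
    (h : IsRightWeight t f) (h' : IsRightWeight t' f) : t = t' := by
  funext i
  have h1 := (h (Function.update 1 i (lUnit l))).symm.trans (h' (Function.update 1 i (lUnit l)))
  have h2 := Units.ext (smul_left_injective (PadicAlgCl l) hf h1)
  have key : ∀ t : Fin n → ℤ, torusChar t (Function.update 1 i (lUnit l)) = lUnit l ^ t i := by
    intro t
    rw [torusChar, Finset.prod_eq_single i]
    · simp
    · intro b _ hb; simp [Function.update_of_ne hb]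
    · simp
  rw [key, key] at h2
  exact lUnit_zpow_injective h2

/-- The right weight of the minor with columns `j`. -/
def colWeight {i : Fin n} (j : Fin (i + 1) ↪o Fin n) : Fin n → ℤ :=
  fun c => if c ∈ Finset.univ.map j.toEmbedding then 1 else 0

theorem isRightWeight_minor (i : Fin n) (j : Fin (i + 1) ↪o Fin n) :
    IsRightWeight (colWeight j) (minor (l := l) i j) := by
  intro d
  rw [rightAct_diagonal_minor, ← Units.coe_prod]
  congr 2
  rw [torusChar]
  have : ∀ c, d c ^ colWeight j c = if c ∈ Finset.univ.map j.toEmbedding then d c else 1 := by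
    intro c
    rw [colWeight]
    split_ifs <;> simp
  simp only [this, Finset.prod_ite_mem, Finset.univ_inter, Finset.prod_map]
  rfl

theorem sum_mul_colWeight (b : Fin n → ℕ) {i : Fin n} (j : Fin (i + 1) ↪o Fin n) :
    ∑ c, (b c : ℤ) * colWeight j c = ∑ s, (b (j s) : ℤ) := by
  simp only [colWeight, mul_ite, mul_one, mul_zero, Finset.sum_ite_mem, Finset.univ_inter,
    Finset.sum_map]
  rfl

theorem colWeight_lastCols (i : Fin n) : colWeight (lastCols i) = fun c => minorWeight i c.rev := by
  funext c
  rw [colWeight, minorWeight]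
  congr 1
  simp only [Finset.mem_map, Finset.mem_univ, true_and, eq_iff_iff]
  constructor
  · rintro ⟨s, rfl⟩
    change (lastCols i s).rev ≤ i
    rw [lastCols_apply, Fin.rev_rev, Fin.le_def, Fin.val_castLE]
    have := s.rev.2
    omega
  · intro h
    rw [Fin.le_def] at h
    refine ⟨(⟨c.rev, by omega⟩ : Fin (i + 1)).rev, ?_⟩
    change lastCols i _ = c
    rw [lastCols_apply, Fin.rev_rev]
    ext
    simp only [Fin.val_rev, Fin.val_castLE]
    omega

theorem twistExp_eq_sum (b : Fin n → ℕ) (t : Fin n → ℤ) :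
    twistExp b t = ∑ c, (b c : ℤ) * t c.rev := rfl

theorem twistExp_minorWeight (b : Fin n → ℕ) (i : Fin n) :
    twistExp b (minorWeight i) = ∑ s, (b (lastCols i s) : ℤ) := by
  rw [← sum_mul_colWeight, colWeight_lastCols, twistExp_eq_sum]

/-- Each column of $j$ is at most the corresponding one of the last columns, and the first is
strictly smaller. Strict decrease of $b$ is what makes the inequality strict, hence what lets $U_l$
isolate the lowest weight vector. -/
theorem twistExp_minorWeight_lt {b : Fin n → ℕ} (hb : StrictAnti b) {i : Fin n}
    {j : Fin (i + 1) ↪o Fin n} (hj : j ≠ lastCols i) :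
    twistExp b (minorWeight i) < ∑ s, (b (j s) : ℤ) := by
  rw [twistExp_minorWeight]
  refine Finset.sum_lt_sum (fun s _ => by exact_mod_cast hb.antitone (orderEmb_le j s))
    ⟨0, Finset.mem_univ _, ?_⟩
  exact_mod_cast hb ((eq_lastCols_or_lt j).resolve_left hj _)

/-- The differences `t_i - t_{i+1}`, with `t_{n+1} = 0`. -/
def weightDiff (t : Fin n → ℤ) (i : Fin n) : ℤ :=
  t i - if h : (i : ℕ) + 1 < n then t ⟨i + 1, h⟩ else 0

theorem weightDiff_add (t t' : Fin n → ℤ) : weightDiff (t + t') = weightDiff t + weightDiff t' := by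
  funext i
  simp only [weightDiff, Pi.add_apply]
  split_ifs <;> ring

theorem weightDiff_zero : weightDiff (0 : Fin n → ℤ) = 0 := by
  funext i
  simp [weightDiff]

/-- The weights of the minors are the fundamental weights, and `weightDiff` gives coordinates with
respect to them. -/
theorem weightDiff_minorWeight (i : Fin n) : weightDiff (minorWeight i) = Pi.single i 1 := by
  funext r
  rw [weightDiff, Pi.single_apply]
  simp only [minorWeight, Fin.le_def, Fin.ext_iff]
  have := r.2
  have := i.2
  split_ifs <;> omega

theorem weightDiff_nonneg {t : Fin n → ℤ} (ht : Antitone t) (h0 : ∀ i, 0 ≤ t i) :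
    0 ≤ weightDiff t := by
  intro i
  rw [weightDiff, Pi.zero_apply]
  split_ifs with h
  · exact sub_nonneg.mpr (ht (by rw [Fin.le_def]; simp))
  · simpa using h0 i

theorem sum_weightDiff (t : Fin n → ℤ) : ∑ i, weightDiff t i • minorWeight i = t := by
  funext r
  -- Extension of $t$ by zero, matching the convention $t_{n+1}=0$ in `weightDiff`: the sum over
  -- $i\ge r$ telescopes to $t'_r-t'_n=t_r$.
  set t' : ℕ → ℤ := fun m => if h : m < n then t ⟨m, h⟩ else 0 with ht'
  have e1 : ∀ i : Fin n, weightDiff t i = t' i - t' (i + 1) := by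
    intro i
    simp [weightDiff, ht']
  have e2 : (∑ i, weightDiff t i • minorWeight i) r =
      ∑ i : Fin n, if (r : ℕ) ≤ i then t' i - t' (i + 1) else 0 := by
    rw [Finset.sum_apply]
    refine Finset.sum_congr rfl fun i _ => ?_
    simp only [Pi.smul_apply, smul_eq_mul, minorWeight, Fin.le_def, e1, mul_ite, mul_one, mul_zero]
  rw [e2, Fin.sum_univ_eq_sum_range (fun i => if (r : ℕ) ≤ i then t' i - t' (i + 1) else 0) n,
    ← Finset.sum_filter]
  have e3 : (Finset.range n).filter (fun i => (r : ℕ) ≤ i) = Finset.Ico (r : ℕ) n := by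
    ext i; simp [and_comm]
  have e4 := Finset.sum_Ico_sub t' r.2.le
  rw [e3, ← neg_inj, ← Finset.sum_neg_distrib]
  simp only [neg_sub]
  rw [e4]
  simp [ht']

variable (l) in
/-- The lowest weight vector of `X_t`. -/
noncomputable def lowVec (t : Fin n → ℤ) : MatPoly l n :=
  ∏ i, minor i (lastCols i) ^ (weightDiff t i).toNat

/-- Nonnegativity matters because `toNat` truncates: only then do the exponents add. -/
theorem lowVec_add {t t' : Fin n → ℤ} (h : 0 ≤ weightDiff t) (h' : 0 ≤ weightDiff t') :
    lowVec l (t + t') = lowVec l t * lowVec l t' := by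
  rw [lowVec, lowVec, lowVec, ← Finset.prod_mul_distrib]
  refine Finset.prod_congr rfl fun i _ => ?_
  rw [← pow_add, weightDiff_add, Pi.add_apply, Int.toNat_add (h i) (h' i)]

theorem lowVec_zero : lowVec l (0 : Fin n → ℤ) = 1 := by
  simp [lowVec, weightDiff_zero]

theorem lowVec_minorWeight (i : Fin n) : lowVec l (minorWeight i) = minor i (lastCols i) := by
  rw [lowVec, Finset.prod_eq_single i]
  · simp [weightDiff_minorWeight]
  · intro r _ hr
    simp [weightDiff_minorWeight, Pi.single_eq_of_ne hr]
  · simp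

theorem IsLeftWeight.pow {t : Fin n → ℤ} {f : MatPoly l n} (h : IsLeftWeight t f) (m : ℕ) :
    IsLeftWeight ((m : ℤ) • t) (f ^ m) := by
  induction m with
  | zero => simpa using isLeftWeight_one
  | succ m ih =>
    rw [pow_succ, Nat.cast_succ, add_smul, one_smul]
    exact ih.mul h

theorem IsLeftWeight.prod {ι : Type*} (s : Finset ι) {t : ι → Fin n → ℤ} {f : ι → MatPoly l n}
    (h : ∀ i ∈ s, IsLeftWeight (t i) (f i)) : IsLeftWeight (∑ i ∈ s, t i) (∏ i ∈ s, f i) := by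
  classical
  induction s using Finset.induction_on with
  | empty => simpa using isLeftWeight_one
  | insert i s hi ih =>
    rw [Finset.sum_insert hi, Finset.prod_insert hi]
    exact (h i (Finset.mem_insert_self _ _)).mul
      (ih fun j hj => h j (Finset.mem_insert_of_mem hj))

theorem lowVec_mem {t : Fin n → ℤ} (h : 0 ≤ weightDiff t) : lowVec l t ∈ weightMonomials l t := by
  have h0 : ∀ i : Fin n, minor i (lastCols i) ∈ minorMonomials l n := fun i =>
    Submonoid.subset_closure ⟨i, _, rfl⟩
  refine ⟨Submonoid.prod_mem _ fun i _ => Submonoid.pow_mem _ (h0 i) _, ?_⟩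
  have h1 : IsLeftWeight (∑ i, ((weightDiff t i).toNat : ℤ) • minorWeight i) (lowVec l t) :=
    IsLeftWeight.prod _ fun i _ => (isLeftWeight_minor i (lastCols i)).pow _
  have h2 : ∀ i, ((weightDiff t i).toNat : ℤ) = weightDiff t i := fun i => Int.toNat_of_nonneg (h i)
  simp only [h2, sum_weightDiff] at h1
  exact h1

/-- A monomial is the lowest weight vector, with value `1` at the antidiagonal matrix, or has larger
right weight and value `0`. -/
theorem minorMonomials_lowest {f : MatPoly l n} (hf : f ∈ minorMonomials l n) :
    ∃ p q : Fin n → ℤ, IsLeftWeight p f ∧ IsRightWeight q f ∧ 0 ≤ p ∧ 0 ≤ weightDiff p ∧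
      (p = 0 → f = 1) ∧
      (((q = fun c => p c.rev) ∧ evalMat (antiDiag _ n) f = 1 ∧ f = lowVec l p) ∨
        ((∀ b : Fin n → ℕ, StrictAnti b → twistExp b p < ∑ c, (b c : ℤ) * q c) ∧
          evalMat (antiDiag _ n) f = 0)) := by
  -- The induction carries two positivity statements: $p\ge0$, so that $p+p'=0$ forces both weights
  -- to vanish and $1$ is the only monomial of weight $0$, and nonnegative differences, so that
  -- `lowVec_add` applies to products.
  induction hf using Submonoid.closure_induction with
  | mem f h =>
    obtain ⟨i, j, rfl⟩ := h
    refine ⟨minorWeight i, colWeight j, isLeftWeight_minor i j, isRightWeight_minor i j, ?_, ?_,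
      fun h => ?_, ?_⟩
    · intro r
      simp only [minorWeight, Pi.zero_apply]
      split_ifs <;> simp
    · rw [weightDiff_minorWeight]
      exact Pi.single_nonneg.mpr zero_le_one
    · have := congrFun h i
      simp [minorWeight] at this
    · by_cases hj : j = lastCols i
      · subst hj
        refine Or.inl ⟨colWeight_lastCols i, ?_, (lowVec_minorWeight i).symm⟩
        rw [evalMat_minor, det_antiDiag_lastCols]
      · refine Or.inr ⟨fun b hb => ?_, ?_⟩
        · rw [sum_mul_colWeight]
          exact twistExp_minorWeight_lt hb hj
        · rw [evalMat_minor, det_antiDiag_eq_zero hj]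
  | one =>
    refine ⟨0, 0, isLeftWeight_one, isRightWeight_one, le_rfl, weightDiff_zero.ge, fun _ => rfl,
      Or.inl ⟨rfl, map_one _, lowVec_zero.symm⟩⟩
  | mul f f' _ _ h h' =>
    obtain ⟨p, q, h1, h2, h3, h4, h5, h6⟩ := h
    obtain ⟨p', q', h1', h2', h3', h4', h5', h6'⟩ := h'
    refine ⟨p + p', q + q', h1.mul h1', h2.mul h2', add_nonneg h3 h3', ?_, fun h => ?_, ?_⟩
    · rw [weightDiff_add]; exact add_nonneg h4 h4'
    · obtain ⟨e, e'⟩ := (add_eq_zero_iff_of_nonneg h3 h3').mp h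
      rw [h5 e, h5' e', mul_one]
    · have hsum : ∀ b : Fin n → ℕ, ∑ c, (b c : ℤ) * (q + q') c =
          ∑ c, (b c : ℤ) * q c + ∑ c, (b c : ℤ) * q' c := by
        intro b
        simp [mul_add, Finset.sum_add_distrib]
      -- A product is lowest exactly when both factors are. If one factor is not, its strict
      -- inequality adds to the at least weak inequality of the other, and its value $0$ at $w$
      -- kills the product.
      rcases h6 with ⟨rfl, e, rfl⟩ | ⟨hlt, e⟩
      · rcases h6' with ⟨rfl, e', rfl⟩ | ⟨hlt', e'⟩
        · exact Or.inl ⟨rfl, by rw [map_mul, e, e', mul_one], (lowVec_add h4 h4').symm⟩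
        · refine Or.inr ⟨fun b hb => ?_, by rw [map_mul, e', mul_zero]⟩
          rw [hsum, twistExp_add]
          exact add_lt_add_of_le_of_lt le_rfl (hlt' b hb)
      · refine Or.inr ⟨fun b hb => ?_, by rw [map_mul, e, zero_mul]⟩
        rw [hsum, twistExp_add]
        refine add_lt_add_of_lt_of_le (hlt b hb) ?_
        rcases h6' with ⟨rfl, -, -⟩ | ⟨hlt', -⟩
        · exact le_rfl
        · exact (hlt' b hb).le

theorem evalMat_lowVec {t : Fin n → ℤ} : evalMat (antiDiag _ n) (lowVec l t) = 1 := by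
  rw [lowVec, map_prod]
  refine Finset.prod_eq_one fun i _ => ?_
  rw [map_pow, evalMat_minor, det_antiDiag_lastCols, one_pow]

theorem weightMonomials_lowest {t : Fin n → ℤ} {f : MatPoly l n} (hf : f ∈ weightMonomials l t) :
    ∃ q : Fin n → ℤ, IsRightWeight q f ∧
      (((q = fun c => t c.rev) ∧ evalMat (antiDiag _ n) f = 1 ∧ f = lowVec l t) ∨
        ((∀ b : Fin n → ℕ, StrictAnti b → twistExp b t < ∑ c, (b c : ℤ) * q c) ∧
          evalMat (antiDiag _ n) f = 0)) := by
  obtain ⟨p, q, h1, h2, -, -, -, h3⟩ := minorMonomials_lowest hf.1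
  rw [hf.2.unique (minorMonomials_spec hf.1).1 h1]
  exact ⟨q, h2, h3⟩

/-- For the lowest right weight the strict alternative fails: tested on the exponents
$(n-1,\dots,1,0)$ it would say that a number is less than itself. -/
theorem evalMat_of_isRightWeight {t : Fin n → ℤ} {f : MatPoly l n} (hf : f ∈ weightMonomials l t)
    (h : IsRightWeight (fun c => t c.rev) f) : evalMat (antiDiag _ n) f = 1 := by
  obtain ⟨q, h1, ⟨-, h2, -⟩ | ⟨h2, -⟩⟩ := weightMonomials_lowest hf
  · exact h2
  · have hb : StrictAnti fun i : Fin n => n - 1 - (i : ℕ) := fun i j hij => by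
      rw [Fin.lt_def] at hij
      have := j.2
      change n - 1 - (j : ℕ) < n - 1 - (i : ℕ)
      omega
    have := h2 _ hb
    rw [h1.unique (minorMonomials_spec hf.1).1 h, twistExp_eq_sum] at this
    exact absurd this (lt_irrefl _)

theorem evalMat_of_not_isRightWeight {t : Fin n → ℤ} {f : MatPoly l n}
    (hf : f ∈ weightMonomials l t) (h : ¬ IsRightWeight (fun c => t c.rev) f) :
    evalMat (antiDiag _ n) f = 0 := by
  obtain ⟨q, h1, ⟨rfl, -, -⟩ | ⟨-, h2⟩⟩ := weightMonomials_lowest hf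
  · exact absurd h1 h
  · exact h2

theorem weightMonomials_zero {f : MatPoly l n} (hf : f ∈ weightMonomials l 0) : f = 1 := by
  obtain ⟨p, q, h1, -, -, -, h2, -⟩ := minorMonomials_lowest hf.1
  exact h2 (h1.unique (minorMonomials_spec hf.1).1 hf.2)

theorem evalMat_antiDiag_mem {t : Fin n → ℤ} {f : MatPoly l n} (hf : f ∈ XLattice l t) :
    evalMat (antiDiag _ n) f ∈ OK l := by
  induction hf using Submodule.span_induction with
  | mem f h =>
    obtain ⟨q, -, ⟨-, h2, -⟩ | ⟨-, h2⟩⟩ := weightMonomials_lowest h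
    · rw [h2]; exact one_mem _
    · rw [h2]; exact zero_mem _
  | zero => simp
  | add x y _ _ hx hy => rw [map_add]; exact add_mem hx hy
  | smul c x _ hx =>
    have : evalMat (antiDiag _ n) (c • x) = (c : PadicAlgCl l) * evalMat (antiDiag _ n) x :=
      map_smul (evalMat (antiDiag _ n)) (c : PadicAlgCl l) x
    rw [this]; exact mul_mem c.2 hx

variable (l) in
/-- The projection of `X_t` to the coefficient of the lowest weight vector: evaluation at the
antidiagonal matrix. -/
noncomputable def lowCoeff (t : Fin n → ℤ) : XLattice l t →ₗ[OK l] OK l where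
  toFun f := ⟨evalMat (antiDiag _ n) f.1, evalMat_antiDiag_mem f.2⟩
  map_add' f f' := Subtype.ext (map_add (evalMat (antiDiag _ n)) f.1 f'.1)
  map_smul' c f := Subtype.ext (map_smul (evalMat (antiDiag _ n)) (c : PadicAlgCl l) f.1)

variable (l n) in
/-- The generator `1` of `X_0`. -/
noncomputable def oneVec : XLattice l (0 : Fin n → ℤ) :=
  ⟨1, Submodule.subset_span ⟨one_mem _, isLeftWeight_one⟩⟩

/-- $X_0$ is spanned by $1$, the only monomial of left weight $0$, and evaluation recovers the
scalar. -/
theorem lowCoeff_smul_oneVec (f : XLattice l (0 : Fin n → ℤ)) :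
    lowCoeff l 0 f • oneVec l n = f := by
  obtain ⟨f, hf⟩ := f
  refine Subtype.ext ?_
  change evalMat (antiDiag _ n) f • (1 : MatPoly l n) = f
  induction hf using Submodule.span_induction with
  | mem f h => rw [weightMonomials_zero h, map_one, one_smul]
  | zero => simp
  | add x y _ _ hx hy => rw [map_add, add_smul, hx, hy]
  | smul c x _ hx =>
    have : evalMat (antiDiag _ n) (c • x) = (c : PadicAlgCl l) * evalMat (antiDiag _ n) x :=
      map_smul (evalMat (antiDiag _ n)) (c : PadicAlgCl l) x
    rw [this, mul_smul, hx]
    rfl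

theorem lowCoeff_oneVec : lowCoeff l 0 (oneVec l n) = 1 :=
  Subtype.ext (map_one (evalMat (antiDiag _ n)))

theorem latticeAct_zero {g : Matrix (Fin n) (Fin n) (PadicAlgCl l)} (hg : ∀ i j, g i j ∈ OK l) :
    latticeAct 0 g hg = 1 := by
  refine LinearMap.ext fun f => ?_
  have h : latticeAct 0 g hg (oneVec l n) = oneVec l n := Subtype.ext (map_one (rightAct g))
  rw [Module.End.one_apply, ← lowCoeff_smul_oneVec f, map_smul, h]

theorem twistAct_weight_zero {b : Fin n → ℕ} (hb : Antitone b) :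
    twistAct (l := l) 0 b hb = 1 := by
  refine LinearMap.ext fun f => ?_
  have h : twistAct 0 b hb (oneVec l n) = oneVec l n := by
    refine Subtype.ext ?_
    change (l : PadicAlgCl l) ^ (-twistExp b 0) • rightAct (lDiag l b) 1 = 1
    simp [twistExp]
  rw [Module.End.one_apply, ← lowCoeff_smul_oneVec f, map_smul, h]

theorem twistAct_exp_zero (t : Fin n → ℤ) :
    twistAct (l := l) t (fun _ => 0) antitone_const = 1 := by
  refine LinearMap.ext fun f => Subtype.ext ?_
  change (l : PadicAlgCl l) ^ (-twistExp (fun _ => 0) t) • rightAct (lDiag l fun _ => 0) f.1 = f.1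
  have : (lDiag l (fun _ => 0) : Matrix (Fin n) (Fin n) (PadicAlgCl l)) = 1 := by simp [lDiag]
  rw [this, rightAct_one]
  simp [twistExp]

theorem torusChar_lUnit_pow (q : Fin n → ℤ) (b : Fin n → ℕ) :
    torusChar q (fun i => lUnit l ^ b i) = lUnit l ^ ∑ c, (b c : ℤ) * q c := by
  rw [torusChar]
  refine Eq.trans ?_ (map_prod (zpowersHom _ (lUnit l))
    (fun c => Multiplicative.ofAdd ((b c : ℤ) * q c)) Finset.univ).symm
  refine Finset.prod_congr rfl fun c _ => ?_
  rw [zpowersHom_apply, toAdd_ofAdd, zpow_mul, zpow_natCast]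

/-- Modulo `l`, the twisted action of `diag(l ^ b_1, …, l ^ b_n)` with `b_1 > ⋯ > b_n` is the
projection to the lowest weight vector. -/
theorem twistAct_sub_mem {t : Fin n → ℤ} (ht : 0 ≤ weightDiff t) {b : Fin n → ℕ}
    (hb : StrictAnti b) (f : XLattice l t) :
    ∃ r : XLattice l t, twistAct t b hb.antitone f =
      lowCoeff l t f • ⟨lowVec l t, Submodule.subset_span (lowVec_mem ht)⟩ + (l : OK l) • r := by
  obtain ⟨f, hf⟩ := f
  suffices H : ∃ r ∈ XLattice l t, (l : PadicAlgCl l) ^ (-twistExp b t) • rightAct (lDiag l b) f =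
      evalMat (antiDiag _ n) f • lowVec l t + (l : PadicAlgCl l) • r by
    obtain ⟨r, hr, h⟩ := H
    exact ⟨⟨r, hr⟩, Subtype.ext h⟩
  induction hf using Submodule.span_induction with
  | mem f h =>
    obtain ⟨q, hq, hlow⟩ := weightMonomials_lowest h
    have h1 := hq fun i => lUnit l ^ b i
    have h2 : (Matrix.diagonal fun i => ((lUnit l ^ b i : (PadicAlgCl l)ˣ) : PadicAlgCl l)) =
        lDiag l b := by
      simp [lDiag, lUnit]
    rw [h2, torusChar_lUnit_pow, Units.val_zpow_eq_zpow_val] at h1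
    have h3 : (l : PadicAlgCl l) ^ (-twistExp b t) • rightAct (lDiag l b) f =
        (l : PadicAlgCl l) ^ (-twistExp b t + ∑ c, (b c : ℤ) * q c) • f := by
      rw [h1, smul_smul, zpow_add₀ natCast_l_ne_zero]
      rfl
    rw [h3]
    rcases hlow with ⟨rfl, e, rfl⟩ | ⟨hlt, e⟩
    · refine ⟨0, zero_mem _, ?_⟩
      rw [e, twistExp_eq_sum, neg_add_cancel, zpow_zero, smul_zero, add_zero]
    -- The exponent is positive, say $s+1$: one factor $l$ is split off, and $l^sf$ remains in the
    -- lattice.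
    · obtain ⟨s, hs⟩ := Int.lt.dest (hlt b hb)
      refine ⟨(l : PadicAlgCl l) ^ s • f, Submodule.smul_mem (XLattice l t)
        (⟨_, pow_mem (natCast_mem_OK l) s⟩ : OK l) (Submodule.subset_span h), ?_⟩
      rw [e, zero_smul, zero_add, smul_smul, ← pow_succ', ← hs, neg_add_cancel_left, zpow_natCast]
  | zero => exact ⟨0, zero_mem _, by simp⟩
  | add x y _ _ hx hy =>
    obtain ⟨r, hr, h⟩ := hx
    obtain ⟨r', hr', h'⟩ := hy
    refine ⟨r + r', add_mem hr hr', ?_⟩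
    rw [map_add, smul_add, h, h', map_add, add_smul, smul_add]
    abel
  | smul c x _ hx =>
    obtain ⟨r, hr, h⟩ := hx
    refine ⟨c • r, Submodule.smul_mem _ c hr, ?_⟩
    have e1 : rightAct (lDiag l b) (c • x) = (c : PadicAlgCl l) • rightAct (lDiag l b) x :=
      map_smul (rightAct (lDiag l b)) (c : PadicAlgCl l) x
    have e2 : evalMat (antiDiag _ n) (c • x) = (c : PadicAlgCl l) * evalMat (antiDiag _ n) x :=
      map_smul (evalMat (antiDiag _ n)) (c : PadicAlgCl l) x
    have e3 : c • r = (c : PadicAlgCl l) • r := rfl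
    rw [e1, e2, e3, smul_comm, h, smul_add, smul_smul, smul_comm (c : PadicAlgCl l)]

/-- The claim is multiplicative in $f$, so it reduces to a minor. There $g$ becomes upper triangular
over $k$ and `det_antiDiag_mul` applies. The witnesses $x$ and $y$ record that the values lie in
$\mathcal{O}$, which is needed before they can be reduced. -/
theorem evalMat_antiDiag_mul_residue {g : Matrix (Fin n) (Fin n) (OK l)} {d : Fin n → (kbar l)ˣ}
    (hd : ∀ i, IsLocalRing.residue _ (g i i) = d i)
    (hg : ∀ i j, j < i → IsLocalRing.residue (OK l) (g i j) = 0)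
    {f : MatPoly l n} (hf : f ∈ minorMonomials l n) :
    ∃ (p : Fin n → ℤ) (x y : OK l), IsLeftWeight p f ∧
      evalMat (antiDiag _ n * g.map (OK l).subtype) f = x ∧ evalMat (antiDiag _ n) f = y ∧
      IsLocalRing.residue _ x =
        ((∏ i, d i ^ p i.rev : (kbar l)ˣ) : kbar l) * IsLocalRing.residue _ y := by
  induction hf using Submonoid.closure_induction with
  | mem f h =>
    obtain ⟨i, j, rfl⟩ := h
    refine ⟨minorWeight i, ((antiDiag (OK l) n * g).submatrix (Fin.castLE i.2) j).det,
      ((antiDiag (OK l) n).submatrix (Fin.castLE i.2) j).det, isLeftWeight_minor i j, ?_, ?_, ?_⟩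
    -- The determinants are taken over $\mathcal{O}$, so that the same element maps to the
    -- evaluation in $K$ and to the reduced determinant in $k$.
    · rw [evalMat_minor, ← antiDiag_map (OK l).subtype, ← Matrix.map_mul, Matrix.submatrix_map]
      exact (RingHom.map_det (OK l).subtype _).symm
    · rw [evalMat_minor, ← antiDiag_map (OK l).subtype, Matrix.submatrix_map]
      exact (RingHom.map_det (OK l).subtype _).symm
    · rw [RingHom.map_det, RingHom.map_det, RingHom.mapMatrix_apply, RingHom.mapMatrix_apply,
        ← Matrix.submatrix_map, ← Matrix.submatrix_map, Matrix.map_mul, antiDiag_map,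
        det_antiDiag_mul (h := g.map (IsLocalRing.residue (OK l))) hg]
      congr 1
      rw [Units.coe_prod, prod_castLE i (fun r => (g.map (IsLocalRing.residue (OK l))) r.rev r.rev),
        ← Equiv.prod_comp Fin.revPerm]
      refine Finset.prod_congr rfl fun c _ => ?_
      simp only [Fin.revPerm_apply, Matrix.map_apply, hd, Fin.rev_rev, minorWeight]
      split_ifs <;> simp
  | one =>
    refine ⟨0, 1, 1, isLeftWeight_one, by simp, by simp, by simp⟩
  | mul f f' _ _ h h' =>
    obtain ⟨p, x, y, h1, h2, h3, h4⟩ := h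
    obtain ⟨p', x', y', h1', h2', h3', h4'⟩ := h'
    refine ⟨p + p', x * x', y * y', h1.mul h1', by rw [map_mul, h2, h2']; rfl,
      by rw [map_mul, h3, h3']; rfl, ?_⟩
    rw [map_mul, map_mul, h4, h4']
    have : (∏ i, d i ^ (p + p') i.rev) = (∏ i, d i ^ p i.rev) * ∏ i, d i ^ p' i.rev := by
      rw [← Finset.prod_mul_distrib]
      exact Finset.prod_congr rfl fun i _ => by rw [Pi.add_apply, zpow_add]
    rw [this, Units.val_mul]
    ring

/-- Modulo the maximal ideal, an upper triangular matrix acts on the lowest weight quotient of `X_t`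
through a character of its diagonal. -/
theorem residue_lowCoeff_latticeAct {t : Fin n → ℤ} {g : Matrix (Fin n) (Fin n) (PadicAlgCl l)}
    (hg : ∀ i j, g i j ∈ OK l) {d : Fin n → (kbar l)ˣ}
    (hd : ∀ i, IsLocalRing.residue (OK l) ⟨g i i, hg i i⟩ = d i)
    (hg' : ∀ i j, j < i → IsLocalRing.residue (OK l) ⟨g i j, hg i j⟩ = 0) (f : XLattice l t) :
    IsLocalRing.residue _ (lowCoeff l t (latticeAct t g hg f)) =
      ((∏ i, d i ^ t i.rev : (kbar l)ˣ) : kbar l) * IsLocalRing.residue _ (lowCoeff l t f) := by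
  have hval : ∀ f : XLattice l t, (lowCoeff l t (latticeAct t g hg f) : PadicAlgCl l) =
      evalMat (antiDiag _ n * g) f.1 := fun f => evalMat_rightAct _ _ _
  obtain ⟨f, hf⟩ := f
  induction hf using Submodule.span_induction with
  | mem f h =>
    obtain ⟨p, x, y, h1, h2, h3, h4⟩ := evalMat_antiDiag_mul_residue
      (g := Matrix.of fun i j => (⟨g i j, hg i j⟩ : OK l)) hd hg' h.1
    rw [h1.unique (minorMonomials_spec h.1).1 h.2] at h4
    have e1 : lowCoeff l t (latticeAct t g hg ⟨f, Submodule.subset_span h⟩) = x :=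
      Subtype.ext ((hval _).trans h2)
    have e2 : lowCoeff l t ⟨f, Submodule.subset_span h⟩ = y := Subtype.ext h3
    rw [e1, e2, h4]
  | zero =>
    have : (⟨0, zero_mem _⟩ : XLattice l t) = 0 := rfl
    simp [this]
  | add x y hx hy ihx ihy =>
    have : (⟨x + y, add_mem hx hy⟩ : XLattice l t) = ⟨x, hx⟩ + ⟨y, hy⟩ := rfl
    rw [this, map_add, map_add, map_add, map_add, ihx, ihy, map_add, mul_add]
  | smul c x hx ih =>
    have : (⟨c • x, Submodule.smul_mem _ c hx⟩ : XLattice l t) = c • ⟨x, hx⟩ := rfl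
    rw [this, LinearMap.map_smul, LinearMap.map_smul, LinearMap.map_smul, smul_eq_mul, smul_eq_mul,
      map_mul, map_mul, ih]
    ring

end Lowest

/-! ## Splitting off one place in the adelic points of the unitary group -/

section Adelic

set_option linter.unusedSectionVars false

open IsDedekindDomain

variable {F : Type*} {M : Type*} [Field F] [NumberField F] [Field M] [NumberField M] [Algebra F M]
  {B : Type*} [DivisionRing B] [Algebra M B] [Algebra F B] [IsScalarTower F M B] {n : ℕ}

open Classical in
/-- The idempotent adele which is `1` at `v` and `0` at the other places. -/
noncomputable def idemAt (v : HeightOneSpectrum (𝓞 F)) : FiniteAdeleRing (𝓞 F) F :=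
  RestrictedProduct.single (fun v : HeightOneSpectrum (𝓞 F) => v.adicCompletionIntegers F) v 1

theorem evalAt_idemAt_same (v : HeightOneSpectrum (𝓞 F)) : evalAt F v (idemAt v) = 1 := by
  classical
  exact Pi.single_eq_same v 1

theorem evalAt_idemAt_of_ne {v v' : HeightOneSpectrum (𝓞 F)} (h : v' ≠ v) :
    evalAt F v' (idemAt v) = 0 := by
  classical
  exact Pi.single_eq_of_ne h 1

theorem finiteAdele_ext {x y : FiniteAdeleRing (𝓞 F) F} (h : ∀ v, evalAt F v x = evalAt F v y) :
    x = y := DFunLike.ext _ _ h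

theorem idemAt_mul_self (v : HeightOneSpectrum (𝓞 F)) : idemAt v * idemAt v = idemAt v := by
  refine finiteAdele_ext fun v' => ?_
  rw [map_mul]
  by_cases h : v' = v
  · subst h; rw [evalAt_idemAt_same, mul_one]
  · rw [evalAt_idemAt_of_ne h, mul_zero]

/-- Coordinates with respect to an $F$-basis of $B$ commute with evaluation at $v$, so equality is
tested on adelic coordinates place by place. -/
theorem adele_tensor_ext {x y : FiniteAdeleRing (𝓞 F) F ⊗[F] B}
    (h : ∀ v, Algebra.TensorProduct.map (evalAt F v) (AlgHom.id F B) x =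
      Algebra.TensorProduct.map (evalAt F v) (AlgHom.id F B) y) : x = y := by
  let b := Module.Basis.ofVectorSpace F B
  refine (b.baseChange (FiniteAdeleRing (𝓞 F) F)).ext_elem fun i => finiteAdele_ext fun v => ?_
  have key : ∀ z : FiniteAdeleRing (𝓞 F) F ⊗[F] B,
      evalAt F v ((b.baseChange (FiniteAdeleRing (𝓞 F) F)).repr z i) =
        (b.baseChange (v.adicCompletion F)).repr
          (Algebra.TensorProduct.map (evalAt F v) (AlgHom.id F B) z) i := by
    intro z
    induction z using TensorProduct.induction_on with
    | zero => simp
    | add z z' h h' => simp only [map_add, Finsupp.add_apply, h, h']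
    | tmul r c => simp [Module.Basis.baseChange_repr_tmul]
  rw [key, key, h]

namespace UnitaryDatum

variable (D : UnitaryDatum F M B n)

theorem proj_ext {g h : D.GA} (H : ∀ v, D.proj v g = D.proj v h) : g = h :=
  Subtype.ext <| Units.ext <| adele_tensor_ext fun v =>
    congrArg (fun x : D.G (v.adicCompletion F) => x.1.val) (H v)

theorem adj_tmul_one_mul {R : Type*} [CommRing R] [Algebra F R] (r : R) (x : R ⊗[F] B) :
    D.adj R ((r ⊗ₜ[F] (1 : B)) * x) = (r ⊗ₜ[F] (1 : B)) * D.adj R x := by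
  rw [adj_mul]
  have : D.adj R (r ⊗ₜ[F] (1 : B)) = r ⊗ₜ[F] (1 : B) := by simp [adj, D.inv_one]
  rw [this]
  induction D.adj R x using TensorProduct.induction_on with
  | zero => simp
  | add x y h h' => rw [add_mul, mul_add, h, h']
  | tmul s b => simp [Algebra.TensorProduct.tmul_mul_tmul, mul_comm]

/-- The idempotent $e$ splits $R$ as a product, and $eg+(1-e)$ is the point with component $g$ in
one factor and $1$ in the other. Scalars $r\otimes1$ are central and fixed by $\ddagger\otimes1$, so
one computation, `key`, gives both the inverse and the unitarity. -/
theorem exists_glue {R : Type*} [CommRing R] [Algebra F R] {e : R} (he : e * e = e) (g : D.G R) :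
    ∃ h : D.G R, h.1.val = (e ⊗ₜ[F] (1 : B)) * g.1.val + ((1 - e) ⊗ₜ[F] (1 : B)) := by
  have hcomm : ∀ (r : R) (x : R ⊗[F] B),
      x * (r ⊗ₜ[F] (1 : B)) = (r ⊗ₜ[F] (1 : B)) * x := by
    intro r x
    induction x using TensorProduct.induction_on with
    | zero => simp
    | add x y h h' => rw [add_mul, mul_add, h, h']
    | tmul s b => simp [Algebra.TensorProduct.tmul_mul_tmul, mul_comm]
  have he2 : (1 - e) * (1 - e) = 1 - e := by ring_nf; rw [pow_two, he]; ring
  have he3 : e * (1 - e) = 0 := by rw [mul_sub, he]; ring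
  have he4 : (1 - e) * e = 0 := by rw [sub_mul, he]; ring
  have key : ∀ x y : R ⊗[F] B, x * y = 1 →
      ((e ⊗ₜ[F] (1 : B)) * x + ((1 - e) ⊗ₜ[F] (1 : B))) *
        ((e ⊗ₜ[F] (1 : B)) * y + ((1 - e) ⊗ₜ[F] (1 : B))) = 1 := by
    intro x y hxy
    have m1 : (e ⊗ₜ[F] (1 : B)) * x * ((e ⊗ₜ[F] (1 : B)) * y) = e ⊗ₜ[F] (1 : B) := by
      rw [mul_assoc, ← mul_assoc x, hcomm, mul_assoc, hxy, mul_one,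
        Algebra.TensorProduct.tmul_mul_tmul, he, one_mul]
    have m2 : (e ⊗ₜ[F] (1 : B)) * x * ((1 - e) ⊗ₜ[F] (1 : B)) = 0 := by
      rw [hcomm, ← mul_assoc, Algebra.TensorProduct.tmul_mul_tmul, he4, TensorProduct.zero_tmul,
        zero_mul]
    have m3 : ((1 - e) ⊗ₜ[F] (1 : B)) * ((e ⊗ₜ[F] (1 : B)) * y) = 0 := by
      rw [← mul_assoc, Algebra.TensorProduct.tmul_mul_tmul, he4, TensorProduct.zero_tmul, zero_mul]
    rw [add_mul, mul_add, mul_add, m1, m2, m3, Algebra.TensorProduct.tmul_mul_tmul, he2, one_mul,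
      add_zero, zero_add, ← TensorProduct.add_tmul, add_sub_cancel, Algebra.TensorProduct.one_def]
  refine ⟨⟨⟨_, (e ⊗ₜ[F] (1 : B)) * g.1⁻¹.val + ((1 - e) ⊗ₜ[F] (1 : B)),
    key _ _ (Units.mul_inv _), key _ _ (Units.inv_mul _)⟩, ?_⟩, rfl⟩
  have h1 : D.adj R g.1.val * g.1.val = 1 := g.2
  change D.adj R ((e ⊗ₜ[F] (1 : B)) * g.1.val + ((1 - e) ⊗ₜ[F] (1 : B))) * _ = 1
  have h2 : D.adj R ((1 - e) ⊗ₜ[F] (1 : B)) = (1 - e) ⊗ₜ[F] (1 : B) := by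
    simp [adj, D.inv_one]
  rw [map_add, adj_tmul_one_mul, h2]
  exact key _ _ h1

/-- The element of `G(𝔸_F^∞)` with the component of `g` at `v` and trivial components elsewhere. -/
theorem exists_component (v : HeightOneSpectrum (𝓞 F)) (g : D.GA) :
    ∃ h : D.GA, D.proj v h = D.proj v g ∧ ∀ v', v' ≠ v → D.proj v' h = 1 := by
  obtain ⟨h, hh⟩ := D.exists_glue (idemAt_mul_self v) g
  have key : ∀ v', (D.proj v' h).1.val = (evalAt F v' (idemAt v) ⊗ₜ[F] (1 : B)) *
      (D.proj v' g).1.val + ((1 - evalAt F v' (idemAt v)) ⊗ₜ[F] (1 : B)) := by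
    intro v'
    change Algebra.TensorProduct.map (evalAt F v') (AlgHom.id F B) h.1.val = _
    rw [hh, map_add, map_mul, Algebra.TensorProduct.map_tmul, Algebra.TensorProduct.map_tmul,
      map_one, map_sub, map_one]
    rfl
  refine ⟨h, Subtype.ext (Units.ext ?_), fun v' hv' => Subtype.ext (Units.ext ?_)⟩
  · rw [key, evalAt_idemAt_same, sub_self, TensorProduct.zero_tmul, add_zero,
      ← Algebra.TensorProduct.one_def, one_mul]
  · rw [key, evalAt_idemAt_of_ne hv', TensorProduct.zero_tmul, zero_mul, zero_add, sub_zero]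
    rfl

theorem commute_of_proj {v : HeightOneSpectrum (𝓞 F)} {g h : D.GA}
    (hg : ∀ v', v' ≠ v → D.proj v' g = 1) (hh : D.proj v h = 1) : Commute g h := by
  refine D.proj_ext fun v' => ?_
  rw [map_mul, map_mul]
  by_cases e : v' = v
  · rw [e, hh, mul_one, one_mul]
  · rw [hg v' e, mul_one, one_mul]

end UnitaryDatum

/-! ### Commutation of $U_l$ with the Hecke operators away from $l$ -/

namespace Level

variable {l : ℕ} [Fact l.Prime] {D : UnitaryDatum F M B n} (P : Level D l)

theorem mem_U_iff {g : D.GA} : g ∈ P.U ↔ ∀ v, D.proj v g ∈ P.Uv v := by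
  simp [U, Subgroup.mem_iInf]

/-- As $U$ is the product of its local components, the component of $c$ at $v$, extended by $1$, is
again in $U$. This allows coset representatives with prescribed support. -/
theorem exists_factorization (v : HeightOneSpectrum (𝓞 F)) (c : P.U) :
    ∃ a b : P.U, c = a * b ∧ (∀ v', v' ≠ v → D.proj v' a = 1) ∧ D.proj v b = 1 := by
  obtain ⟨h, h1, h2⟩ := D.exists_component v c
  have hU : h ∈ P.U := P.mem_U_iff.mpr fun v' => by
    by_cases e : v' = v
    · rw [e, h1]; exact P.mem_U c.2 v
    · rw [h2 v' e]; exact one_mem _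
  exact ⟨⟨h, hU⟩, ⟨h, hU⟩⁻¹ * c, by group, h2, by simp [h1]⟩

theorem mem_cosetStab_of_commute {𝒢 : Type*} [Group 𝒢] {U : Subgroup 𝒢} {g : 𝒢} {b : U}
    (h : Commute g b) : b ∈ cosetStab U g := by
  refine Subgroup.mem_subgroupOf.mpr ⟨b, b.2, ?_⟩
  simp [h.eq]

theorem rep_comp_twistY (χ : ∀ w : P.Sl, TameChar n l w.1)
    (a : (M →+* PadicAlgCl l) → Fin n → ℤ) (A : Type*) [CommRing A] [Algebra (OK l) A]
    {b : P.Sl → Fin n → ℕ} (hb : ∀ w, Antitone (b w)) {g : D.GA} (hg : P.IsDiagAt g b)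
    (k k' : P.U) (h : (k : D.GA) * g = g * k') :
    P.rep χ a A k ∘ₗ (P.twistY a b hb).baseChange A =
      (P.twistY a b hb).baseChange A ∘ₗ P.rep χ a A k' := by
  change (P.repY χ a k).baseChange A ∘ₗ _ = _ ∘ₗ (P.repY χ a k').baseChange A
  rw [← LinearMap.baseChange_comp, ← LinearMap.baseChange_comp, P.twist_compat χ a b hb hg k k' h]

/-- The element $g$ lives at a place $v\nmid l$ where $u$ is trivial. Representatives for $UgU$ are
taken at $v$ and those for $UuU$ away from $v$, so all group elements involved in one operator
commute with those of the other; on coefficients $g$ acts as the identity by `htw`. -/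
theorem commute_heckeGen (χ : ∀ w : P.Sl, TameChar n l w.1)
    (a : (M →+* PadicAlgCl l) → Fin n → ℤ) (A : Type*) [CommRing A] [Algebra (OK l) A]
    {u : D.GA} (hu : P.IsUlElement u) {g : D.GA} (hg : P.IsHeckeElement g)
    (htw : P.twistY a (fun _ _ => 0) (fun _ => antitone_const) = 1) :
    Commute (P.heckeGen χ a A g hg) (P.hecke χ a A u P.stdExp P.stdExp_antitone hu.2) := by
  obtain ⟨v, hv, hgv⟩ : ∃ v : HeightOneSpectrum (𝓞 F), (l : 𝓞 F) ∉ v.asIdeal ∧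
      ∀ v', v' ≠ v → D.proj v' g = 1 := by
    obtain ⟨w, hw, hw', ϖ, j, hl, -, -, -, -, h⟩ := hg
    refine ⟨below F w, hl, fun v' hv' => ?_⟩
    rcases h with h | ⟨-, h⟩
    · exact h.1 v' hv'
    · simpa using h.1 v' hv'
  have huv : D.proj v u = 1 := hu.1 v hv
  refine heckeOperator_commute (P.rep_comp_twistY χ a A _ hg.isDiagAt)
    (P.rep_comp_twistY χ a A _ hu.2) {c | ∀ v', v' ≠ v → D.proj v' c = 1} {d | D.proj v d = 1}
    (fun c => ?_) (fun d => ?_) (fun c hc d hd => Subtype.ext (D.commute_of_proj hc hd))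
    (fun d hd => D.commute_of_proj hgv hd) (fun c hc => D.commute_of_proj hc huv)
    (D.commute_of_proj hgv huv) ?_
  -- The factor $y$ trivial at $v$ commutes with $g$, hence lies in $U\cap gUg^{-1}$ and does not
  -- change the coset; for $u$ it is the factor at $v$ that drops out.
  · obtain ⟨x, y, rfl, hx, hy⟩ := P.exists_factorization v c
    refine ⟨x, hx, QuotientGroup.eq.mpr ?_⟩
    rw [inv_mul_cancel_left]
    exact mem_cosetStab_of_commute (D.commute_of_proj hgv hy)
  · obtain ⟨x, y, rfl, hx, hy⟩ := P.exists_factorization v d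
    refine ⟨y, hy, QuotientGroup.eq.mpr ?_⟩
    have e : x * y = y * x := Subtype.ext (D.commute_of_proj hx hy).eq
    rw [e, inv_mul_cancel_left]
    exact mem_cosetStab_of_commute (D.commute_of_proj hx huv).symm
  · rw [htw]
    have : (1 : Module.End (OK l) (P.Y a)).baseChange A = 1 := LinearMap.baseChange_id ..
    rw [this]
    exact Commute.one_left _

end Level

end Adelic

/-! ## Tensor products of lattices modulo the maximal ideal -/

section PiTensor

/-- When $x-dy$ is in the maximal ideal this exhibits the error term in the shape required by
`baseChange_piTensor_map_congr`. -/
theorem smul_eq_smul_add {R V : Type*} [CommRing R] [AddCommGroup V] [Module R V] (x d y : R)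
    (v : V) : x • v = d • y • v + (x - d * y) • v := by
  module

variable {ι R : Type*} [CommRing R] {X X' : ι → Type*} [∀ i, AddCommGroup (X i)]
  [∀ i, Module R (X i)] [∀ i, AddCommGroup (X' i)] [∀ i, Module R (X' i)]

theorem piTensor_map_smul [Fintype ι] (c : ι → R) (φ : ∀ i, X i →ₗ[R] X' i) :
    PiTensorProduct.map (fun i => c i • φ i) = (∏ i, c i) • PiTensorProduct.map φ := by
  refine PiTensorProduct.ext (MultilinearMap.ext fun y => ?_)
  simp only [LinearMap.compMultilinearMap_apply, PiTensorProduct.map_tprod, LinearMap.smul_apply]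
  exact MultilinearMap.map_smul_univ _ _ _

/-- Families of maps which agree modulo the maximal ideal have the same tensor product over the
residue field. -/
theorem baseChange_piTensor_map_congr [IsLocalRing R] [Finite ι] {φ ψ : ∀ i, X i →ₗ[R] X' i}
    (h : ∀ i x, ∃ c ∈ IsLocalRing.maximalIdeal R, ∃ r, φ i x = ψ i x + c • r) :
    (PiTensorProduct.map φ).baseChange (IsLocalRing.ResidueField R) =
      (PiTensorProduct.map ψ).baseChange (IsLocalRing.ResidueField R) := by
  classical
  have := Fintype.ofFinite ι
  -- The factors are replaced one at a time. Each replacement changes the pure tensor by $c$ times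
  -- another one, and $c$ is zero in the residue field.
  have key : ∀ (y : ∀ i, X i) (s : Finset ι),
      (1 : IsLocalRing.ResidueField R) ⊗ₜ[R] PiTensorProduct.tprod R (fun i => φ i (y i)) =
        1 ⊗ₜ[R] PiTensorProduct.tprod R
          (s.piecewise (fun i => ψ i (y i)) fun i => φ i (y i)) := by
    intro y s
    induction s using Finset.induction_on with
    | empty => simp
    | insert i s hi ih =>
      rw [ih, Finset.piecewise_insert]
      set z := s.piecewise (fun i => ψ i (y i)) fun i => φ i (y i) with hz
      obtain ⟨c, hc, r, hr⟩ := h i (y i)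
      have hzi : z i = ψ i (y i) + c • r := by
        rw [hz, Finset.piecewise_eq_of_notMem _ _ _ hi, hr]
      conv_lhs => rw [← Function.update_eq_self i z, hzi]
      rw [MultilinearMap.map_update_add, MultilinearMap.map_update_smul, TensorProduct.tmul_add,
        ← TensorProduct.smul_tmul]
      have : c • (1 : IsLocalRing.ResidueField R) = 0 := by
        rw [Algebra.smul_def, mul_one]
        exact (IsLocalRing.residue_eq_zero_iff c).mpr hc
      rw [this, TensorProduct.zero_tmul, add_zero]
  refine TensorProduct.AlgebraTensorModule.curry_injective (LinearMap.ext_ring ?_)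
  refine PiTensorProduct.ext (MultilinearMap.ext fun y => ?_)
  have := key y Finset.univ
  rw [Finset.piecewise_univ] at this
  simpa using this

end PiTensor

/-! ## Reduction of the weight to zero -/

section Unitary

set_option linter.unusedSectionVars false

open IsDedekindDomain

variable {F : Type*} {M : Type*} [Field F] [NumberField F] [Field M] [NumberField M] [Algebra F M]
  {B : Type*} [DivisionRing B] [Algebra M B] [Algebra F B] [IsScalarTower F M B] {n : ℕ}
  {l : ℕ} [Fact l.Prime]

theorem residue_OK_eq_zero {x : OK l} (hx : ‖(x : PadicAlgCl l)‖ < 1) :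
    IsLocalRing.residue (OK l) x = 0 := by
  rw [IsLocalRing.residue_eq_zero_iff, IsLocalRing.mem_maximalIdeal, mem_nonunits_iff]
  intro hu
  obtain ⟨y, hy⟩ := hu.exists_right_inv
  have h1 : ‖(y : PadicAlgCl l)‖ ≤ 1 := y.2
  have h2 := congrArg (fun z : OK l => ‖(z : PadicAlgCl l)‖) hy
  simp only [MulMemClass.coe_mul, norm_mul, OneMemClass.coe_one, norm_one] at h2
  nlinarith [norm_nonneg (x : PadicAlgCl l), norm_nonneg (y : PadicAlgCl l)]

/-- Embeddings are only assumed continuous: $x^k\to0$ gives $\|\tau(x)\|^k\to0$, which forces the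
norm below $1$. -/
theorem Emb.norm_lt_one {w : HeightOneSpectrum (𝓞 M)} (τ : Emb l w) {x : w.adicCompletion M}
    (hx : Valued.v x < 1) : ‖τ.1 x‖ < 1 := by
  have h2 := (τ.2.tendsto 0).comp (Valued.tendsto_zero_pow_of_v_lt_one hx)
  have h3 : Filter.Tendsto (fun k : ℕ => ‖τ.1 x‖ ^ k) Filter.atTop (nhds 0) := by
    simpa [Function.comp_def] using h2.norm
  have h4 := tendsto_pow_atTop_nhds_zero_iff.mp h3
  rwa [abs_of_nonneg (norm_nonneg _)] at h4

theorem Emb.residue_int_eq_zero {w : HeightOneSpectrum (𝓞 M)} (hl : (l : 𝓞 M) ∈ w.asIdeal)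
    (τ : Emb l w) {x : w.adicCompletionIntegers M} (hx : Valued.v (x : w.adicCompletion M) < 1) :
    IsLocalRing.residue (OK l) (τ.int hl x) = 0 :=
  residue_OK_eq_zero (τ.norm_lt_one hx)

theorem residue_adic_eq_zero_iff {w : HeightOneSpectrum (𝓞 M)} {x : w.adicCompletionIntegers M} :
    IsLocalRing.residue _ x = 0 ↔ Valued.v (x : w.adicCompletion M) < 1 := by
  rw [IsLocalRing.residue_eq_zero_iff, IsLocalRing.mem_maximalIdeal, mem_nonunits_iff,
    HeightOneSpectrum.adicCompletionIntegers.isUnit_iff_valued_eq_one]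
  exact ⟨fun h => lt_of_le_of_ne x.2 h, ne_of_lt⟩

variable (l) in
/-- The projection of `X_t` to `X_0` through the coefficient of the lowest weight vector. -/
noncomputable def lowProj (t : Fin n → ℤ) : XLattice l t →ₗ[OK l] XLattice l (0 : Fin n → ℤ) :=
  (lowCoeff l t).smulRight (oneVec l n)

/-- The inclusion of `X_0` in `X_t` as the multiples of the lowest weight vector. -/
noncomputable def lowIncl {t : Fin n → ℤ} (ht : 0 ≤ weightDiff t) :
    XLattice l (0 : Fin n → ℤ) →ₗ[OK l] XLattice l t :=
  (lowCoeff l 0).smulRight ⟨lowVec l t, Submodule.subset_span (lowVec_mem ht)⟩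

theorem lowProj_apply (t : Fin n → ℤ) (f : XLattice l t) :
    lowProj l t f = lowCoeff l t f • oneVec l n := rfl

theorem lowCoeff_lowProj (t : Fin n → ℤ) (f : XLattice l t) :
    lowCoeff l 0 (lowProj l t f) = lowCoeff l t f := by
  rw [lowProj_apply, LinearMap.map_smul, lowCoeff_oneVec, smul_eq_mul, mul_one]

theorem lowProj_comp_lowIncl {t : Fin n → ℤ} (ht : 0 ≤ weightDiff t) :
    lowProj l t ∘ₗ lowIncl ht = LinearMap.id := by
  refine LinearMap.ext fun f => ?_
  have h : lowCoeff l t ⟨lowVec l t, Submodule.subset_span (lowVec_mem ht)⟩ = 1 :=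
    Subtype.ext evalMat_lowVec
  have h2 : lowIncl ht f =
    lowCoeff l 0 f • ⟨lowVec l t, Submodule.subset_span (lowVec_mem ht)⟩ := rfl
  rw [LinearMap.comp_apply, h2, LinearMap.map_smul, lowProj_apply, h, one_smul,
    lowCoeff_smul_oneVec, LinearMap.id_apply]

/-! ### The projection to the lowest weight vectors on $Y_a$ -/

namespace Level

variable {D : UnitaryDatum F M B n} (P : Level D l)

theorem stdExp_strictAnti (w : P.Sl) : StrictAnti (P.stdExp w) := by
  intro i j h
  rw [Fin.lt_def] at h
  have := j.2
  simp only [stdExp]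
  omega

/-- The factor at `τ` of the value of the character `χ_a` at `u`. -/
noncomputable def wtFactor (T : ∀ w : P.Sl, TeichmullerLift w.1)
    (a : (M →+* PadicAlgCl l) → Fin n → ℤ) (u : P.U) (τ : P.Idx) : (OK l)ˣ :=
  ∏ i : Fin n, (Units.map (τ.2.int (P.l_mem τ.1) : _ →* _)
    ((T τ.1).toHom (diagResidue τ.1.1 i (P.compU τ.1 u)))) ^ P.wt a τ i.rev

theorem chi_mul_chiWt [inst : Fintype P.Idx] (T : ∀ w : P.Sl, TeichmullerLift w.1)
    (χ : ∀ w : P.Sl, TameChar n l w.1) (a : (M →+* PadicAlgCl l) → Fin n → ℤ) (u : P.U) :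
    P.chi (χ * P.chiWt T a) u = P.chi χ u * ∏ τ, P.wtFactor T a u τ := by
  classical
  have (w : P.Sl) : Fintype (Emb l w.1) := Fintype.ofFinite _
  have e : ∏ τ, P.wtFactor T a u τ = ∏ w : P.Sl, (P.chiWt T a w).toHom (P.compU w u) := by
    -- The given `Fintype` instance is exchanged for that of a sigma type, so the product over
    -- $\tilde I_l$ splits over places and then over embeddings of $M_w$.
    rw [Subsingleton.elim inst Sigma.instFintype, Fintype.prod_sigma]
    exact Finset.prod_congr rfl fun w _ =>
      (finprod_eq_prod_of_fintype fun τ : Emb l w.1 => P.wtFactor T a u ⟨w, τ⟩).symm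
  rw [e]
  simp only [chi, MonoidHom.finsetProd_apply, MonoidHom.comp_apply]
  rw [← Finset.prod_mul_distrib]
  rfl

/-- A diagonal entry and the lift of its residue differ by an element of the maximal ideal of
$\mathcal{O}_{M,w}$, which $\tau$ maps into that of $\mathcal{O}$. -/
theorem residue_matAt_diag (T : ∀ w : P.Sl, TeichmullerLift w.1) (u : P.U) (τ : P.Idx) (i : Fin n) :
    IsLocalRing.residue (OK l) ⟨P.matAt τ u i i, P.matAt_mem τ u i i⟩ =
      IsLocalRing.residue (OK l) (τ.2.int (P.l_mem τ.1)
        ((T τ.1).toHom (diagResidue τ.1.1 i (P.compU τ.1 u))).val) := by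
  set x : τ.1.1.adicCompletionIntegers M :=
    ⟨(P.compU τ.1 u).1.val i i, (P.compU τ.1 u).2.1.1 i i⟩ with hx
  set y := ((T τ.1).toHom (diagResidue τ.1.1 i (P.compU τ.1 u))).val
  have h1 : IsLocalRing.residue _ y = IsLocalRing.residue _ x :=
    (T τ.1).residue_toHom _
  have h2 : IsLocalRing.residue _ (x - y) = 0 := by rw [map_sub, h1, sub_self]
  have h3 := τ.2.residue_int_eq_zero (P.l_mem τ.1) (residue_adic_eq_zero_iff.mp h2)
  rw [map_sub, map_sub, sub_eq_zero] at h3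
  exact h3

theorem residue_matAt_lower (u : P.U) (τ : P.Idx) {i j : Fin n} (h : j < i) :
    IsLocalRing.residue (OK l) ⟨P.matAt τ u i j, P.matAt_mem τ u i j⟩ = 0 :=
  residue_OK_eq_zero (τ.2.norm_lt_one ((P.compU τ.1 u).2.1.2 i j h))

/-- The projection of `X_{a_τ}` to `X_0` through the lowest weight vector. -/
noncomputable def projX (a : (M →+* PadicAlgCl l) → Fin n → ℤ) (τ : P.Idx) :
    XLattice l (P.wt a τ) →ₗ[OK l] XLattice l (P.wt 0 τ) := lowProj l (P.wt a τ)

/-- The inclusion of `X_0` in `X_{a_τ}` through the lowest weight vector. -/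
noncomputable def inclX {a : (M →+* PadicAlgCl l) → Fin n → ℤ}
    (ha : ∀ τ : P.Idx, 0 ≤ weightDiff (P.wt a τ)) (τ : P.Idx) :
    XLattice l (P.wt 0 τ) →ₗ[OK l] XLattice l (P.wt a τ) := lowIncl (ha τ)

theorem projX_comp_inclX {a : (M →+* PadicAlgCl l) → Fin n → ℤ}
    (ha : ∀ τ : P.Idx, 0 ≤ weightDiff (P.wt a τ)) (τ : P.Idx) :
    P.projX a τ ∘ₗ P.inclX ha τ = LinearMap.id := lowProj_comp_lowIncl (ha τ)

/-- Both terms are multiples of the generator $1$ of $X_0$, so the error is the difference of two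
scalars; `residue_lowCoeff_latticeAct` puts it in the maximal ideal. -/
theorem projX_actX (T : ∀ w : P.Sl, TeichmullerLift w.1)
    (a : (M →+* PadicAlgCl l) → Fin n → ℤ) (u : P.U) (τ : P.Idx) (f : XLattice l (P.wt a τ)) :
    ∃ c ∈ IsLocalRing.maximalIdeal (OK l), ∃ r, P.projX a τ (P.actX a u τ f) =
      (P.wtFactor T a u τ).val • P.projX a τ f + c • r := by
  let d₀ : Fin n → (OK l)ˣ := fun i =>
    Units.map (τ.2.int (P.l_mem τ.1) : τ.1.1.adicCompletionIntegers M →* OK l)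
      ((T τ.1).toHom (diagResidue τ.1.1 i (P.compU τ.1 u)))
  let d : Fin n → (kbar l)ˣ := fun i =>
    Units.map (IsLocalRing.residue (OK l) : OK l →* kbar l) (d₀ i)
  refine ⟨lowCoeff l _ (P.actX a u τ f) - (P.wtFactor T a u τ).val * lowCoeff l _ f, ?_,
    oneVec l n, smul_eq_smul_add _ _ _ _⟩
  rw [← IsLocalRing.residue_eq_zero_iff, map_sub, map_mul, sub_eq_zero]
  refine (residue_lowCoeff_latticeAct (P.matAt_mem τ u) (d := d)
    (fun i => P.residue_matAt_diag T u τ i) (fun i j h => P.residue_matAt_lower u τ h) f).trans ?_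
  have e : ∏ i, d i ^ P.wt a τ i.rev =
      Units.map (IsLocalRing.residue (OK l) : OK l →* kbar l) (P.wtFactor T a u τ) := by
    rw [wtFactor, map_prod]
    exact Finset.prod_congr rfl fun i _ => (map_zpow _ (d₀ i) _).symm
  rw [e]
  rfl

/-- The projection of `Y_a` to `Y_0` through the lowest weight vectors. -/
noncomputable def projY (a : (M →+* PadicAlgCl l) → Fin n → ℤ) : P.Y a →ₗ[OK l] P.Y 0 :=
  PiTensorProduct.map (P.projX a)

/-- The inclusion of `Y_0` in `Y_a` through the lowest weight vectors. -/
noncomputable def inclY {a : (M →+* PadicAlgCl l) → Fin n → ℤ}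
    (ha : ∀ τ : P.Idx, 0 ≤ weightDiff (P.wt a τ)) : P.Y 0 →ₗ[OK l] P.Y a :=
  PiTensorProduct.map (P.inclX ha)

theorem projY_comp_inclY {a : (M →+* PadicAlgCl l) → Fin n → ℤ}
    (ha : ∀ τ : P.Idx, 0 ≤ weightDiff (P.wt a τ)) : P.projY a ∘ₗ P.inclY ha = LinearMap.id := by
  rw [projY, inclY, ← PiTensorProduct.map_comp]
  simp only [projX_comp_inclX]
  exact PiTensorProduct.map_id

theorem piTensor_map_eq_id {a : (M →+* PadicAlgCl l) → Fin n → ℤ}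
    {φ : ∀ τ : P.Idx, Module.End (OK l) (XLattice l (P.wt a τ))}
    (h : ∀ τ, φ τ = LinearMap.id) : PiTensorProduct.map φ = LinearMap.id := by
  rw [show φ = fun τ => LinearMap.id from funext h]
  exact PiTensorProduct.map_id

theorem twistY_weight_zero (b : P.Sl → Fin n → ℕ) (hb : ∀ w, Antitone (b w)) :
    P.twistY 0 b hb = LinearMap.id :=
  P.piTensor_map_eq_id fun τ => twistAct_weight_zero (hb τ.1)

theorem twistY_exp_zero (a : (M →+* PadicAlgCl l) → Fin n → ℤ) :
    P.twistY a (fun _ _ => 0) (fun _ => antitone_const) = LinearMap.id :=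
  P.piTensor_map_eq_id fun τ => twistAct_exp_zero (P.wt a τ)

/-- The factorization $\iota\circ p$ on which the proof rests: `twistAct_sub_mem` at each $\tau$,
with error divisible by $l$, passes to the tensor product over $k$. -/
theorem baseChange_twistY {a : (M →+* PadicAlgCl l) → Fin n → ℤ}
    (ha : ∀ τ : P.Idx, 0 ≤ weightDiff (P.wt a τ)) :
    (P.twistY a P.stdExp P.stdExp_antitone).baseChange (kbar l) =
      (P.inclY ha).baseChange (kbar l) ∘ₗ (P.projY a).baseChange (kbar l) := by
  rw [← LinearMap.baseChange_comp, inclY, projY, ← PiTensorProduct.map_comp, twistY]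
  refine baseChange_piTensor_map_congr fun τ f => ⟨l, ?_, ?_⟩
  · rw [← IsLocalRing.residue_eq_zero_iff]
    refine residue_OK_eq_zero ?_
    have hn : ‖(l : PadicAlgCl l)‖ = (l : ℝ)⁻¹ := by
      have := PadicAlgCl.norm_extends l (l : ℚ_[l])
      simpa using this
    have hl : (1 : ℝ) < l := by exact_mod_cast (Fact.out : l.Prime).one_lt
    exact hn.trans_lt (inv_lt_one_of_one_lt₀ hl)
  · obtain ⟨r, hr⟩ := twistAct_sub_mem (ha τ) (P.stdExp_strictAnti τ.1) f
    refine ⟨r, hr.trans ?_⟩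
    rw [← lowCoeff_lowProj]
    rfl

theorem actX_zero (u : P.U) (τ : P.Idx) : P.actX 0 u τ = LinearMap.id :=
  latticeAct_zero (P.matAt_mem τ u)

theorem repY_zero (χ : ∀ w : P.Sl, TameChar n l w.1) (u : P.U) :
    P.repY χ 0 u = (P.chi χ u).val • LinearMap.id := by
  rw [repY_apply, P.piTensor_map_eq_id (P.actX_zero u)]

theorem baseChange_projY_comp_actX [Fintype P.Idx] (T : ∀ w : P.Sl, TeichmullerLift w.1)
    (a : (M →+* PadicAlgCl l) → Fin n → ℤ) (u : P.U) :
    (P.projY a ∘ₗ PiTensorProduct.map (P.actX a u)).baseChange (kbar l) =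
      ((∏ τ, P.wtFactor T a u τ : (OK l)ˣ).val • P.projY a).baseChange (kbar l) := by
  rw [projY, ← PiTensorProduct.map_comp, Units.coe_prod, ← piTensor_map_smul]
  exact baseChange_piTensor_map_congr fun τ f => P.projX_actX T a u τ f

/-- Here the twist by $\chi_a$ arises: $U$ acts on $Y_0$ by scalars, and the product over $\tau$ of
the scalars from `projX_actX` is $\chi_a(u)$. -/
theorem baseChange_projY_comp_rep (T : ∀ w : P.Sl, TeichmullerLift w.1)
    (χ : ∀ w : P.Sl, TameChar n l w.1) (a : (M →+* PadicAlgCl l) → Fin n → ℤ) (u : P.U) :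
    (P.projY a).baseChange (kbar l) ∘ₗ P.rep χ a (kbar l) u =
      P.rep (χ * P.chiWt T a) 0 (kbar l) u ∘ₗ (P.projY a).baseChange (kbar l) := by
  have := Fintype.ofFinite P.Idx
  change _ ∘ₗ (P.repY χ a u).baseChange _ = (P.repY _ 0 u).baseChange _ ∘ₗ _
  rw [← LinearMap.baseChange_comp, ← LinearMap.baseChange_comp]
  have e1 : P.projY a ∘ₗ P.repY χ a u =
      (P.chi χ u).val • (P.projY a ∘ₗ PiTensorProduct.map (P.actX a u)) := by
    rw [repY_apply, LinearMap.comp_smul]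
  have e2 : P.repY (χ * P.chiWt T a) 0 u ∘ₗ P.projY a =
      (P.chi χ u).val • ((∏ τ, P.wtFactor T a u τ : (OK l)ˣ).val • P.projY a) := by
    rw [repY_zero, LinearMap.smul_comp, LinearMap.id_comp, chi_mul_chiWt, Units.val_mul, mul_smul]
  rw [e1, e2, LinearMap.baseChange_smul, P.baseChange_projY_comp_actX T,
    ← LinearMap.baseChange_smul]

/-- Each factor of a tensor of monomials is evaluated at $w$, giving $1$ or $0$; a single non-lowest
factor makes the whole tensor vanish. -/
theorem isLowestWeightProjection_projY (a : (M →+* PadicAlgCl l) → Fin n → ℤ) :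
    P.IsLowestWeightProjection a ((P.projY a).baseChange (kbar l)) := by
  classical
  intro y hy
  have h : (P.projY a).baseChange (kbar l) (1 ⊗ₜ PiTensorProduct.tprod _ y) =
      1 ⊗ₜ PiTensorProduct.tprod _ fun τ => P.projX a τ (y τ) := by
    rw [LinearMap.baseChange_tmul, projY, PiTensorProduct.map_tprod]
  refine ⟨fun hr => ?_, fun hr => ?_⟩
  · rw [h]
    congr 2
    funext τ
    have e : lowCoeff l _ (y τ) = 1 := Subtype.ext (evalMat_of_isRightWeight (hy τ) (hr τ))
    change lowCoeff l _ (y τ) • oneVec l n = oneVec l n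
    rw [e, one_smul]
  · obtain ⟨τ, hτ⟩ := not_forall.mp hr
    have e : lowCoeff l _ (y τ) = 0 := Subtype.ext (evalMat_of_not_isRightWeight (hy τ) hτ)
    have e' : P.projX a τ (y τ) = 0 := by
      change lowCoeff l _ (y τ) • oneVec l n = 0
      rw [e, zero_smul]
    rw [h, MultilinearMap.map_coord_zero _ τ e', TensorProduct.tmul_zero]

end Level

end Unitary

/-! ### The isomorphism of ordinary parts and its Hecke equivariance -/

section Unitary

set_option linter.unusedSectionVars false

open IsDedekindDomain

variable {F : Type*} {M : Type*} [Field F] [NumberField F] [Field M] [NumberField M] [Algebra F M]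
  {B : Type*} [DivisionRing B] [Algebra M B] [Algebra F B] [IsScalarTower F M B] {n : ℕ}
  {l : ℕ} [Fact l.Prime]

namespace Level

variable {D : UnitaryDatum F M B n} (P : Level D l)

/-- Composition of forms with the projection to the lowest weight vectors. -/
noncomputable def projForms (T : ∀ w : P.Sl, TeichmullerLift w.1)
    (χ : ∀ w : P.Sl, TameChar n l w.1) (a : (M →+* PadicAlgCl l) → Fin n → ℤ) :
    P.S χ a (kbar l) →ₗ[kbar l] P.S (χ * P.chiWt T a) 0 (kbar l) :=
  formsMap D.GF ((P.projY a).baseChange (kbar l)) (P.baseChange_projY_comp_rep T χ a)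

/-- `exists_ordinaryPart_equiv` applies since $\iota\circ p$ is the coefficient map of $U_l$ in
weight $a$, and $p\circ\iota=1$ is the one in weight $0$, where the twisted action is trivial. -/
theorem exists_sord_equiv (T : ∀ w : P.Sl, TeichmullerLift w.1)
    (χ : ∀ w : P.Sl, TameChar n l w.1) {a : (M →+* PadicAlgCl l) → Fin n → ℤ}
    (ha : ∀ τ : P.Idx, 0 ≤ weightDiff (P.wt a τ)) {u : D.GA} (hu : P.IsUlElement u) :
    ∃ φ : P.Sord χ a (kbar l) u hu ≃ₗ[kbar l] P.Sord (χ * P.chiWt T a) 0 (kbar l) u hu,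
      ∀ f, (φ f).1 = P.projForms T χ a f.1 := by
  have hpi : (P.projY a).baseChange (kbar l) ∘ₗ (P.inclY ha).baseChange (kbar l) =
      LinearMap.id := by
    rw [← LinearMap.baseChange_comp, P.projY_comp_inclY ha]
    exact LinearMap.baseChange_id ..
  have hsurj : Function.Surjective ((P.projY a).baseChange (kbar l)) :=
    fun v => ⟨(P.inclY ha).baseChange (kbar l) v, LinearMap.congr_fun hpi v⟩
  have hpi' : (P.projY a).baseChange (kbar l) ∘ₗ (P.inclY ha).baseChange (kbar l) =
      (P.twistY 0 P.stdExp P.stdExp_antitone).baseChange (kbar l) := by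
    rw [P.twistY_weight_zero, hpi]
    exact (LinearMap.baseChange_id ..).symm
  exact exists_ordinaryPart_equiv (Γ := D.GF) (P.baseChange_projY_comp_rep T χ a) hsurj
    (P.baseChange_twistY ha) hpi'
    (P.rep_comp_twistY χ a (kbar l) P.stdExp_antitone hu.2)
    (P.rep_comp_twistY (χ * P.chiWt T a) 0 (kbar l) P.stdExp_antitone hu.2)

/-- The exponents at $l$ are all $0$, so the generator acts as the identity on both coefficient
modules and commutes with $p$. -/
theorem projForms_heckeGen (T : ∀ w : P.Sl, TeichmullerLift w.1)
    (χ : ∀ w : P.Sl, TameChar n l w.1) (a : (M →+* PadicAlgCl l) → Fin n → ℤ)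
    {g : D.GA} (hg : P.IsHeckeElement g) (f : P.S χ a (kbar l)) :
    P.projForms T χ a (P.heckeGen χ a (kbar l) g hg f) =
      P.heckeGen (χ * P.chiWt T a) 0 (kbar l) g hg (P.projForms T χ a f) := by
  have h : (P.projY a).baseChange (kbar l) ∘ₗ
      (P.twistY a (fun _ _ => 0) (fun _ => antitone_const)).baseChange (kbar l) =
      (P.twistY 0 (fun _ _ => 0) (fun _ => antitone_const)).baseChange (kbar l) ∘ₗ
        (P.projY a).baseChange (kbar l) := by
    rw [← LinearMap.baseChange_comp, ← LinearMap.baseChange_comp, P.twistY_exp_zero,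
      P.twistY_exp_zero, LinearMap.comp_id, LinearMap.id_comp]
  exact formsMap_heckeOperator (P.baseChange_projY_comp_rep T χ a) h
    (P.rep_comp_twistY χ a (kbar l) _ hg.isDiagAt)
    (P.rep_comp_twistY (χ * P.chiWt T a) 0 (kbar l) _ hg.isDiagAt) f

/-- The isomorphism of ordinary parts induced by the projection to the lowest weight vectors. -/
noncomputable def sordEquiv (T : ∀ w : P.Sl, TeichmullerLift w.1)
    (χ : ∀ w : P.Sl, TameChar n l w.1) {a : (M →+* PadicAlgCl l) → Fin n → ℤ}
    (ha : ∀ τ : P.Idx, 0 ≤ weightDiff (P.wt a τ)) {u : D.GA} (hu : P.IsUlElement u) :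
    P.Sord χ a (kbar l) u hu ≃ₗ[kbar l] P.Sord (χ * P.chiWt T a) 0 (kbar l) u hu :=
  (P.exists_sord_equiv T χ ha hu).choose

theorem sordEquiv_apply (T : ∀ w : P.Sl, TeichmullerLift w.1)
    (χ : ∀ w : P.Sl, TameChar n l w.1) {a : (M →+* PadicAlgCl l) → Fin n → ℤ}
    (ha : ∀ τ : P.Idx, 0 ≤ weightDiff (P.wt a τ)) {u : D.GA} (hu : P.IsUlElement u)
    (f : P.Sord χ a (kbar l) u hu) : (P.sordEquiv T χ ha hu f).1 = P.projForms T χ a f.1 :=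
  (P.exists_sord_equiv T χ ha hu).choose_spec f

theorem heckeGen_mem_sord (χ : ∀ w : P.Sl, TameChar n l w.1)
    (a : (M →+* PadicAlgCl l) → Fin n → ℤ) (A : Type*) [CommRing A] [Algebra (OK l) A]
    {u : D.GA} (hu : P.IsUlElement u) {g : D.GA} (hg : P.IsHeckeElement g)
    {f : P.S χ a A} (hf : f ∈ P.Sord χ a A u hu) :
    P.heckeGen χ a A g hg f ∈ P.Sord χ a A u hu := by
  have h1 : P.twistY a (fun _ _ => 0) (fun _ => antitone_const) = 1 := P.twistY_exp_zero a
  have hc := P.commute_heckeGen χ a A hu hg h1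
  exact apply_mem_ordinaryPart hc hf

theorem sordEquiv_heckeGen (T : ∀ w : P.Sl, TeichmullerLift w.1)
    (χ : ∀ w : P.Sl, TameChar n l w.1) {a : (M →+* PadicAlgCl l) → Fin n → ℤ}
    (ha : ∀ τ : P.Idx, 0 ≤ weightDiff (P.wt a τ)) {u : D.GA} (hu : P.IsUlElement u)
    {g : D.GA} (hg : P.IsHeckeElement g) (f : P.Sord χ a (kbar l) u hu) :
    (P.sordEquiv T χ ha hu ⟨P.heckeGen χ a (kbar l) g hg f.1,
      P.heckeGen_mem_sord χ a (kbar l) hu hg f.2⟩).1 =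
      P.heckeGen (χ * P.chiWt T a) 0 (kbar l) g hg (P.sordEquiv T χ ha hu f).1 :=
  (P.sordEquiv_apply T χ ha hu _).trans ((P.projForms_heckeGen T χ a hg f.1).trans
    (congrArg (P.heckeGen (χ * P.chiWt T a) 0 (kbar l) g hg)
      (P.sordEquiv_apply T χ ha hu f)).symm)

end Level

end Unitary

end UnitaryHida

theorem mainTheorem8 {F M B : Type*} [Field F] [NumberField F] [NumberField.IsTotallyReal F]
    [Field M] [NumberField M] [NumberField.IsTotallyComplex M] [Algebra F M]
    [Algebra.IsQuadraticExtension F M] [DivisionRing B] [Algebra M B] [Algebra F B]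
    [IsScalarTower F M B] [Algebra.IsCentral M B] {n l : ℕ} [Fact l.Prime]
    (D : UnitaryHida.UnitaryDatum F M B n) (P : UnitaryHida.Level D l)
    (T : ∀ w : P.Sl, UnitaryHida.TeichmullerLift w.1)
    (χ : ∀ w : P.Sl, UnitaryHida.TameChar n l w.1)
    (a : (M →+* PadicAlgCl l) → Fin n → ℤ) (ha : P.IsWeight a)
    (u : D.GA) (hu : P.IsUlElement u) :
    ∃ (φ : P.Sord χ a (UnitaryHida.kbar l) u hu ≃ₗ[UnitaryHida.kbar l]
        P.Sord (χ * P.chiWt T a) 0 (UnitaryHida.kbar l) u hu)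
      (p : UnitaryHida.kbar l ⊗[UnitaryHida.OK l] P.Y a →ₗ[UnitaryHida.kbar l]
        UnitaryHida.kbar l ⊗[UnitaryHida.OK l] P.Y 0),
      P.IsLowestWeightProjection a p ∧
      (∀ f x, (φ f).1.1 x = p (f.1.1 x)) ∧
      ∀ (g : D.GA) (hg : P.IsHeckeElement g) (f : P.Sord χ a (UnitaryHida.kbar l) u hu),
        ∃ h : P.heckeGen χ a (UnitaryHida.kbar l) g hg f.1 ∈
            P.Sord χ a (UnitaryHida.kbar l) u hu,
          (φ ⟨P.heckeGen χ a (UnitaryHida.kbar l) g hg f.1, h⟩).1 =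
            P.heckeGen (χ * P.chiWt T a) 0 (UnitaryHida.kbar l) g hg (φ f).1 := by
  have hd : ∀ τ : P.Idx, 0 ≤ UnitaryHida.weightDiff (P.wt a τ) := fun τ =>
    UnitaryHida.weightDiff_nonneg (ha.1 τ).1 (ha.1 τ).2
  exact ⟨P.sordEquiv T χ hd hu, (P.projY a).baseChange (UnitaryHida.kbar l),
    P.isLowestWeightProjection_projY a,
    fun f x => congrFun (congrArg Subtype.val (P.sordEquiv_apply T χ hd hu f)) x,
    -- Stability of the target is contained in this equation: it identifies the generator applied to
    -- $\varphi(f)$ with a value of $\varphi$, and $\varphi$ is surjective.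
    fun g hg f => ⟨P.heckeGen_mem_sord χ a (UnitaryHida.kbar l) hu hg f.2,
      P.sordEquiv_heckeGen T χ hd hu hg f⟩⟩
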